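/- **Conventions.** Let $\mathcal A^{\mathbb Z}$ be the path algebra over $\mathbb Z$ of the quiver with vertices $0,1$ and arrows $\rho_1,\rho_3\colon 0\to 1$, $\rho_2,\rho_4\colon 1\to 0$ (products read left to right, $\iota_0,\iota_1$ the vertex idempotents), modulo $\rho_2\rho_1=\rho_3\rho_2=\rho_4\rho_3=\rho_1\rho_4=0$. With indices in $\mathbb Z/4$, it is free over $\mathbb Z$ with basis $\iota_0,\iota_1$ and the $\rho_i\rho_{i+1}\cdots\rho_{i+n}$, $n\ge 0$. Put $A=\mathcal A^{\mathbb Z}\otimes\mathbb Z[U]$ and let $\mathbf k=\mathbb Z[U]\iota_0\oplus\mathbb Z[U]\iota_1\subset A$. An *$A_\infty$-deformation of $\mathcal A^{\mathbb Z}$ over $\mathbb Z[U]$* is a sequence of $\mathbb Z[U]$-linear $\mathbf k$-bimodule maps $\mu_n\colon A^{\otimes_{\mathbf k} n}\to A$, $n\ge 1$, with $\mu_1=0$, $\mu_2$ the multiplication of $A$, $\mu_n(a_1,\dots,a_n)=0$ if $n\ge 3$ and some $a_i\in\mathbf k$, and for all $n$ $$\sum_{r+s+t=n,\ s\ge1}(-1)^{r+st}\mu_{r+1+t}\circ(\mathrm{Id}^{\otimes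 r}\otimes\mu_s\otimes\mathrm{Id}^{\otimes t})=0,$$ where all elements of $A$ are even for the sign rule. Let $G$ be the group of triples $(m;a,b)\in(\tfrac12\mathbb Z)^3$ with $a+b\in\mathbb Z$ and $m+\tfrac{(2a+1)(a+b+1)+1}{2}\in\mathbb Z$, with product $(m;a,b)(n;c,d)=(m+n+ad-bc;\,a+c,\,b+d)$. Put $\Gamma=G\times\mathbb Z$, $\lambda=(1;0,0)\times0$, and $$\gamma(\rho_1)=(-\tfrac12;\tfrac12,-\tfrac12)\times0,\quad \gamma(\rho_2)=(-\tfrac12;\tfrac12,\tfrac12)\times0,\quad \gamma(\rho_3)=(-\tfrac12;-\tfrac12,\tfrac12)\times0,\quad \gamma(\rho_4)=(-\tfrac32;-\tfrac12,-\tfrac12)\times1.$$ A deformation is *$\Gamma$-graded* if it comes with a decomposition $A=\bigoplus_{g\in\Gamma}A_g$ of abelian groups such that $\iota_0,\iota_1$ have grading the identity, $\rho_i$ has grading $\gamma(\rho_i)$ for $i=1,\dots,4$, and $\mu_n(a_1,\dots,a_n)$ has grading $\lambda^{n-2}g_1\cdots g_n$ whenever each $a_i$ is homogeneous of grading $g_i$.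 A *homomorphism* from $(A,\mu)$ to $(A,\mu')$ is a sequence of $\mathbb Z[U]$-linear $\mathbf k$-bimodule maps $f_n\colon A^{\otimes_{\mathbf k}n}\to A$, $n\ge1$, of degree $\lambda^{n-1}$, strictly unital ($f_1|_{\mathbf k}=\mathrm{Id}$ and $f_n(a_1,\dots,a_n)=0$ if $n\ge2$ and some $a_i\in\mathbf k$), with $$\sum_{r+s+t=n,\ s\ge1}(-1)^{r+st}f_{r+1+t}\circ(\mathrm{Id}^{\otimes r}\otimes\mu_s\otimes\mathrm{Id}^{\otimes t})=\sum_{i_1+\cdots+i_m=n}(-1)^{\sigma}\mu'_m\circ(f_{i_1}\otimes\cdots\otimes f_{i_m}),\qquad \sigma=\sum_{k=1}^{m-1}(m-k)(i_k-1),$$ for all $n$; homomorphisms are composed by $(g\circ f)_n=\sum_{i_1+\cdots+i_m=n}(-1)^{\sigma}g_m\circ(f_{i_1}\otimes\cdots\otimes f_{i_m})$. An *isomorphism of $\Gamma$-graded deformations* is a homomorphism with $f_1=\mathrm{Id}$ that has a two-sided inverse homomorphism. **Theorem.** Up to isomorphism of $\Gamma$-graded deformations, there is a unique $\Gamma$-graded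 $A_\infty$-deformation of $\mathcal A^{\mathbb Z}$ over $\mathbb Z[U]$ such that $$\mu_4(\rho_4,\rho_3,\rho_2,\rho_1)=U\iota_1\qquad\text{and}\qquad \mu_4(\rho_3,\rho_2,\rho_1,\rho_4)=U\iota_0.$$ That is, one exists, and any two are isomorphic. -/

import Mathlib

open scoped Polynomial

noncomputable section

namespace TorusAInf

/-! ### The grading group -/

/-- Rational triples `(m; a, b)`. -/
@[ext] structure Triple where
  m : ℚ
  a : ℚ
  b : ℚ

namespace Triple

/-- `(m; a, b) * (n; c, d) = (m + n + a d - b c; a + c, b + d)`. -/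
instance : Mul Triple :=
  ⟨fun x y => ⟨x.m + y.m + x.a * y.b - x.b * y.a, x.a + y.a, x.b + y.b⟩⟩

instance : One Triple := ⟨⟨0, 0, 0⟩⟩

instance : Inv Triple := ⟨fun x => ⟨-x.m, -x.a, -x.b⟩⟩

theorem mul_def (x y : Triple) :
    x * y = ⟨x.m + y.m + x.a * y.b - x.b * y.a, x.a + y.a, x.b + y.b⟩ := rfl

theorem one_def : (1 : Triple) = ⟨0, 0, 0⟩ := rfl

theorem inv_def (x : Triple) : x⁻¹ = ⟨-x.m, -x.a, -x.b⟩ := rfl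

instance : Group Triple :=
  Group.ofLeftAxioms
    (by intro x y z; ext <;> simp only [mul_def] <;> ring)
    (by intro x; ext <;> simp [mul_def, one_def])
    (by intro x; ext <;> simp [mul_def, one_def, inv_def, mul_comm])

end Triple

/-- The conditions cutting out the (intermediate) grading group: `m, a, b` are half-integers,
`a + b` is an integer, and `m + ((2a + 1)(a + b + 1) + 1) / 2` is an integer. -/
def IsGr (x : Triple) : Prop :=
  (∃ k : ℤ, 2 * x.m = k) ∧ (∃ k : ℤ, 2 * x.a = k) ∧ (∃ k : ℤ, 2 * x.b = k) ∧
    (∃ k : ℤ, x.a + x.b = k) ∧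
    ∃ k : ℤ, x.m + ((2 * x.a + 1) * (x.a + x.b + 1) + 1) / 2 = k

/-- The grading group `G`. -/
def G : Subgroup Triple where
  carrier := {x | IsGr x}
  one_mem' := ⟨⟨0, by simp [Triple.one_def]⟩, ⟨0, by simp [Triple.one_def]⟩,
    ⟨0, by simp [Triple.one_def]⟩, ⟨0, by simp [Triple.one_def]⟩,
    ⟨1, by simp [Triple.one_def]⟩⟩
  mul_mem' := by
    rintro ⟨m, a, b⟩ ⟨n, c, d⟩ ⟨⟨M, hM⟩, ⟨A, hA⟩, -, ⟨p, hp⟩, ⟨q, hq⟩⟩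
      ⟨⟨N, hN⟩, ⟨C, hC⟩, -, ⟨r, hr⟩, ⟨s, hs⟩⟩
    simp only at hM hA hp hq hN hC hr hs
    obtain rfl : m = M / 2 := by linarith
    obtain rfl : a = A / 2 := by linarith
    obtain rfl : b = p - A / 2 := by linarith
    obtain rfl : n = N / 2 := by linarith
    obtain rfl : c = C / 2 := by linarith
    obtain rfl : d = r - C / 2 := by linarith
    refine ⟨⟨M + N + A * r - p * C, ?_⟩, ⟨A + C, ?_⟩, ⟨2 * p - A + 2 * r - C, ?_⟩,
      ⟨p + r, ?_⟩, ⟨q + s + A * r - 1, ?_⟩⟩ <;> simp only [Triple.mul_def] <;> push_cast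
    · ring
    · ring
    · ring
    · ring
    · rw [← hq, ← hs]; ring
  inv_mem' := by
    rintro ⟨m, a, b⟩ ⟨⟨M, hM⟩, ⟨A, hA⟩, -, ⟨p, hp⟩, ⟨q, hq⟩⟩
    simp only at hM hA hp hq
    obtain rfl : m = M / 2 := by linarith
    obtain rfl : a = A / 2 := by linarith
    obtain rfl : b = p - A / 2 := by linarith
    refine ⟨⟨-M, ?_⟩, ⟨-A, ?_⟩, ⟨-2 * p + A, ?_⟩,
      ⟨-p, ?_⟩, ⟨-q + A * p + 2, ?_⟩⟩ <;> simp only [Triple.inv_def] <;> push_cast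
    · ring
    · ring
    · ring
    · ring
    · rw [← hq]; ring

/-- The grading group `Γ = G × ℤ`. -/
abbrev Grp : Type := G × Multiplicative ℤ

/-- The distinguished central element `λ = (1; 0, 0) × 0`. -/
def lam : Grp :=
  (⟨⟨1, 0, 0⟩, ⟨2, by norm_num⟩, ⟨0, by norm_num⟩, ⟨0, by norm_num⟩, ⟨0, by norm_num⟩,
    ⟨2, by norm_num⟩⟩, 1)

/-- The `G`-grading of the chords `ρ₁, ρ₂, ρ₃, ρ₄` (where `4 = 0` in `ZMod 4`). -/
def grRho (i : ZMod 4) : G :=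
  if i = 1 then ⟨⟨-1/2, 1/2, -1/2⟩, ⟨-1, by norm_num⟩, ⟨1, by norm_num⟩, ⟨-1, by norm_num⟩,
    ⟨0, by norm_num⟩, ⟨1, by norm_num⟩⟩
  else if i = 2 then ⟨⟨-1/2, 1/2, 1/2⟩, ⟨-1, by norm_num⟩, ⟨1, by norm_num⟩, ⟨1, by norm_num⟩,
    ⟨1, by norm_num⟩, ⟨2, by norm_num⟩⟩
  else if i = 3 then ⟨⟨-1/2, -1/2, 1/2⟩, ⟨-1, by norm_num⟩, ⟨-1, by norm_num⟩, ⟨1, by norm_num⟩,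
    ⟨0, by norm_num⟩, ⟨0, by norm_num⟩⟩
  else ⟨⟨-3/2, -1/2, -1/2⟩, ⟨-3, by norm_num⟩, ⟨-1, by norm_num⟩, ⟨-1, by norm_num⟩,
    ⟨-1, by norm_num⟩, ⟨-1, by norm_num⟩⟩

/-- The winding number of the chords: `1` on `ρ₄` and `0` on `ρ₁, ρ₂, ρ₃`. -/
def windRho (i : ZMod 4) : ℤ := if i = 4 then 1 else 0

/-- `γ(ρᵢ) = gr(ρᵢ) × wind(ρᵢ)`. -/
def gammaRho (i : ZMod 4) : Grp := (grRho i, Multiplicative.ofAdd (windRho i))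

/-! ### The associative torus algebra

The quiver has vertices `0, 1` and arrows `ρ₁, ρ₃ : 0 → 1`, `ρ₂, ρ₄ : 1 → 0`, products are read
from left to right, and the relations are `ρ₂ρ₁ = ρ₃ρ₂ = ρ₄ρ₃ = ρ₁ρ₄ = 0`.  So the paths that
survive are the two idempotents and the `ρᵢρᵢ₊₁⋯ρᵢ₊ₙ`. -/

/-- The vertex at which the arrow `ρᵢ` starts. -/
def src (i : ZMod 4) : Fin 2 := if i = 1 ∨ i = 3 then 0 else 1

/-- The vertex at which the arrow `ρᵢ` ends. -/
def tgt (i : ZMod 4) : Fin 2 := if i = 1 ∨ i = 3 then 1 else 0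

theorem src_succ (i : ZMod 4) : src (i + 1) = tgt i := by
  revert i; decide

/-- The nonzero paths: the idempotents `ι₀, ι₁` and `chord i n = ρᵢρᵢ₊₁⋯ρᵢ₊ₙ`, with `n + 1`
arrows. -/
inductive Basic : Type
  | idem (j : Fin 2)
  | chord (i : ZMod 4) (n : ℕ)

/-- Concatenation of paths; `none` stands for `0`. -/
def Basic.mul : Basic → Basic → Option Basic
  | .idem j, .idem k => if j = k then some (.idem j) else none
  | .idem j, .chord i n => if j = src i then some (.chord i n) else none
  | .chord i n, .idem k => if k = tgt (i + n) then some (.chord i n) else none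
  | .chord i n, .chord k m => if k = i + n + 1 then some (.chord i (n + m + 1)) else none

theorem Basic.mul_assoc (x y z : Basic) :
    (x.mul y).bind (fun w => w.mul z) = (y.mul z).bind (fun w => x.mul w) := by
  rcases x with j | ⟨i, n⟩ <;> rcases y with j' | ⟨i', n'⟩ <;> rcases z with j'' | ⟨i'', n''⟩ <;>
    simp only [Basic.mul]
  · split_ifs <;> simp_all
  · split_ifs <;> simp_all
  · split_ifs <;> simp_all
  · split_ifs <;> simp_all
  · by_cases h1 : j' = tgt (i + n) <;> by_cases h2 : j' = j'' <;>
      by_cases h3 : j'' = tgt (i + n) <;> simp_all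
  · by_cases h : i'' = i + n + 1
    · have h2 : src i'' = tgt (i + n) := by rw [h, src_succ]
      rw [h2]
      by_cases h1 : j' = tgt (i + n) <;> simp [h1, h]
    · by_cases h1 : j' = tgt (i + n) <;> by_cases h3 : j' = src i'' <;>
        simp_all
  · by_cases h : i' = i + n + 1
    · subst h
      have e : i + ((n + n' + 1 : ℕ) : ZMod 4) = i + n + 1 + n' := by push_cast; ring
      by_cases h1 : j'' = tgt (i + n + 1 + n') <;>
        simp only [h1, e, if_true, if_false, Option.bind_some, Option.bind_none]
    · by_cases h1 : j'' = tgt (i' + n') <;> simp [h1, h]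
  · by_cases h : i' = i + n + 1
    · subst h
      have e : i + ((n + n' + 1 : ℕ) : ZMod 4) + 1 = i + n + 1 + n' + 1 := by push_cast; ring
      have e' : n + n' + 1 + n'' + 1 = n + (n' + n'' + 1) + 1 := by ring
      by_cases h1 : i'' = i + n + 1 + n' + 1 <;>
        simp only [h1, e, e', if_true, if_false, Option.bind_some, Option.bind_none]
    · by_cases h1 : i'' = i' + n' + 1 <;> simp [h1, h]

/-- The torus algebra with coefficients in `R`: the free `R`-module on the nonzero paths. -/
def TorusAlg (R : Type) [CommRing R] : Type := Basic →₀ R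

namespace TorusAlg

variable {R : Type} [CommRing R]

instance : AddCommGroup (TorusAlg R) := inferInstanceAs (AddCommGroup (Basic →₀ R))

instance : Module R (TorusAlg R) := inferInstanceAs (Module R (Basic →₀ R))

/-- The basis of nonzero paths. -/
def basis : Module.Basis Basic R (TorusAlg R) := ⟨LinearEquiv.refl R (Basic →₀ R)⟩

/-- The basis element of a path. -/
def of (x : Basic) : TorusAlg R := basis x

/-- The basis element of a path, or `0`. -/
def ofOption : Option Basic → TorusAlg R
  | none => 0
  | some x => of x

/-- The bilinear extension of the concatenation of paths. -/
def mulHom : TorusAlg R →ₗ[R] TorusAlg R →ₗ[R] TorusAlg R :=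
  basis.constr R fun x => basis.constr R fun y => ofOption (x.mul y)

instance : Mul (TorusAlg R) := ⟨fun a b => mulHom a b⟩

instance : One (TorusAlg R) := ⟨of (.idem 0) + of (.idem 1)⟩

theorem mul_def (a b : TorusAlg R) : a * b = mulHom a b := rfl

theorem one_def : (1 : TorusAlg R) = of (.idem 0) + of (.idem 1) := rfl

theorem of_mul_of (x y : Basic) : (of x * of y : TorusAlg R) = ofOption (x.mul y) := by
  simp only [mul_def, mulHom, of, Module.Basis.constr_basis]

/-- Linear maps out of the torus algebra agree if they agree on paths. -/
theorem hom_ext {N : Type} [AddCommGroup N] [Module R N] {f g : TorusAlg R →ₗ[R] N}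
    (h : ∀ x, f (of x) = g (of x)) : f = g :=
  basis.ext h

theorem ofOption_mul_of (x : Option Basic) (y : Basic) :
    (ofOption x * of y : TorusAlg R) = ofOption (x.bind (fun w => w.mul y)) := by
  cases x with
  | none => simp [ofOption, mul_def]
  | some x => simp [ofOption, of_mul_of]

theorem of_mul_ofOption (x : Basic) (y : Option Basic) :
    (of x * ofOption y : TorusAlg R) = ofOption (y.bind (fun w => x.mul w)) := by
  cases y with
  | none => simp [ofOption, mul_def]
  | some y => simp [ofOption, of_mul_of]

theorem mul_assoc' (a b c : TorusAlg R) : a * b * c = a * (b * c) := by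
  have h : (mulHom (R := R)).compr₂ mulHom =
      (LinearMap.llcomp R (TorusAlg R) (TorusAlg R) (TorusAlg R)).compl₁₂ mulHom mulHom := by
    refine hom_ext fun x => hom_ext fun y => hom_ext fun z => ?_
    change of x * of y * of z = of x * (of y * of z)
    rw [of_mul_of, of_mul_of, ofOption_mul_of, of_mul_ofOption, Basic.mul_assoc]
  exact congrArg (fun F => F a b c) h

theorem one_mul' (a : TorusAlg R) : 1 * a = a := by
  have h : mulHom (R := R) 1 = LinearMap.id := by
    refine hom_ext fun x => ?_
    rw [one_def, map_add, LinearMap.add_apply, ← mul_def, ← mul_def, of_mul_of, of_mul_of]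
    rcases x with j | ⟨i, n⟩
    · fin_cases j <;> simp [Basic.mul, ofOption]
    · have : src i = 0 ∨ src i = 1 := by revert i; decide
      rcases this with h | h <;> simp [Basic.mul, ofOption, h]
  exact congrArg (fun F => F a) h

theorem mul_one' (a : TorusAlg R) : a * 1 = a := by
  have h : (mulHom (R := R)).flip 1 = LinearMap.id := by
    refine hom_ext fun x => ?_
    rw [LinearMap.flip_apply, one_def, map_add, ← mul_def, ← mul_def, of_mul_of, of_mul_of]
    rcases x with j | ⟨i, n⟩
    · fin_cases j <;> simp [Basic.mul, ofOption]
    · have : ∀ i : ZMod 4, tgt i = 0 ∨ tgt i = 1 := by decide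
      rcases this (i + n) with h | h <;> simp [Basic.mul, ofOption, h]
  exact congrArg (fun F => F a) h

instance : Ring (TorusAlg R) :=
  { (inferInstance : AddCommGroup (TorusAlg R)) with
    mul := (· * ·)
    one := 1
    mul_assoc := mul_assoc'
    one_mul := one_mul'
    mul_one := mul_one'
    left_distrib := fun a b c => by simp only [mul_def, map_add]
    right_distrib := fun a b c => by simp only [mul_def, map_add, LinearMap.add_apply]
    zero_mul := fun a => by simp only [mul_def, map_zero, LinearMap.zero_apply]
    mul_zero := fun a => by simp only [mul_def, map_zero] }

end TorusAlg

/-! ### `A∞`-deformations over `ℤ[U]` -/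

/-- The integral torus algebra with coefficients extended to `ℤ[U]` (the variable of the
polynomial ring, `Polynomial.X`, is `U`). -/
abbrev A : Type := TorusAlg ℤ[X]

/-- The idempotents `ι₀, ι₁`.  They span the ground ring `ℤ[U] ⊕ ℤ[U]`. -/
def iota (j : Fin 2) : A := TorusAlg.of (.idem j)

/-- The chords `ρ₁, ρ₂, ρ₃, ρ₄`. -/
def rho (i : ZMod 4) : A := TorusAlg.of (.chord i 0)

/-- A sequence of `ℤ[U]`-multilinear maps, one for each number of inputs. -/
abbrev Ops : Type := ∀ n : ℕ, MultilinearMap ℤ[X] (fun _ : Fin n => A) A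

/-- The value on a list of inputs. -/
def Ops.ev (f : Ops) (l : List A) : A := f l.length l.get

/-- `f` consists of bimodule maps over the ground ring `ℤ[U] ⊕ ℤ[U]`, defined on tensor powers
over the ground ring. -/
structure Ops.IsGroundLinear (f : Ops) : Prop where
  left : ∀ (j : Fin 2) (a : A) (l : List A), f.ev (iota j * a :: l) = iota j * f.ev (a :: l)
  right : ∀ (j : Fin 2) (a : A) (l : List A),
    f.ev (l ++ [a * iota j]) = f.ev (l ++ [a]) * iota j
  balanced : ∀ (j : Fin 2) (a b : A) (l l' : List A),
    f.ev (l ++ a * iota j :: b :: l') = f.ev (l ++ a :: iota j * b :: l')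

/-- `∑ (-1)^(r + s t) f_{r+1+t} ∘ (1^{⊗ r} ⊗ μ_s ⊗ 1^{⊗ t})`, summed over `r + s + t = n`, `s ≥ 1`,
on `n` inputs.  All elements of the algebra are even for the sign rule. -/
def Ops.insert (f μ : Ops) (l : List A) : A :=
  ∑ r ∈ Finset.range (l.length + 1), ∑ s ∈ Finset.Icc 1 (l.length - r),
    (-1 : ℤ) ^ (r + s * (l.length - r - s)) •
      f.ev (l.take r ++ μ.ev ((l.drop r).take s) :: l.drop (r + s))

/-- The exponent `∑_{k=1}^{m} (m - k) (i_k - 1)`. -/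
def sigma : List ℕ → ℕ
  | [] => 0
  | i :: l => l.length * (i - 1) + sigma l

/-- `∑ (-1)^σ g_m ∘ (f_{i₁} ⊗ ⋯ ⊗ f_{i_m})`, summed over `i₁ + ⋯ + i_m = n`, `i_k ≥ 1`, on `n`
inputs, where `σ = ∑ (m - k) (i_k - 1)`. -/
def Ops.comp (g f : Ops) (l : List A) : A :=
  ∑ c : Composition l.length,
    (-1 : ℤ) ^ sigma c.blocks • g.ev ((l.splitWrtComposition c).map f.ev)

/-- The components of the identity homomorphism. -/
def idOn : List A → A
  | [a] => a
  | _ => 0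

/-- A (strictly unital) `A∞`-deformation over `ℤ[U]` of the integral torus algebra: an
`A∞`-algebra structure over the ground ring with `μ₁ = 0` and `μ₂` the given multiplication. -/
structure Deformation where
  μ : Ops
  μ_zero : μ 0 = 0
  μ_one : μ 1 = 0
  μ_two : ∀ a b : A, μ.ev [a, b] = a * b
  groundLinear : μ.IsGroundLinear
  unital : ∀ l : List A, 3 ≤ l.length → (∃ j, iota j ∈ l) → μ.ev l = 0
  relation : ∀ l : List A, μ.insert μ l = 0

/-- `f_n` shifts gradings by `λ^(n - d)`. -/
def Ops.IsHomogeneous (f : Ops) (d : ℤ) (S T : Grp → AddSubgroup A) : Prop :=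
  ∀ (n : ℕ) (a : Fin n → A) (g : Fin n → Grp), (∀ i, a i ∈ S (g i)) →
    f n a ∈ T (lam ^ ((n : ℤ) - d) * (List.ofFn g).prod)

/-- A `Γ`-graded deformation, in which `ρᵢ` has grading `γ(ρᵢ)`: a decomposition of the
underlying abelian group into pieces indexed by `Γ`, such that `μ_n` has degree `λ^(n-2)`. -/
structure GradedDeformation extends Deformation where
  piece : Grp → AddSubgroup A
  independent : iSupIndep piece
  span : ⨆ g, piece g = ⊤
  iota_mem : ∀ j, iota j ∈ piece 1
  rho_mem : ∀ i, rho i ∈ piece (gammaRho i)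
  homogeneous : μ.IsHomogeneous 2 piece piece

/-- `f` is a `Γ`-graded, strictly unital homomorphism of `A∞`-algebras from `D` to `E`. -/
structure IsHom (D E : GradedDeformation) (f : Ops) : Prop where
  zero : f 0 = 0
  groundLinear : f.IsGroundLinear
  unital_one : ∀ j, f.ev [iota j] = iota j
  unital : ∀ l : List A, 2 ≤ l.length → (∃ j, iota j ∈ l) → f.ev l = 0
  relation : ∀ l : List A, f.insert D.μ l = E.μ.comp f l
  homogeneous : f.IsHomogeneous 1 D.piece E.piece

/-- `f` is an isomorphism of `Γ`-graded deformations from `D` to `E`: a homomorphism with linear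
part the identity that has a two-sided inverse homomorphism. -/
def IsIso (D E : GradedDeformation) (f : Ops) : Prop :=
  IsHom D E f ∧ (∀ a : A, f.ev [a] = a) ∧
    ∃ g : Ops, IsHom E D g ∧ g.comp f = idOn ∧ f.comp g = idOn

end TorusAInf

end

open scoped Polynomial

noncomputable section

namespace TorusAInf

/-! ### Sums over the splittings of a list -/

section SplitSum

variable {α N : Type*} [AddCommMonoid N]

/-! The argument is obstruction theory in the bar construction, with a contraction of the Hochschild
complex coming from Koszulness of the torus algebra.

Sequences of operations are linear maps from the tensor algebra `Words` on the paths to `A`. With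
all letters odd, a cochain `μ` extends to a coderivation `coder μ` and a cochain `f` to a coalgebra
map `cohom f`. The structure equations become `μ ∘ coder μ = 0` and `f ∘ coder μ = μ' ∘ cohom f`.
This gives the signs of the theorem because the grading forces μ_n = 0 for n odd and f_n = 0 for n
even (`Good.hasParity`): on gradings of closed paths, Γ carries a parity that counts λ modulo 2.

Correcting a partial solution in arity n changes its error in arity n + 1 by a Hochschild
coboundary, and the lowest nonzero error is a Hochschild cocycle. Among the composable words without
idempotent letters, the critical ones are ρ_i, ρ_{i-1}, ρ_{i-2}, … (`koszul`), where all letters are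
single arrows and all adjacent products vanish. The others are matched in pairs: contract the first
nonzero product, or split the first long chord after its first arrow. The contraction `hWord`
inverts the differential on the contractible words, and a cocycle that vanishes on contractible,
critical and idempotent-containing words is zero (`eq_zero_of_cocycle`). Hence a solution exists as
soon as the error vanishes on critical words (`IsObstruction.exists_solution`).

By grading, a cochain of degree λ⁻¹ vanishes on every critical word of length other than 4
(`Good.koszul_eq_zero`). For existence, μ₄ is set to U times an idempotent on all four critical
words of length 4. The error on critical words vanishes in length 5 because U is central, and in
larger length by strict unitality (`Admissible.relation_koszul`). For uniqueness, the error of a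
homomorphism has degree λ⁻¹, so only critical words of length 4 matter. The two prescribed values
and the relation in arity 5 leave a single integer z of freedom (`exists_quartic_eq`), and f₃(ρ₁,
ρ₄, ρ₃) = z ρ₃ρ₄ρ₁ absorbs it. The resulting coalgebra map is unipotent for the length filtration,
hence invertible, with inverse again a strictly unital coalgebra map.

The decomposition of `A` in a graded deformation is not prescribed, but the quartic values fix the
degree of U and therefore the whole decomposition (`GradedDeformation.piece_eq`). All homogeneity
can thus be tested against one standard grading. -/

/-- The sum of `g u v` over all `u, v` with `u ++ v` the given list. -/
def splitSum : (List α → List α → N) → List α → N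
  | g, [] => g [] []
  | g, x :: w => g [] (x :: w) + splitSum (fun u v => g (x :: u) v) w

@[simp] theorem splitSum_nil (g : List α → List α → N) : splitSum g [] = g [] [] := rfl

theorem splitSum_cons (g : List α → List α → N) (x : α) (w : List α) :
    splitSum g (x :: w) = g [] (x :: w) + splitSum (fun u v => g (x :: u) v) w := rfl

theorem splitSum_congr {g h : List α → List α → N} {w : List α}
    (H : ∀ u v, u ++ v = w → g u v = h u v) : splitSum g w = splitSum h w := by
  induction w generalizing g h with
  | nil => exact H [] [] rfl
  | cons x w ih =>
    rw [splitSum_cons, splitSum_cons, H [] (x :: w) rfl,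
      ih (g := fun u v => g (x :: u) v) fun u v huv => H (x :: u) v (by rw [List.cons_append, huv])]

theorem splitSum_add (g h : List α → List α → N) (w : List α) :
    splitSum (fun u v => g u v + h u v) w = splitSum g w + splitSum h w := by
  induction w generalizing g h with
  | nil => rfl
  | cons x w ih => rw [splitSum_cons, splitSum_cons, splitSum_cons, ih]; abel

@[simp] theorem splitSum_zero (w : List α) : splitSum (fun _ _ => (0 : N)) w = 0 := by
  induction w with
  | nil => rfl
  | cons x w ih => rw [splitSum_cons, ih, add_zero]

theorem splitSum_eq_zero {g : List α → List α → N} {w : List α}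
    (H : ∀ u v, u ++ v = w → g u v = 0) : splitSum g w = 0 := by
  rw [splitSum_congr H, splitSum_zero]

theorem map_splitSum {N' F : Type*} [AddCommMonoid N'] [FunLike F N N'] [AddMonoidHomClass F N N']
    (φ : F) (g : List α → List α → N) (w : List α) :
    φ (splitSum g w) = splitSum (fun u v => φ (g u v)) w := by
  induction w generalizing g with
  | nil => rfl
  | cons x w ih => rw [splitSum_cons, splitSum_cons, map_add, ih]

/-- Coassociativity of deconcatenation: both sides run over the ways to cut the word into three
pieces. -/
theorem splitSum_assoc (g : List α → List α → List α → N) (w : List α) :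
    splitSum (fun u v => splitSum (fun v₁ v₂ => g u v₁ v₂) v) w =
      splitSum (fun u v => splitSum (fun u₁ u₂ => g u₁ u₂ v) u) w := by
  induction w generalizing g with
  | nil => rfl
  | cons x w ih =>
    rw [splitSum_cons, splitSum_cons, splitSum_cons, ih]
    simp only [splitSum_cons, splitSum_nil, splitSum_add]
    abel

theorem splitSum_append_singleton (g : List α → List α → N) (w : List α) (x : α) :
    splitSum g (w ++ [x]) = splitSum (fun u v => g u (v ++ [x])) w + g (w ++ [x]) [] := by
  induction w generalizing g with
  | nil => rfl
  | cons y w ih => rw [List.cons_append, splitSum_cons, ih, splitSum_cons]; simp [add_assoc]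

theorem splitSum_eq_sum (g : List α → List α → N) (w : List α) :
    splitSum g w = ∑ r ∈ Finset.range (w.length + 1), g (w.take r) (w.drop r) := by
  induction w generalizing g with
  | nil => simp
  | cons x w ih =>
    rw [splitSum_cons, ih, List.length_cons, Finset.sum_range_succ' _ (w.length + 1), add_comm]
    simp

end SplitSum

/-! ### The word algebra -/

/-- The tensor algebra on the paths. -/
abbrev Words : Type := MonoidAlgebra ℤ[X] (FreeMonoid Basic)

/-- The basis element of a word. -/
def word (w : List Basic) : Words := MonoidAlgebra.of _ _ (FreeMonoid.ofList w)

@[simp] theorem word_nil : word [] = 1 := map_one _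

theorem word_append (u v : List Basic) : word (u ++ v) = word u * word v := by
  simp [word, FreeMonoid.ofList_append]

theorem basis_eq_word (w : FreeMonoid Basic) :
    MonoidAlgebra.basis (FreeMonoid Basic) ℤ[X] w = word w.toList := by
  simp [word]

section Lin

variable {N : Type*} [AddCommGroup N] [Module ℤ[X] N]

/-- The linear map with given values on words. -/
def lin (φ : List Basic → N) : Words →ₗ[ℤ[X]] N :=
  (MonoidAlgebra.basis (FreeMonoid Basic) ℤ[X]).constr ℤ[X] fun w => φ w.toList

@[simp] theorem lin_word (φ : List Basic → N) (w : List Basic) : lin φ (word w) = φ w := by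
  have := (MonoidAlgebra.basis (FreeMonoid Basic) ℤ[X]).constr_basis ℤ[X]
    (fun w => φ w.toList) (FreeMonoid.ofList w)
  rw [basis_eq_word] at this
  exact this

theorem words_ext {f g : Words →ₗ[ℤ[X]] N} (h : ∀ w, f (word w) = g (word w)) : f = g :=
  (MonoidAlgebra.basis (FreeMonoid Basic) ℤ[X]).ext fun w => by rw [basis_eq_word]; exact h _

end Lin

theorem words_induction {P : Words → Prop} (t : Words) (hw : ∀ w, P (word w)) (h0 : P 0)
    (hadd : ∀ s t, P s → P t → P (s + t)) (hsmul : ∀ (c : ℤ[X]) t, P t → P (c • t)) : P t := by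
  induction t using MonoidAlgebra.induction_linear with
  | zero => exact h0
  | add s t hs ht => exact hadd s t hs ht
  | single m r =>
    have : (MonoidAlgebra.single m r : Words) = r • word m.toList := by
      simp [word]
    rw [this]
    exact hsmul _ _ (hw _)

/-- The inclusion of the letters. -/
def letter : A →ₗ[ℤ[X]] Words := TorusAlg.basis.constr ℤ[X] fun x => word [x]

@[simp] theorem letter_of (x : Basic) : letter (TorusAlg.of x) = word [x] :=
  TorusAlg.basis.constr_basis _ _ _

theorem word_cons (x : Basic) (w : List Basic) : word (x :: w) = word [x] * word w :=
  word_append [x] w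

theorem word_cons' (x : Basic) (w : List Basic) :
    word (x :: w) = letter (TorusAlg.of x) * word w := by
  rw [letter_of, word_cons]

/-- Left multiplication, as an endomorphism of the underlying module. -/
abbrev lmul (t : Words) : Words →ₗ[ℤ[X]] Words := LinearMap.mulLeft ℤ[X] t

/-- The functionals whose coderivations and coalgebra maps are considered. -/
abbrev Cochain : Type := Words →ₗ[ℤ[X]] A

/-- The convolution `t ↦ p(t') q(t'')`. -/
def conv (p : Cochain) (q : Words →ₗ[ℤ[X]] Words) : Words →ₗ[ℤ[X]] Words :=
  lin (splitSum fun u v => letter (p (word u)) * q (word v))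

@[simp] theorem conv_word (p : Cochain) (q : Words →ₗ[ℤ[X]] Words) (w : List Basic) :
    conv p q (word w) = splitSum (fun u v => letter (p (word u)) * q (word v)) w := by
  rw [conv, lin_word]

theorem conv_add_left (p p' : Cochain) (q : Words →ₗ[ℤ[X]] Words) :
    conv (p + p') q = conv p q + conv p' q :=
  words_ext fun w => by simp [add_mul, splitSum_add]

theorem conv_smul_left (c : ℤ[X]) (p : Cochain) (q : Words →ₗ[ℤ[X]] Words) :
    conv (c • p) q = c • conv p q :=
  words_ext fun w => by
    simp only [conv_word, LinearMap.smul_apply, map_smul, smul_mul_assoc]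
    exact (map_splitSum (LinearMap.lsmul ℤ[X] Words c) _ w).symm

/-- A cut falls either before the first letter or after it. Allowing an arbitrary element `a` as
first letter matters because coderivations and coalgebra maps produce letters that are not paths. -/
theorem conv_letter_mul (p : Cochain) (q : Words →ₗ[ℤ[X]] Words) (a : A) (t : Words) :
    conv p q (letter a * t) =
      letter (p 1) * q (letter a * t) + conv (p ∘ₗ lmul (letter a)) q t := by
  induction t using words_induction with
  | h0 => simp
  | hadd s t hs ht => rw [mul_add, map_add, map_add, map_add, hs, ht, mul_add]; abel
  | hsmul c t ht =>
    rw [mul_smul_comm, map_smul, map_smul, map_smul, ht, smul_add, mul_smul_comm]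
  | hw w =>
    have H : conv p q ∘ₗ LinearMap.mulRight ℤ[X] (word w) ∘ₗ letter =
        LinearMap.mulLeft ℤ[X] (letter (p 1)) ∘ₗ q ∘ₗ LinearMap.mulRight ℤ[X] (word w) ∘ₗ letter +
        { toFun := fun a => conv (p ∘ₗ lmul (letter a)) q (word w)
          map_add' := fun a b => by
            rw [← LinearMap.add_apply, ← conv_add_left]
            congr 2
            exact LinearMap.ext fun t => by simp [add_mul]
          map_smul' := fun c a => by
            rw [RingHom.id_apply, ← LinearMap.smul_apply, ← conv_smul_left]
            congr 2
            exact LinearMap.ext fun t => by simp } := by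
      refine TorusAlg.hom_ext fun x => ?_
      simp [← word_cons, splitSum_cons]
    exact congrArg (fun F => F a) H

/-! ### Coderivations -/

/-- The values on words of the odd coderivation with corestriction `μ`. -/
def coderWord (μ : Cochain) : List Basic → Words
  | [] => 0
  | x :: w => splitSum (fun u v => letter (μ (word u)) * word v) (x :: w) -
      word [x] * coderWord μ w

/-- The odd coderivation with corestriction `μ`, for all letters odd. -/
def coder (μ : Cochain) : Words →ₗ[ℤ[X]] Words := lin (coderWord μ)

@[simp] theorem coder_one (μ : Cochain) : coder μ 1 = 0 := by
  rw [← word_nil, coder, lin_word, coderWord]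

theorem coder_cons (μ : Cochain) (x : Basic) (w : List Basic) :
    coder μ (word (x :: w)) = splitSum (fun u v => letter (μ (word u)) * word v) (x :: w) -
      word [x] * coder μ (word w) := by
  rw [coder, lin_word, lin_word, coderWord]

/-- The composite of a convolution with a coderivation. -/
theorem conv_coder (μ : Cochain) (hμ : μ 1 = 0) (p : Cochain) (q : Words →ₗ[ℤ[X]] Words)
    (w : List Basic) :
    conv p q (coder μ (word w)) = splitSum (fun u v => letter (p (coder μ (word u))) * q (word v) +
      (-1 : ℤ) ^ u.length • (letter (p (word u)) * q (coder μ (word v)))) w := by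
  induction w generalizing p with
  | nil => simp
  | cons x w ih =>
    -- A block starting the word followed by a cut: the cut comes before the block, or after it, and
    -- in the latter case coassociativity collects the terms according to the left part.
    have h1 : ∀ (p : Cochain) w, conv p q (splitSum (fun u v => letter (μ (word u)) * word v) w) =
        letter (p 1) * q (splitSum (fun u v => letter (μ (word u)) * word v) w) +
        splitSum (fun u v => letter (p (splitSum (fun u v => letter (μ (word u)) * word v) u)) *
          q (word v)) w := by
      intro p w
      rw [map_splitSum]
      simp only [conv_letter_mul, conv_word, splitSum_add]
      congr 1
      · rw [map_splitSum q]
        exact (map_splitSum (LinearMap.mulLeft ℤ[X] (letter (p 1))) _ w).symm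
      · rw [splitSum_assoc (fun u v₁ v₂ =>
          letter ((p ∘ₗ lmul (letter (μ (word u)))) (word v₁)) * q (word v₂))]
        refine splitSum_congr fun u v _ => ?_
        rw [map_splitSum p, map_splitSum letter]
        exact (map_splitSum (LinearMap.mulRight ℤ[X] (q (word v))) _ u).symm
    have h2 : ∀ u, splitSum (fun u v => letter (μ (word u)) * word v) (x :: u) =
        coder μ (word (x :: u)) + word [x] * coder μ (word u) := by
      intro u; rw [coder_cons]; abel
    conv_lhs => rw [coder_cons, map_sub, h1, ← letter_of, conv_letter_mul, ih, h2 w]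
    conv_rhs => rw [splitSum_cons]
    conv_lhs => rw [splitSum_cons]
    simp only [h2, LinearMap.comp_apply, LinearMap.mulLeft_apply, letter_of, ← word_cons, map_add,
      mul_add, add_mul, splitSum_add]
    simp only [word_nil, coder_one, map_zero, zero_mul, List.length_nil, pow_zero, one_smul,
      List.length_cons, pow_succ, mul_neg_one, neg_smul, splitSum_nil, hμ]
    have h3 : splitSum (fun u v => -((-1 : ℤ) ^ u.length •
        (letter (p (word (x :: u))) * q (coder μ (word v))))) w =
        - splitSum (fun u v => ((-1 : ℤ) ^ u.length •
        (letter (p (word (x :: u))) * q (coder μ (word v))))) w :=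
      (map_splitSum (-AddMonoidHom.id Words) _ w).symm
    rw [h3]
    abel

/-! ### Coalgebra maps -/

/-- Auxiliary recursion: the convolution of `p` with the coalgebra map with corestriction `f`. -/
def cohomAux (f : Cochain) : Cochain → List Basic → Words
  | p, [] => letter (p 1)
  | p, x :: w => letter (p 1) * cohomAux f (f ∘ₗ lmul (word [x])) w +
      cohomAux f (p ∘ₗ lmul (word [x])) w

/-- The values on words of the coalgebra map with corestriction `f`. -/
def cohomWord (f : Cochain) : List Basic → Words
  | [] => 1
  | x :: w => cohomAux f (f ∘ₗ lmul (word [x])) w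

/-- The coalgebra map with corestriction `f`. -/
def cohom (f : Cochain) : Words →ₗ[ℤ[X]] Words := lin (cohomWord f)

@[simp] theorem cohom_one (f : Cochain) : cohom f 1 = 1 := by
  rw [← word_nil, cohom, lin_word, cohomWord]; rfl

/-- The expected recursion of a coalgebra map calls itself on every proper suffix and is not
structural. `cohomAux` absorbs letters into its first argument until the first block is closed, and
this identity recovers the intended sum over first blocks. -/
theorem cohomAux_eq (f p : Cochain) (w : List Basic) :
    cohomAux f p w = splitSum (fun u v => letter (p (word u)) * cohom f (word v)) w := by
  induction w generalizing p with
  | nil => simp [cohomAux]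
  | cons x w ih =>
    rw [cohomAux, splitSum_cons, ih, ih, cohom, lin_word, cohomWord, ih]
    simp [← word_cons, cohom]

theorem cohom_of_ne_nil {f : Cochain} (hf : f 1 = 0) {w : List Basic} (hw : w ≠ []) :
    cohom f (word w) = splitSum (fun u v => letter (f (word u)) * cohom f (word v)) w := by
  obtain ⟨x, w, rfl⟩ := List.exists_cons_of_ne_nil hw
  rw [splitSum_cons, word_nil, hf, map_zero, zero_mul, zero_add, cohom, lin_word, cohomWord,
    cohomAux_eq]
  simp [← word_cons, cohom]

/-- The composite of a convolution with a coalgebra map. -/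
theorem conv_cohom {f : Cochain} (hf : f 1 = 0) (p : Cochain) (q : Words →ₗ[ℤ[X]] Words)
    (w : List Basic) :
    conv p q (cohom f (word w)) =
      splitSum (fun u v => letter (p (cohom f (word u))) * q (cohom f (word v))) w := by
  induction hn : w.length using Nat.strong_induction_on generalizing w p with
  | _ n ih =>
    subst hn
    rcases eq_or_ne w [] with rfl | hw
    · have := conv_word p q []
      simp only [word_nil, splitSum_nil] at this
      simp [this]
    -- A nonempty first block leaves a shorter suffix, to which the induction applies; an empty one
    -- contributes nothing since `f 1 = 0`.
    have key : ∀ u v, u ++ v = w → conv p q (letter (f (word u)) * cohom f (word v)) =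
        letter (p 1) * q (letter (f (word u)) * cohom f (word v)) +
        splitSum (fun v₁ v₂ => letter (p (letter (f (word u)) * cohom f (word v₁))) *
          q (cohom f (word v₂))) v := by
      intro u v huv
      rw [conv_letter_mul]
      rcases eq_or_ne u [] with rfl | hu
      · have h1 : conv 0 q = 0 := words_ext fun w => by simp
        simp [hf, h1]
      · rw [ih v.length ?_ _ v rfl]
        · rfl
        · have := List.length_pos_iff.2 hu
          rw [← huv, List.length_append]; omega
    -- The recursion fails on the empty word, where the sum is 0 and the coalgebra map is 1. This
    -- defect cancels the term `p 1` below.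
    have e : ∀ u, splitSum (fun u v => letter (f (word u)) * cohom f (word v)) u =
        cohom f (word u) - if u = [] then 1 else 0 := by
      intro u
      split_ifs with h
      · subst h; simp [hf]
      · rw [cohom_of_ne_nil hf h, sub_zero]
    rw [cohom_of_ne_nil hf hw, map_splitSum, splitSum_congr key, splitSum_add,
      splitSum_assoc (fun u v₁ v₂ => letter (p (letter (f (word u)) * cohom f (word v₁))) *
          q (cohom f (word v₂)))]
    have e1 : splitSum (fun u v => letter (p 1) * q (letter (f (word u)) * cohom f (word v))) w =
        letter (p 1) * q (cohom f (word w)) := by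
      rw [cohom_of_ne_nil hf hw, map_splitSum q]
      exact (map_splitSum (LinearMap.mulLeft ℤ[X] (letter (p 1))) _ w).symm
    have e2 : ∀ u v, splitSum (fun u₁ u₂ => letter (p (letter (f (word u₁)) * cohom f (word u₂))) *
          q (cohom f (word v))) u =
        letter (p (cohom f (word u))) * q (cohom f (word v)) -
          (if u = [] then letter (p 1) * q (cohom f (word v)) else 0) := by
      intro u v
      have := map_splitSum (LinearMap.mulRight ℤ[X] (q (cohom f (word v))) ∘ₗ letter ∘ₗ p)
        (fun u₁ u₂ => letter (f (word u₁)) * cohom f (word u₂)) u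
      simp only [LinearMap.comp_apply, LinearMap.mulRight_apply] at this
      rw [← this, e]
      split_ifs with h
      · subst h; simp
      · simp
    simp only [e2, e1]
    obtain ⟨x, w, rfl⟩ := List.exists_cons_of_ne_nil hw
    simp [splitSum_cons]

section SplitSum

variable {α N : Type*} [AddCommMonoid N]

theorem splitSum_eq_first {g : List α → List α → N} {w : List α}
    (H : ∀ u v, u ++ v = w → u ≠ [] → g u v = 0) : splitSum g w = g [] w := by
  cases w with
  | nil => rfl
  | cons x w =>
    rw [splitSum_cons, splitSum_eq_zero, add_zero]
    exact fun u v h => H _ _ (by simp [h]) (by simp)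

theorem splitSum_eq_last {g : List α → List α → N} {w : List α}
    (H : ∀ u v, u ++ v = w → v ≠ [] → g u v = 0) : splitSum g w = g w [] := by
  rcases List.eq_nil_or_concat w with rfl | ⟨w, x, rfl⟩
  · rfl
  · rw [List.concat_eq_append] at *
    rw [splitSum_append_singleton, splitSum_eq_zero, zero_add]
    exact fun u v h => H _ _ (by rw [← List.append_assoc, h]) (by simp)

end SplitSum

/-! ### The augmentation and the projection to the letters -/

/-- The coefficient of the empty word. -/
def aug : Words →ₗ[ℤ[X]] ℤ[X] := lin fun w => if w = [] then 1 else 0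

/-- The component of length one. -/
def proj1 : Cochain := lin fun w => match w with
  | [x] => TorusAlg.of x
  | _ => 0

@[simp] theorem aug_word (w : List Basic) : aug (word w) = if w = [] then 1 else 0 := lin_word _ _

@[simp] theorem aug_one : aug 1 = 1 := by rw [← word_nil, aug_word, if_pos rfl]

theorem proj1_singleton (x : Basic) : proj1 (word [x]) = TorusAlg.of x := lin_word _ _

@[simp] theorem proj1_one : proj1 1 = 0 := by rw [← word_nil]; exact lin_word _ _

theorem proj1_of_length_ne_one {w : List Basic} (h : w.length ≠ 1) : proj1 (word w) = 0 := by
  rw [proj1, lin_word]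
  match w, h with
  | [], _ => rfl
  | [x], h => exact absurd rfl h
  | _ :: _ :: _, _ => rfl

@[simp] theorem proj1_letter (a : A) : proj1 (letter a) = a := by
  have : proj1 ∘ₗ letter = LinearMap.id := TorusAlg.hom_ext fun x => by
    simp [proj1_singleton]
  exact congrArg (fun F => F a) this

theorem proj1_letter_mul (a : A) (t : Words) : proj1 (letter a * t) = aug t • a := by
  have : proj1 ∘ₗ lmul (letter a) = (LinearMap.toSpanSingleton ℤ[X] A a) ∘ₗ aug :=
    words_ext fun w => by
      rcases eq_or_ne w [] with rfl | hw
      · simp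
      · have : (proj1 ∘ₗ LinearMap.mulRight ℤ[X] (word w)) ∘ₗ letter = 0 :=
          TorusAlg.hom_ext fun x => by
            simp only [LinearMap.comp_apply, letter_of, LinearMap.mulRight_apply, ← word_cons,
              LinearMap.zero_apply]
            exact proj1_of_length_ne_one (by simpa using hw)
        simpa [hw] using congrArg (fun F => F a) this
  exact congrArg (fun F => F t) this

theorem aug_letter_mul (a : A) (t : Words) : aug (letter a * t) = 0 := by
  have : aug ∘ₗ lmul (letter a) = 0 :=
    words_ext fun w => by
      have : (aug ∘ₗ LinearMap.mulRight ℤ[X] (word w)) ∘ₗ letter = 0 :=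
        TorusAlg.hom_ext fun x => by simp [← word_cons]
      exact congrArg (fun F => F a) this
  exact congrArg (fun F => F t) this

theorem aug_word_singleton_mul (x : Basic) (t : Words) : aug (word [x] * t) = 0 := by
  rw [← letter_of, aug_letter_mul]

theorem aug_coder (μ : Cochain) (t : Words) : aug (coder μ t) = 0 := by
  have : aug ∘ₗ coder μ = 0 := words_ext fun w => by
    cases w with
    | nil => simp
    | cons x w =>
      simp [coder_cons, map_splitSum, aug_letter_mul, aug_word_singleton_mul]
  exact congrArg (fun F => F t) this

theorem aug_cohom {f : Cochain} (hf : f 1 = 0) (t : Words) : aug (cohom f t) = aug t := by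
  have : aug ∘ₗ cohom f = aug := words_ext fun w => by
    rcases eq_or_ne w [] with rfl | hw
    · simp
    · simp [cohom_of_ne_nil hf hw, map_splitSum, aug_letter_mul, hw]
  exact congrArg (fun F => F t) this

theorem proj1_coder {μ : Cochain} (hμ : μ 1 = 0) (t : Words) : proj1 (coder μ t) = μ t := by
  have : proj1 ∘ₗ coder μ = μ := words_ext fun w => by
    cases w with
    | nil => simp [hμ]
    | cons x w =>
      simp only [LinearMap.comp_apply, coder_cons, map_sub, map_splitSum, ← letter_of,
        proj1_letter_mul, aug_coder, zero_smul, sub_zero]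
      rw [splitSum_eq_last]
      · simp
      · intro u v _ hv; simp [hv]
  exact congrArg (fun F => F t) this

theorem proj1_cohom {f : Cochain} (hf : f 1 = 0) (t : Words) : proj1 (cohom f t) = f t := by
  have : proj1 ∘ₗ cohom f = f := words_ext fun w => by
    rcases eq_or_ne w [] with rfl | hw
    · simp [hf]
    · simp only [LinearMap.comp_apply, cohom_of_ne_nil hf hw, map_splitSum,
        proj1_letter_mul, aug_cohom hf]
      rw [splitSum_eq_last]
      · simp
      · intro u v _ hv; simp [hv]
  exact congrArg (fun F => F t) this

theorem conv_proj1_cons (q : Words →ₗ[ℤ[X]] Words) (x : Basic) (w : List Basic) :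
    conv proj1 q (word (x :: w)) = word [x] * q (word w) := by
  rw [conv_word, splitSum_cons, splitSum_eq_first]
  · simp [proj1_singleton]
  · intro u v _ hu
    rw [proj1_of_length_ne_one (by simpa using hu), map_zero, zero_mul]

/-- Either the block starts at the first letter, or the first letter is passed with a sign. In this
form the composite of two coderivations is covered by `conv_coder`. -/
theorem coder_eq_conv {μ : Cochain} (hμ : μ 1 = 0) :
    coder μ = conv μ LinearMap.id - conv proj1 (coder μ) := words_ext fun w => by
  cases w with
  | nil =>
    rw [LinearMap.sub_apply, conv_word, conv_word]
    simp [hμ]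
  | cons x w =>
    rw [LinearMap.sub_apply, conv_proj1_cons, conv_word, coder_cons]
    rfl

theorem cohom_eq_conv {f : Cochain} (hf : f 1 = 0) :
    cohom f = conv f (cohom f) + LinearMap.toSpanSingleton ℤ[X] Words 1 ∘ₗ aug :=
  words_ext fun w => by
    rw [LinearMap.add_apply, conv_word]
    rcases eq_or_ne w [] with rfl | hw
    · simp [hf]
    · simp [cohom_of_ne_nil hf hw, hw]

/-! ### The coderivations measuring the failure of the structure relations -/

/-- `p` vanishes on words whose length is not congruent to `d` modulo `2`. -/
def HasParity (d : ℕ) (p : Cochain) : Prop := ∀ w, w.length % 2 ≠ d % 2 → p (word w) = 0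

theorem HasParity.map_one {p : Cochain} (hp : HasParity 1 p) : p 1 = 0 := by
  rw [← word_nil]; exact hp [] (by simp)

/-- The square of an odd coderivation is an even one. The cross terms, with one block in each part,
cancel because `μ` lives on even lengths, and passing a single letter twice costs no sign. -/
theorem coder_coder {μ : Cochain} (hμ : μ 1 = 0) (hpar : HasParity 0 μ) (w : List Basic) :
    coder μ (coder μ (word w)) = splitSum (fun u v =>
      letter ((μ ∘ₗ coder μ) (word u)) * (LinearMap.id : Words →ₗ[ℤ[X]] Words) (word v) +
      (1 : ℤ) • (letter (proj1 (word u)) * (coder μ ∘ₗ coder μ) (word v))) w := by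
  have e : coder μ (coder μ (word w)) = conv μ LinearMap.id (coder μ (word w)) -
      conv proj1 (coder μ) (coder μ (word w)) :=
    congrArg (fun F : Words →ₗ[ℤ[X]] Words => F (coder μ (word w))) (coder_eq_conv hμ)
  rw [e, conv_coder μ hμ, conv_coder μ hμ,
    sub_eq_iff_eq_add, ← splitSum_add]
  refine splitSum_congr fun u v _ => ?_
  rw [proj1_coder hμ]
  have h1 : (-1 : ℤ) ^ u.length • (letter (μ (word u)) * (LinearMap.id : Words →ₗ[ℤ[X]] Words) (coder μ (word v))) =
      letter (μ (word u)) * coder μ (word v) := by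
    rcases Nat.even_or_odd u.length with h | h
    · simp [h.neg_one_pow]
    · rw [hpar u (by rw [Nat.odd_iff.1 h]; simp)]; simp
  have h2 : (-1 : ℤ) ^ u.length • (letter (proj1 (word u)) * coder μ (coder μ (word v))) =
      - (letter (proj1 (word u)) * coder μ (coder μ (word v))) := by
    by_cases h : u.length = 1
    · simp [h]
    · simp [proj1_of_length_ne_one h]
  rw [h1, h2]
  simp only [LinearMap.comp_apply, LinearMap.id_coe, id_eq, one_smul]
  abel

/-- The failure of a coalgebra map to be a chain map is a coderivation along it. The sign of passing
a block of `f` is constant because `f` lives on odd lengths. -/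
theorem cohom_coder_sub {μ μ' f : Cochain} (hμ : μ 1 = 0) (hμ' : μ' 1 = 0) (hf : HasParity 1 f)
    (w : List Basic) :
    (cohom f ∘ₗ coder μ - coder μ' ∘ₗ cohom f) (word w) = splitSum (fun u v =>
      letter ((f ∘ₗ coder μ - μ' ∘ₗ cohom f) (word u)) * cohom f (word v) +
      (-1 : ℤ) • (letter (f (word u)) *
        (cohom f ∘ₗ coder μ - coder μ' ∘ₗ cohom f) (word v))) w := by
  have hf1 := hf.map_one
  have e1 : cohom f (coder μ (word w)) = conv f (cohom f) (coder μ (word w)) := by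
    conv_lhs => rw [cohom_eq_conv hf1]
    simp [aug_coder]
  have e2 : coder μ' (cohom f (word w)) = conv μ' LinearMap.id (cohom f (word w)) -
      conv proj1 (coder μ') (cohom f (word w)) := by
    conv_lhs => rw [coder_eq_conv hμ']
    rfl
  rw [LinearMap.sub_apply, LinearMap.comp_apply, LinearMap.comp_apply, e1, e2, conv_coder μ hμ,
    conv_cohom hf1, conv_cohom hf1, sub_eq_iff_eq_add, add_sub, ← splitSum_add, eq_sub_iff_add_eq,
    ← splitSum_add]
  refine splitSum_congr fun u v _ => ?_
  rw [proj1_cohom hf1]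
  have h1 : (-1 : ℤ) ^ u.length • (letter (f (word u)) * cohom f (coder μ (word v))) =
      -(letter (f (word u)) * cohom f (coder μ (word v))) := by
    rcases Nat.even_or_odd u.length with h | h
    · rw [hf u (by rw [Nat.even_iff.1 h]; simp)]; simp
    · simp [h.neg_one_pow]
  rw [h1]
  simp only [LinearMap.sub_apply, LinearMap.comp_apply, map_sub, sub_mul, mul_sub, LinearMap.id_coe,
    id_eq, neg_smul, one_smul]
  abel

/-- `D` is a coderivation along `F` with corestriction `o`, where `f` is the corestriction of
`F` and `ε` the sign rule. -/
def IsCoderAlong (F : Words →ₗ[ℤ[X]] Words) (f : Cochain) (ε : ℤ) (o : Cochain)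
    (D : Words →ₗ[ℤ[X]] Words) : Prop :=
  ∀ w, D (word w) = splitSum (fun u v => letter (o (word u)) * F (word v) +
    ε • (letter (f (word u)) * D (word v))) w

namespace IsCoderAlong

variable {F : Words →ₗ[ℤ[X]] Words} {f : Cochain} {ε : ℤ} {o : Cochain}
  {D : Words →ₗ[ℤ[X]] Words} {n : ℕ}

theorem eq_zero (h : IsCoderAlong F f ε o D) (hf : f 1 = 0)
    (ho : ∀ w : List Basic, w.length < n → o (word w) = 0) (w : List Basic) (hw : w.length < n) :
    D (word w) = 0 := by
  induction hk : w.length using Nat.strong_induction_on generalizing w with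
  | _ k ih =>
    subst hk
    rw [h]
    refine splitSum_eq_zero fun u v huv => ?_
    have hl : u.length + v.length = w.length := by rw [← huv, List.length_append]
    rw [ho u (by omega)]
    rcases eq_or_ne u [] with rfl | hu
    · simp [hf]
    · have := List.length_pos_iff.2 hu
      rw [ih v.length (by omega) v (by omega) rfl]; simp

theorem eq_letter (h : IsCoderAlong F f ε o D) (hf : f 1 = 0) (hF : F 1 = 1)
    (ho : ∀ w : List Basic, w.length < n → o (word w) = 0) (w : List Basic) (hw : w.length = n) :
    D (word w) = letter (o (word w)) := by
  rw [h, splitSum_eq_last]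
  · rw [word_nil, hF, mul_one, ← word_nil]
    rcases eq_or_ne w [] with rfl | hw0
    · simp [hf]
    · rw [h.eq_zero hf ho [] (by have := List.length_pos_iff.2 hw0; simp; omega)]; simp
  · intro u v huv hv
    have hl : u.length + v.length = w.length := by rw [← huv, List.length_append]
    have := List.length_pos_iff.2 hv
    rw [ho u (by omega)]
    rcases eq_or_ne u [] with rfl | hu
    · simp [hf]
    · have := List.length_pos_iff.2 hu
      rw [h.eq_zero hf ho v (by omega)]; simp

/-- One length above the order of vanishing, only the whole word and its two subwords omitting one
end letter contribute. Applying a structure map to this formula gives the Hochschild cocycle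
condition for the lowest obstruction. -/
theorem eq_add (h : IsCoderAlong F f ε o D) (hf : f 1 = 0) (hF : F 1 = 1)
    (hf1 : ∀ x, f (word [x]) = TorusAlg.of x) (hF1 : ∀ x, F (word [x]) = word [x])
    (ho : ∀ w : List Basic, w.length < n → o (word w) = 0) (x y : Basic) (m : List Basic)
    (hw : m.length + 1 = n) :
    D (word (x :: (m ++ [y]))) = letter (o (word (x :: m))) * word [y] +
      letter (o (word (x :: (m ++ [y])))) + ε • (word [x] * letter (o (word (m ++ [y])))) := by
  rw [h, splitSum_add, ← List.cons_append, splitSum_append_singleton, splitSum_eq_last]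
  · rw [List.nil_append, hF1, word_nil, hF, mul_one]
    congr 1
    rw [List.cons_append, splitSum_cons, word_nil, hf, splitSum_eq_first]
    · rw [hf1, letter_of, h.eq_letter hf hF ho (m ++ [y]) (by simpa using hw)]
      simp
    · intro u v huv hu
      have hl : u.length + v.length = m.length + 1 := by
        rw [← List.length_append, huv]; simp
      have := List.length_pos_iff.2 hu
      rw [h.eq_zero hf ho v (by omega)]
      simp
  · intro u v huv hv
    have hl : u.length + v.length = m.length + 1 := by
      rw [← List.length_append, huv]; simp
    have := List.length_pos_iff.2 hv
    rw [ho u (by omega)]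
    simp

end IsCoderAlong

/-! ### The length filtration -/

/-- The span of the words of length at most `n`. -/
def lengthLE (n : ℕ) : Submodule ℤ[X] Words :=
  Submodule.span ℤ[X] {t | ∃ w : List Basic, w.length ≤ n ∧ t = word w}

theorem word_mem_lengthLE {w : List Basic} {n : ℕ} (h : w.length ≤ n) : word w ∈ lengthLE n :=
  Submodule.subset_span ⟨w, h, rfl⟩

theorem lengthLE_mono {m n : ℕ} (h : m ≤ n) : lengthLE m ≤ lengthLE n :=
  Submodule.span_mono fun _ ⟨w, hw, e⟩ => ⟨w, hw.trans h, e⟩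

theorem lengthLE_induction {n : ℕ} {S : Submodule ℤ[X] Words}
    (h : ∀ w : List Basic, w.length ≤ n → word w ∈ S) : lengthLE n ≤ S :=
  Submodule.span_le.2 fun _ ⟨w, hw, e⟩ => e ▸ h w hw

theorem word_mul_mem_lengthLE {w : List Basic} {t : Words} {m n : ℕ} (hw : w.length ≤ m)
    (ht : t ∈ lengthLE n) : word w * t ∈ lengthLE (m + n) := by
  have : lengthLE n ≤ (lengthLE (m + n)).comap (lmul (word w)) := lengthLE_induction fun v hv => by
    rw [Submodule.mem_comap, LinearMap.mulLeft_apply, ← word_append]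
    exact word_mem_lengthLE (by rw [List.length_append]; omega)
  exact this ht

theorem letter_mul_mem_lengthLE (a : A) {t : Words} {n : ℕ} (ht : t ∈ lengthLE n) :
    letter a * t ∈ lengthLE (n + 1) := by
  have : ⊤ ≤ (lengthLE (n + 1)).comap (LinearMap.mulRight ℤ[X] t ∘ₗ letter) := by
    rw [← TorusAlg.basis.span_eq, Submodule.span_le]
    rintro _ ⟨x, rfl⟩
    change letter (TorusAlg.of x) * t ∈ lengthLE (n + 1)
    rw [letter_of, add_comm]
    exact word_mul_mem_lengthLE le_rfl ht
  exact this (Submodule.mem_top (x := a))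

theorem splitSum_mem {S : Submodule ℤ[X] Words} {g : List Basic → List Basic → Words}
    {w : List Basic} (H : ∀ u v, u ++ v = w → g u v ∈ S) : splitSum g w ∈ S := by
  rw [splitSum_eq_sum]
  exact Submodule.sum_mem _ fun r _ => H _ _ (List.take_append_drop r w)

/-- Without μ₀ and μ₁, every block that is contracted has at least two letters. This is what makes a
change of μ or f in arity n visible only from arity n + 1 on. -/
theorem coder_mem_lengthLE {μ : Cochain} (h0 : μ 1 = 0) (h1 : ∀ x, μ (word [x]) = 0)
    (w : List Basic) : coder μ (word w) ∈ lengthLE (w.length - 1) := by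
  induction w with
  | nil => simp
  | cons x w ih =>
    rw [coder_cons]
    refine sub_mem (splitSum_mem fun u v huv => ?_) ?_
    · have hl : u.length + v.length = w.length + 1 := by
        rw [← List.length_append, huv]; simp
      match u with
      | [] => simp [h0]
      | [x] => simp [h1]
      | x :: y :: u =>
        simp only [List.length_cons] at hl
        exact lengthLE_mono (by rw [List.length_cons]; omega)
          (letter_mul_mem_lengthLE _ (word_mem_lengthLE (le_refl v.length)))
    · rcases eq_or_ne w [] with rfl | hw
      · simp
      · have := List.length_pos_iff.2 hw
        refine lengthLE_mono ?_ (word_mul_mem_lengthLE (m := 1) (by simp) ih)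
        simp; omega

theorem cohom_mem_lengthLE {f : Cochain} (hf : f 1 = 0) (w : List Basic) :
    cohom f (word w) ∈ lengthLE w.length := by
  induction hk : w.length using Nat.strong_induction_on generalizing w with
  | _ k ih =>
    subst hk
    rcases eq_or_ne w [] with rfl | hw
    · simp only [word_nil, cohom_one]; rw [← word_nil]; exact word_mem_lengthLE le_rfl
    · rw [cohom_of_ne_nil hf hw]
      refine splitSum_mem fun u v huv => ?_
      have hl : u.length + v.length = w.length := by rw [← huv, List.length_append]
      rcases eq_or_ne u [] with rfl | hu
      · simp [hf]
      · have := List.length_pos_iff.2 hu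
        exact lengthLE_mono (by omega) (letter_mul_mem_lengthLE _ (ih v.length (by omega) v rfl))

/-- Only the decomposition into single letters preserves the length, so the coalgebra map is
unipotent for the length filtration. -/
theorem cohom_sub_mem_lengthLE {f : Cochain} (hf : f 1 = 0)
    (hf1 : ∀ x, f (word [x]) = TorusAlg.of x) (w : List Basic) :
    cohom f (word w) - word w ∈ lengthLE (w.length - 1) := by
  induction w with
  | nil => simp
  | cons x w ih =>
    rw [cohom_of_ne_nil hf (by simp), splitSum_cons, word_nil, hf, map_zero, zero_mul, zero_add]
    cases w with
    | nil => simp [hf1]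
    | cons y w =>
      rw [splitSum_cons, hf1, letter_of, add_sub_right_comm, word_cons x (y :: w), ← mul_sub]
      refine add_mem ?_ (splitSum_mem fun u v huv => ?_)
      · refine lengthLE_mono ?_ (word_mul_mem_lengthLE (m := 1) (by simp) ih)
        simp; omega
      · have hl : u.length + v.length = w.length := by rw [← huv, List.length_append]
        refine lengthLE_mono ?_ (letter_mul_mem_lengthLE _ (cohom_mem_lengthLE hf v))
        simp; omega

/-- Two cochains agree on words of length at most `n`. -/
def AgreeLE {N : Type*} [AddCommGroup N] [Module ℤ[X] N] (n : ℕ) (p q : Words →ₗ[ℤ[X]] N) : Prop :=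
  ∀ w : List Basic, w.length ≤ n → p (word w) = q (word w)

theorem AgreeLE.eq_of_mem {N : Type*} [AddCommGroup N] [Module ℤ[X] N] {n : ℕ}
    {p q : Words →ₗ[ℤ[X]] N} (h : AgreeLE n p q) {t : Words} (ht : t ∈ lengthLE n) : p t = q t := by
  have : lengthLE n ≤ LinearMap.ker (p - q) := lengthLE_induction fun w hw => by
    rw [LinearMap.mem_ker, LinearMap.sub_apply, h w hw, sub_self]
  exact sub_eq_zero.1 (LinearMap.mem_ker.1 (this ht))

theorem AgreeLE.coder {n : ℕ} {μ ν : Cochain} (h : AgreeLE n μ ν) :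
    AgreeLE n (coder μ) (coder ν) := by
  intro w hw
  induction w with
  | nil => simp
  | cons x w ih =>
    rw [List.length_cons] at hw
    rw [coder_cons, coder_cons, ih (by omega)]
    refine congrArg (· - _) (splitSum_congr fun u v huv => ?_)
    have hl : u.length + v.length = w.length + 1 := by
      rw [← List.length_append, huv]; simp
    rw [h u (by omega)]

theorem AgreeLE.cohom {n : ℕ} {f g : Cochain} (hf : f 1 = 0) (hg : g 1 = 0) (h : AgreeLE n f g) :
    AgreeLE n (cohom f) (cohom g) := by
  intro w hw
  induction hk : w.length using Nat.strong_induction_on generalizing w with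
  | _ k ih =>
    subst hk
    rcases eq_or_ne w [] with rfl | hw0
    · simp
    · rw [cohom_of_ne_nil hf hw0, cohom_of_ne_nil hg hw0]
      refine splitSum_congr fun u v huv => ?_
      have hl : u.length + v.length = w.length := by rw [← huv, List.length_append]
      rcases eq_or_ne u [] with rfl | hu
      · simp [hf, hg]
      · have := List.length_pos_iff.2 hu
        rw [h u (by omega), ih v.length (by omega) v (by omega) rfl]

/-! ### Gradings of the word algebra by monoids -/

/-- Degrees of the paths and of the variable `U` in a monoid. -/
structure PathGrading (Q : Type) [Monoid Q] where
  deg : Basic → Q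
  var : Q
  var_comm : ∀ q, var * q = q * var

namespace PathGrading

variable {Q : Type} [Monoid Q] (γ : PathGrading Q)

/-- The degree of a word. -/
def wdeg (w : List Basic) : Q := (w.map γ.deg).prod

@[simp] theorem wdeg_nil : γ.wdeg [] = 1 := rfl

@[simp] theorem wdeg_cons (x : Basic) (w : List Basic) :
    γ.wdeg (x :: w) = γ.deg x * γ.wdeg w := by simp [wdeg]

theorem wdeg_append (u v : List Basic) : γ.wdeg (u ++ v) = γ.wdeg u * γ.wdeg v := by simp [wdeg]

theorem var_pow_comm (k : ℕ) (q : Q) : γ.var ^ k * q = q * γ.var ^ k :=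
  ((show Commute γ.var q from γ.var_comm q).pow_left k).eq

/-- The elements of the algebra of degree `q`. -/
def homA (q : Q) : AddSubgroup A :=
  AddSubgroup.closure {a | ∃ k b, a = (Polynomial.X : ℤ[X]) ^ k • TorusAlg.of b ∧
    γ.deg b * γ.var ^ k = q}

/-- The elements of the word algebra of degree `q`. -/
def homW (q : Q) : AddSubgroup Words :=
  AddSubgroup.closure {t | ∃ k w, t = (Polynomial.X : ℤ[X]) ^ k • word w ∧
    γ.wdeg w * γ.var ^ k = q}

variable {γ}

theorem homA_induction {q : Q} {S : AddSubgroup A}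
    (h : ∀ k b, γ.deg b * γ.var ^ k = q → (Polynomial.X : ℤ[X]) ^ k • TorusAlg.of b ∈ S) :
    γ.homA q ≤ S :=
  (AddSubgroup.closure_le _).2 fun _ ⟨k, b, e, hq⟩ => e ▸ h k b hq

theorem homW_induction {q : Q} {S : AddSubgroup Words}
    (h : ∀ k w, γ.wdeg w * γ.var ^ k = q → (Polynomial.X : ℤ[X]) ^ k • word w ∈ S) :
    γ.homW q ≤ S :=
  (AddSubgroup.closure_le _).2 fun _ ⟨k, b, e, hq⟩ => e ▸ h k b hq

theorem monomial_mem_homA (k : ℕ) (b : Basic) :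
    (Polynomial.X : ℤ[X]) ^ k • (TorusAlg.of b : A) ∈ γ.homA (γ.deg b * γ.var ^ k) :=
  AddSubgroup.subset_closure ⟨k, b, rfl, rfl⟩

theorem monomial_mem_homW (k : ℕ) (w : List Basic) :
    (Polynomial.X : ℤ[X]) ^ k • word w ∈ γ.homW (γ.wdeg w * γ.var ^ k) :=
  AddSubgroup.subset_closure ⟨k, w, rfl, rfl⟩

theorem of_mem_homA (b : Basic) : (TorusAlg.of b : A) ∈ γ.homA (γ.deg b) := by
  simpa using γ.monomial_mem_homA 0 b

theorem word_mem_homW (w : List Basic) : word w ∈ γ.homW (γ.wdeg w) := by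
  simpa using γ.monomial_mem_homW 0 w

theorem pow_smul_mem_homA {a : A} {q : Q} (h : a ∈ γ.homA q) (k : ℕ) :
    (Polynomial.X : ℤ[X]) ^ k • a ∈ γ.homA (q * γ.var ^ k) := by
  have : γ.homA q ≤ (γ.homA (q * γ.var ^ k)).comap
      (DistribSMul.toAddMonoidHom A ((Polynomial.X : ℤ[X]) ^ k)) := homA_induction fun l b e => by
    rw [AddSubgroup.mem_comap, DistribSMul.toAddMonoidHom_apply, smul_smul, ← pow_add, ← e,
      mul_assoc, ← pow_add, add_comm k l]
    exact monomial_mem_homA _ _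
  exact this h

theorem pow_smul_mem_homW {a : Words} {q : Q} (h : a ∈ γ.homW q) (k : ℕ) :
    (Polynomial.X : ℤ[X]) ^ k • a ∈ γ.homW (q * γ.var ^ k) := by
  have : γ.homW q ≤ (γ.homW (q * γ.var ^ k)).comap
      (DistribSMul.toAddMonoidHom Words ((Polynomial.X : ℤ[X]) ^ k)) :=
    homW_induction fun l b e => by
    rw [AddSubgroup.mem_comap, DistribSMul.toAddMonoidHom_apply, smul_smul, ← pow_add, ← e,
      mul_assoc, ← pow_add, add_comm k l]
    exact monomial_mem_homW _ _
  exact this h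

theorem letter_mem_homW {a : A} {q : Q} (h : a ∈ γ.homA q) : letter a ∈ γ.homW q := by
  have : γ.homA q ≤ (γ.homW q).comap letter.toAddMonoidHom := homA_induction fun k b e => by
    rw [AddSubgroup.mem_comap, LinearMap.toAddMonoidHom_coe, map_smul, letter_of, ← e]
    simpa using monomial_mem_homW (γ := γ) k [b]
  exact this h

theorem mul_mem_homW {s t : Words} {q r : Q} (hs : s ∈ γ.homW q) (ht : t ∈ γ.homW r) :
    s * t ∈ γ.homW (q * r) := by
  have h1 : ∀ u : List Basic, γ.homW r ≤ (γ.homW (γ.wdeg u * r)).comap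
      (AddMonoidHom.mulLeft (word u)) := fun u => homW_induction fun k w e => by
    rw [AddSubgroup.mem_comap, AddMonoidHom.coe_mulLeft, mul_smul_comm, ← word_append, ← e,
      ← mul_assoc, ← wdeg_append]
    exact monomial_mem_homW _ _
  have h2 : γ.homW q ≤ (γ.homW (q * r)).comap (AddMonoidHom.mulRight t) :=
    homW_induction fun k w e => by
      rw [AddSubgroup.mem_comap, AddMonoidHom.mulRight_apply, smul_mul_assoc, ← e, mul_assoc,
        γ.var_pow_comm, ← mul_assoc]
      exact pow_smul_mem_homW (h1 w ht) k
  exact h2 hs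

/-- A cochain shifts degrees by `s`. -/
def IsHom (γ : PathGrading Q) (s : Q) (p : Cochain) : Prop :=
  ∀ w, p (word w) ∈ γ.homA (s * γ.wdeg w)

/-- An endomorphism of the word algebra shifts degrees by `s`. -/
def IsHomEnd (γ : PathGrading Q) (s : Q) (p : Words →ₗ[ℤ[X]] Words) : Prop :=
  ∀ w, p (word w) ∈ γ.homW (s * γ.wdeg w)

theorem IsHom.apply_mem {s : Q} {p : Cochain} (hp : γ.IsHom s p) {t : Words} {q : Q}
    (ht : t ∈ γ.homW q) : p t ∈ γ.homA (s * q) := by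
  have : γ.homW q ≤ (γ.homA (s * q)).comap p.toAddMonoidHom := homW_induction fun k w e => by
    rw [AddSubgroup.mem_comap, LinearMap.toAddMonoidHom_coe, map_smul, ← e, ← mul_assoc]
    exact pow_smul_mem_homA (hp w) k
  exact this ht

theorem IsHomEnd.apply_mem {s : Q} {p : Words →ₗ[ℤ[X]] Words} (hp : γ.IsHomEnd s p) {t : Words}
    {q : Q} (ht : t ∈ γ.homW q) : p t ∈ γ.homW (s * q) := by
  have : γ.homW q ≤ (γ.homW (s * q)).comap p.toAddMonoidHom := homW_induction fun k w e => by
    rw [AddSubgroup.mem_comap, LinearMap.toAddMonoidHom_coe, map_smul, ← e, ← mul_assoc]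
    exact pow_smul_mem_homW (hp w) k
  exact this ht

theorem IsHom.add {s : Q} {p p' : Cochain} (hp : γ.IsHom s p) (hp' : γ.IsHom s p') :
    γ.IsHom s (p + p') := fun w => add_mem (hp w) (hp' w)

theorem IsHom.sub {s : Q} {p p' : Cochain} (hp : γ.IsHom s p) (hp' : γ.IsHom s p') :
    γ.IsHom s (p - p') := fun w => sub_mem (hp w) (hp' w)

theorem IsHomEnd.sub {s : Q} {p p' : Words →ₗ[ℤ[X]] Words} (hp : γ.IsHomEnd s p)
    (hp' : γ.IsHomEnd s p') : γ.IsHomEnd s (p - p') := fun w => sub_mem (hp w) (hp' w)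

theorem isHomEnd_id : γ.IsHomEnd 1 LinearMap.id := fun w => by
  rw [one_mul]; exact word_mem_homW w

theorem IsHomEnd.comp {s r : Q} {p p' : Words →ₗ[ℤ[X]] Words} (hp : γ.IsHomEnd s p)
    (hp' : γ.IsHomEnd r p') : γ.IsHomEnd (s * r) (p ∘ₗ p') := fun w => by
  rw [mul_assoc]; exact hp.apply_mem (hp' w)

theorem IsHom.comp {s r : Q} {p : Cochain} {p' : Words →ₗ[ℤ[X]] Words} (hp : γ.IsHom s p)
    (hp' : γ.IsHomEnd r p') : γ.IsHom (s * r) (p ∘ₗ p') := fun w => by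
  rw [mul_assoc]; exact hp.apply_mem (hp' w)

theorem splitSum_mem_homW {q : Q} {g : List Basic → List Basic → Words} {w : List Basic}
    (H : ∀ u v, u ++ v = w → g u v ∈ γ.homW q) : splitSum g w ∈ γ.homW q := by
  rw [splitSum_eq_sum]
  exact AddSubgroup.sum_mem _ fun r _ => H _ _ (List.take_append_drop r w)

theorem isHom_proj1 : γ.IsHom 1 proj1 := fun w => by
  by_cases h : w.length = 1
  · obtain ⟨x, rfl⟩ := List.length_eq_one_iff.1 h
    rw [proj1_singleton]
    simpa using of_mem_homA (γ := γ) x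
  · rw [proj1_of_length_ne_one h]; exact zero_mem _

/-- Centrality of `s` is needed to move the shift past the letters in front of the contracted block.
-/
theorem IsHom.coder {s : Q} (hs : ∀ q, s * q = q * s) {μ : Cochain} (hμ : γ.IsHom s μ) :
    γ.IsHomEnd s (coder μ) := fun w => by
  induction w with
  | nil => simp
  | cons x w ih =>
    rw [coder_cons]
    refine sub_mem (splitSum_mem_homW fun u v huv => ?_) ?_
    · rw [← huv, wdeg_append, ← mul_assoc]
      exact mul_mem_homW (letter_mem_homW (hμ u)) (word_mem_homW v)
    · rw [wdeg_cons, ← mul_assoc, hs, mul_assoc]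
      have h := word_mem_homW (γ := γ) [x]
      rw [wdeg_cons, wdeg_nil, mul_one] at h
      exact mul_mem_homW h ih

theorem IsHom.cohom {f : Cochain} (hf1 : f 1 = 0) (hf : γ.IsHom 1 f) :
    γ.IsHomEnd 1 (cohom f) := fun w => by
  induction hk : w.length using Nat.strong_induction_on generalizing w with
  | _ k ih =>
    subst hk
    rcases eq_or_ne w [] with rfl | hw
    · simpa using word_mem_homW (γ := γ) []
    · rw [cohom_of_ne_nil hf1 hw]
      refine splitSum_mem_homW fun u v huv => ?_
      have hl : u.length + v.length = w.length := by rw [← huv, List.length_append]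
      rcases eq_or_ne u [] with rfl | hu
      · simp [hf1]
      · have := List.length_pos_iff.2 hu
        have h1 := ih v.length (by omega) v rfl
        have h2 := hf u
        rw [one_mul] at h1 h2 ⊢
        rw [← huv, wdeg_append]
        exact mul_mem_homW (letter_mem_homW h2) h1

/-! ### Coefficients -/

/-- The coefficient of `U^k b`. -/
def _root_.TorusAInf.coefA (b : Basic) (k : ℕ) : A →+ ℤ :=
  (Polynomial.lcoeff ℤ k).toAddMonoidHom.comp
    ((Finsupp.lapply b).comp (TorusAlg.basis (R := ℤ[X])).repr.toLinearMap).toAddMonoidHom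

open Classical in
theorem _root_.TorusAInf.coefA_monomial (b b' : Basic) (k k' : ℕ) :
    coefA b k ((Polynomial.X : ℤ[X]) ^ k' • TorusAlg.of b') = if b = b' ∧ k = k' then 1 else 0 := by
  have : (TorusAlg.basis (R := ℤ[X])).repr (TorusAlg.of b') = Finsupp.single b' 1 :=
    Module.Basis.repr_self _ _
  simp only [coefA, AddMonoidHom.comp_apply, LinearMap.toAddMonoidHom_coe, LinearMap.comp_apply,
    LinearEquiv.coe_coe, map_smul, this, Finsupp.lapply_apply, Polynomial.lcoeff_apply,
    Finsupp.single_apply, smul_eq_mul]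
  by_cases h : b' = b
  · subst h; simp [Polynomial.coeff_X_pow]
  · rw [if_neg h, mul_zero, Polynomial.coeff_zero, if_neg (fun h' => h h'.1.symm)]

theorem _root_.TorusAInf.coefA_ext {a a' : A} (h : ∀ b k, coefA b k a = coefA b k a') : a = a' := by
  apply (TorusAlg.basis (R := ℤ[X])).repr.injective
  ext b k
  exact h b k

theorem coefA_eq_zero {a : A} {q : Q} (ha : a ∈ γ.homA q) {b : Basic} {k : ℕ}
    (h : γ.deg b * γ.var ^ k ≠ q) : coefA b k a = 0 := by
  classical
  have : γ.homA q ≤ (coefA b k).ker := homA_induction fun l b' e => by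
    rw [AddMonoidHom.mem_ker, coefA_monomial, if_neg]
    rintro ⟨rfl, rfl⟩
    exact h e
  exact this ha

theorem eq_zero_of_mem_homA {a : A} {q : Q} (ha : a ∈ γ.homA q)
    (h : ∀ b k, γ.deg b * γ.var ^ k ≠ q) : a = 0 :=
  coefA_ext fun b k => by rw [coefA_eq_zero ha (h b k), map_zero]

/-- Additive maps out of the algebra are determined by their values on monomials. -/
theorem _root_.TorusAInf.mem_of_monomials {S : AddSubgroup A}
    (h : ∀ k b, (Polynomial.X : ℤ[X]) ^ k • (TorusAlg.of b : A) ∈ S) (a : A) : a ∈ S := by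
  have h1 : ∀ (r : ℤ[X]) b, r • (TorusAlg.of b : A) ∈ S := fun r b => by
    induction r using Polynomial.induction_on' with
    | add p q hp hq => rw [add_smul]; exact add_mem hp hq
    | monomial n c =>
      rw [← Polynomial.C_mul_X_pow_eq_monomial, ← smul_smul, eq_intCast, Int.cast_smul_eq_zsmul]
      exact zsmul_mem (h n b) c
  rw [← (TorusAlg.basis (R := ℤ[X])).linearCombination_repr a, Finsupp.linearCombination_apply]
  exact AddSubgroup.sum_mem _ fun b _ => h1 _ b

end PathGrading

end TorusAInf

namespace TorusAInf

/-! ### The grading group -/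

namespace Grp

/-- The first coordinate. -/
def m (g : Grp) : ℚ := g.1.1.m
/-- The second coordinate. -/
def a (g : Grp) : ℚ := g.1.1.a
/-- The third coordinate. -/
def b (g : Grp) : ℚ := g.1.1.b
/-- The winding number. -/
def w (g : Grp) : ℤ := g.2.toAdd

theorem ext {g h : Grp} (hm : m g = m h) (ha : a g = a h) (hb : b g = b h) (hw : w g = w h) :
    g = h :=
  Prod.ext (Subtype.ext (Triple.ext hm ha hb)) hw

variable (g h : Grp)

theorem m_mul : m (g * h) = m g + m h + a g * b h - b g * a h := rfl
theorem a_mul : a (g * h) = a g + a h := rfl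
theorem b_mul : b (g * h) = b g + b h := rfl
theorem w_mul : w (g * h) = w g + w h := rfl
theorem m_inv : m g⁻¹ = -m g := rfl
theorem a_inv : a g⁻¹ = -a g := rfl
theorem b_inv : b g⁻¹ = -b g := rfl
theorem w_inv : w g⁻¹ = -w g := rfl
theorem m_one : m 1 = 0 := rfl
theorem a_one : a 1 = 0 := rfl
theorem b_one : b 1 = 0 := rfl
theorem w_one : w 1 = 0 := rfl
theorem m_lam : m lam = 1 := rfl
theorem a_lam : a lam = 0 := rfl
theorem b_lam : b lam = 0 := rfl
theorem w_lam : w lam = 0 := rfl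

theorem m_gammaRho (i : ZMod 4) : m (gammaRho i) = if i = 4 then -3 / 2 else -1 / 2 := by
  obtain rfl | rfl | rfl | rfl : i = 1 ∨ i = 2 ∨ i = 3 ∨ i = 4 := by revert i; decide
  all_goals simp +decide [m, gammaRho, grRho]
theorem a_gammaRho (i : ZMod 4) : a (gammaRho i) = if i = 1 ∨ i = 2 then 1 / 2 else -1 / 2 := by
  obtain rfl | rfl | rfl | rfl : i = 1 ∨ i = 2 ∨ i = 3 ∨ i = 4 := by revert i; decide
  all_goals simp +decide [a, gammaRho, grRho]
theorem b_gammaRho (i : ZMod 4) : b (gammaRho i) = if i = 2 ∨ i = 3 then 1 / 2 else -1 / 2 := by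
  obtain rfl | rfl | rfl | rfl : i = 1 ∨ i = 2 ∨ i = 3 ∨ i = 4 := by revert i; decide
  all_goals simp +decide [b, gammaRho, grRho]
theorem w_gammaRho (i : ZMod 4) : w (gammaRho i) = if i = 4 then 1 else 0 := rfl

end Grp

open Grp

theorem zmod4_cases (i : ZMod 4) : i = 1 ∨ i = 2 ∨ i = 3 ∨ i = 4 := by revert i; decide

theorem lam_mul_comm (g : Grp) : lam * g = g * lam := by
  apply Grp.ext <;> simp [m_mul, a_mul, b_mul, w_mul, m_lam, a_lam, b_lam,
    w_lam, add_comm]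

/-- The grading of `U`. -/
def gU : Grp := gammaRho 1 * gammaRho 2 * gammaRho 3 * gammaRho 4

theorem m_gU : m gU = -2 := by
  simp +decide [gU, m_mul, a_mul, b_mul, m_gammaRho, a_gammaRho, b_gammaRho]
  norm_num
theorem a_gU : a gU = 0 := by
  simp +decide [gU, a_mul, a_gammaRho]
  norm_num
theorem b_gU : b gU = 0 := by
  simp +decide [gU, b_mul, b_gammaRho]
  norm_num
theorem w_gU : w gU = 1 := by
  simp +decide

theorem gU_mul_comm (g : Grp) : gU * g = g * gU := by
  apply Grp.ext <;> simp [m_mul, a_mul, b_mul, w_mul, m_gU, a_gU, b_gU,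
    w_gU, add_comm]

/-- All four rotations of the loop have the same degree, which is central because its coordinates
`a` and `b` vanish. So U can be given this degree. -/
theorem gammaRho_loop (i : ZMod 4) :
    gammaRho i * gammaRho (i + 1) * gammaRho (i + 2) * gammaRho (i + 3) = gU := by
  rcases zmod4_cases i with rfl | rfl | rfl | rfl <;>
  apply Grp.ext <;>
  simp +decide [m_gU, a_gU, b_gU, m_mul, a_mul, b_mul, m_gammaRho,
    a_gammaRho, b_gammaRho] <;> norm_num

/-- The grading of the chord `ρᵢ ⋯ ρᵢ₊ₙ`. -/
def chordGr (i : ZMod 4) : ℕ → Grp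
  | 0 => gammaRho i
  | n + 1 => chordGr i n * gammaRho (i + n + 1)

theorem chordGr_mul (i : ZMod 4) (n m : ℕ) :
    chordGr i n * chordGr (i + n + 1) m = chordGr i (n + m + 1) := by
  induction m with
  | zero => rfl
  | succ m ih =>
    rw [chordGr, ← mul_assoc, ih, ← add_assoc n, chordGr]
    congr 2
    push_cast
    ring

theorem chordGr_add_four (i : ZMod 4) (n : ℕ) : chordGr i (n + 4) = chordGr i n * gU := by
  rw [← gammaRho_loop (i + n + 1)]
  simp only [chordGr, mul_assoc]
  push_cast
  ring_nf

theorem chordGr_add_mul_four (i : ZMod 4) (n c : ℕ) :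
    chordGr i (n + 4 * c) = chordGr i n * gU ^ c := by
  induction c with
  | zero => simp
  | succ c ih => rw [Nat.mul_succ, ← add_assoc, chordGr_add_four, ih, mul_assoc, ← pow_succ]

namespace Basic

/-- The vertex at which a path starts. -/
def source : Basic → Fin 2
  | idem j => j
  | chord i _ => src i

/-- The vertex at which a path ends. -/
def target : Basic → Fin 2
  | idem j => j
  | chord i n => tgt (i + n)

/-- The grading of a path. -/
def gr : Basic → Grp
  | idem _ => 1
  | chord i n => chordGr i n

theorem mul_eq_some {x y z : Basic} (h : x.mul y = some z) :
    x.target = y.source ∧ z.source = x.source ∧ z.target = y.target ∧ z.gr = x.gr * y.gr := by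
  rcases x with j | ⟨i, n⟩ <;> rcases y with k | ⟨k, m⟩ <;> simp only [mul] at h <;>
    split_ifs at h with hc <;> obtain rfl := Option.some_injective _ h <;> subst hc <;>
    simp [source, target, gr, src_succ, chordGr_mul]
  congr 1
  ring

end Basic

/-! ### The two gradings -/

/-- The grading by `Γ`, with letters shifted by `λ`. -/
def grpGrading : PathGrading Grp where
  deg b := lam * b.gr
  var := gU
  var_comm := gU_mul_comm

/-- The monoid recording the end points of a path together with its grading. -/
abbrev Deg : Type := Matrix (Fin 2) (Fin 2) ℤ × Grp

/-- The grading by `Γ` and by the end points. -/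
def pathGrading : PathGrading Deg where
  deg b := (Matrix.single b.source b.target 1, lam * b.gr)
  var := (1, gU)
  var_comm q := Prod.ext (by simp) (gU_mul_comm _)

/-- The degree `λʲ`. -/
def shift (j : ℤ) : Deg := (1, lam ^ j)

theorem shift_comm (j : ℤ) (q : Deg) : shift j * q = q * shift j :=
  Prod.ext (by simp [shift]) ((show Commute lam q.2 from lam_mul_comm q.2).zpow_left j).eq

theorem shift_mul (i j : ℤ) : shift i * shift j = shift (i + j) :=
  Prod.ext (by simp [shift]) (by simp [shift, zpow_add])

theorem shift_zero : shift 0 = 1 := Prod.ext (by simp [shift]) (by simp [shift])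

theorem shift_fst (j : ℤ) : (shift j).1 = 1 := rfl

/-- A cochain that respects end points and shifts the grading by `λʲ`, for letters shifted
by `λ`. -/
abbrev Good (j : ℤ) (p : Cochain) : Prop := pathGrading.IsHom (shift j) p

theorem wdeg_grp (w : List Basic) : (pathGrading.wdeg w).2 = grpGrading.wdeg w := by
  induction w with
  | nil => rfl
  | cons x w ih => rw [PathGrading.wdeg_cons, PathGrading.wdeg_cons, Prod.snd_mul, ih]; rfl

theorem homA_path_le (q : Deg) : pathGrading.homA q ≤ grpGrading.homA q.2 :=
  PathGrading.homA_induction fun k b e => by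
    have h : q.2 = grpGrading.deg b * grpGrading.var ^ k := by
      rw [← e, Prod.snd_mul, Prod.pow_snd]; rfl
    rw [h]
    exact PathGrading.monomial_mem_homA k b

theorem Good.isHom_grp {j : ℤ} {p : Cochain} (hp : Good j p) : grpGrading.IsHom (lam ^ j) p :=
  fun w => by
    have h := homA_path_le _ (hp w)
    rw [Prod.snd_mul, wdeg_grp] at h
    exact h

theorem deg_fst_ne_zero (b : Basic) (k : ℕ) :
    (pathGrading.deg b * pathGrading.var ^ k).1 ≠ 0 := by
  intro h
  have := congrFun (congrFun h b.source) b.target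
  simp [pathGrading] at this

theorem homA_eq_zero {a : A} {q : Deg} (hq : q.1 = 0) (ha : a ∈ pathGrading.homA q) : a = 0 :=
  PathGrading.eq_zero_of_mem_homA ha fun b k e => deg_fst_ne_zero b k (by rw [e, hq])

/-- The end-point component of the empty word is the identity matrix, which is not a matrix unit, so
no monomial has the required degree. -/
theorem Good.map_one {j : ℤ} {p : Cochain} (hp : Good j p) : p 1 = 0 := by
  rw [← word_nil]
  refine PathGrading.eq_zero_of_mem_homA (hp []) fun b k e => ?_
  have h := congrArg Prod.fst e
  have h0 := congrFun (congrFun h 0) 0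
  have h1 := congrFun (congrFun h 1) 1
  simp [pathGrading, shift] at h0 h1
  by_cases hb : b.source = 0
  · simp [hb] at h1
  · simp [hb] at h0

theorem wdeg_cons_fst (x : Basic) (w : List Basic) : (pathGrading.wdeg (x :: w)).1 = 0 ∨
    ∃ t, (pathGrading.wdeg (x :: w)).1 = Matrix.single x.source t 1 := by
  induction w generalizing x with
  | nil => exact Or.inr ⟨x.target, by simp [pathGrading]⟩
  | cons y w ih =>
    rw [PathGrading.wdeg_cons, Prod.fst_mul]
    rcases ih y with h | ⟨t, h⟩
    · left; rw [h, mul_zero]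
    · rw [h]
      by_cases hxy : x.target = y.source
      · right; exact ⟨t, by simp [pathGrading, hxy]⟩
      · left; simp [pathGrading, Matrix.single_mul_single_of_ne, hxy]

theorem wdeg_append_fst (w : List Basic) (x : Basic) : (pathGrading.wdeg (w ++ [x])).1 = 0 ∨
    ∃ s, (pathGrading.wdeg (w ++ [x])).1 = Matrix.single s x.target 1 := by
  induction w with
  | nil => exact Or.inr ⟨x.source, by simp [pathGrading]⟩
  | cons y w ih =>
    rw [List.cons_append, PathGrading.wdeg_cons, Prod.fst_mul]
    rcases ih with h | ⟨t, h⟩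
    · left; rw [h, mul_zero]
    · rw [h]
      by_cases hxy : y.target = t
      · right; exact ⟨y.source, by simp [pathGrading, hxy]⟩
      · left; simp [pathGrading, Matrix.single_mul_single_of_ne, hxy]

/-- A product of matrix units vanishes at a pair that does not compose. Homogeneity for
`pathGrading` thus encodes that operations are bimodule maps over the idempotents, defined on
tensors over them. -/
theorem wdeg_fst_eq_zero (u v : List Basic) {x y : Basic} (h : x.target ≠ y.source) :
    (pathGrading.wdeg (u ++ x :: y :: v)).1 = 0 := by
  rw [PathGrading.wdeg_append, PathGrading.wdeg_cons, PathGrading.wdeg_cons, ← mul_assoc,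
    ← mul_assoc, Prod.fst_mul, Prod.fst_mul, Prod.fst_mul, mul_assoc (pathGrading.wdeg u).1]
  simp [pathGrading, Matrix.single_mul_single_of_ne, h]

theorem iota_mul_of (j : Fin 2) (b : Basic) :
    iota j * (TorusAlg.of b : A) = if j = b.source then TorusAlg.of b else 0 := by
  rw [iota, TorusAlg.of_mul_of]
  rcases b with k | ⟨i, n⟩ <;> simp only [Basic.mul, Basic.source] <;> split_ifs with h <;>
    simp [TorusAlg.ofOption, h]

theorem of_mul_iota (j : Fin 2) (b : Basic) :
    (TorusAlg.of b : A) * iota j = if j = b.target then TorusAlg.of b else 0 := by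
  rw [iota, TorusAlg.of_mul_of]
  rcases b with k | ⟨i, n⟩ <;> simp only [Basic.mul, Basic.target] <;>
    split_ifs <;>
    simp_all [TorusAlg.ofOption]

/-! ### End points -/

theorem single_inj {s t s' t' : Fin 2}
    (h : (Matrix.single s t 1 : Matrix (Fin 2) (Fin 2) ℤ) = Matrix.single s' t' 1) :
    s = s' ∧ t = t' := by
  have := congrFun (congrFun h s') t'
  simp only [Matrix.single_apply] at this
  simpa using this

theorem monomial_fst {q : Deg} {k : ℕ} {b : Basic}
    (e : pathGrading.deg b * pathGrading.var ^ k = q) :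
    q.1 = Matrix.single b.source b.target 1 := by
  rw [← e]; simp [pathGrading]

theorem monomial_snd {q : Deg} {k : ℕ} {b : Basic}
    (e : pathGrading.deg b * pathGrading.var ^ k = q) : q.2 = lam * b.gr * gU ^ k := by
  rw [← e]; simp [pathGrading]

theorem iota_mul_mem_homA {a : A} {q : Deg} (ha : a ∈ pathGrading.homA q) {s t : Fin 2}
    (hq : q.1 = Matrix.single s t 1) (j : Fin 2) : iota j * a = if j = s then a else 0 := by
  have : pathGrading.homA q ≤ (AddMonoidHom.mulLeft (iota j) -
      (if j = s then AddMonoidHom.id A else 0)).ker := PathGrading.homA_induction fun k b e => by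
    obtain ⟨rfl, rfl⟩ := single_inj (hq.symm.trans (monomial_fst e))
    rw [AddMonoidHom.mem_ker, AddMonoidHom.sub_apply, AddMonoidHom.coe_mulLeft, sub_eq_zero]
    have : iota j * ((Polynomial.X : ℤ[X]) ^ k • (TorusAlg.of b : A)) =
        (Polynomial.X : ℤ[X]) ^ k • (iota j * TorusAlg.of b) := by
      rw [TorusAlg.mul_def, TorusAlg.mul_def, map_smul]
    rw [this, iota_mul_of]
    split_ifs <;> simp
  have := this ha
  rw [AddMonoidHom.mem_ker, AddMonoidHom.sub_apply, sub_eq_zero] at this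
  refine this.trans ?_
  split_ifs <;> simp

theorem mul_iota_mem_homA {a : A} {q : Deg} (ha : a ∈ pathGrading.homA q) {s t : Fin 2}
    (hq : q.1 = Matrix.single s t 1) (j : Fin 2) : a * iota j = if j = t then a else 0 := by
  have : pathGrading.homA q ≤ (AddMonoidHom.mulRight (iota j) -
      (if j = t then AddMonoidHom.id A else 0)).ker := PathGrading.homA_induction fun k b e => by
    obtain ⟨rfl, rfl⟩ := single_inj (hq.symm.trans (monomial_fst e))
    rw [AddMonoidHom.mem_ker, AddMonoidHom.sub_apply, AddMonoidHom.mulRight_apply, sub_eq_zero]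
    have : ((Polynomial.X : ℤ[X]) ^ k • (TorusAlg.of b : A)) * iota j =
        (Polynomial.X : ℤ[X]) ^ k • (TorusAlg.of b * iota j) := by
      rw [TorusAlg.mul_def, TorusAlg.mul_def, map_smul, LinearMap.smul_apply]
    rw [this, of_mul_iota]
    split_ifs <;> simp
  have := this ha
  rw [AddMonoidHom.mem_ker, AddMonoidHom.sub_apply, sub_eq_zero] at this
  refine this.trans ?_
  split_ifs <;> simp

namespace Good

variable {j : ℤ} {p : Cochain}

theorem eq_zero_of_wdeg (hp : Good j p) {w : List Basic} (h : (pathGrading.wdeg w).1 = 0) :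
    p (word w) = 0 :=
  homA_eq_zero (by rw [Prod.fst_mul, h, mul_zero]) (hp w)

theorem eq_zero_of_ne (hp : Good j p) (u v : List Basic) {x y : Basic} (h : x.target ≠ y.source) :
    p (word (u ++ x :: y :: v)) = 0 :=
  hp.eq_zero_of_wdeg (wdeg_fst_eq_zero u v h)

theorem iota_mul (hp : Good j p) (k : Fin 2) (x : Basic) (w : List Basic) :
    iota k * p (word (x :: w)) = if k = x.source then p (word (x :: w)) else 0 := by
  rcases wdeg_cons_fst x w with h | ⟨t, h⟩
  · simp [hp.eq_zero_of_wdeg h]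
  · exact iota_mul_mem_homA (hp _) (by rw [Prod.fst_mul, h, shift_fst, one_mul]) k

theorem mul_iota (hp : Good j p) (k : Fin 2) (x : Basic) (w : List Basic) :
    p (word (w ++ [x])) * iota k = if k = x.target then p (word (w ++ [x])) else 0 := by
  rcases wdeg_append_fst w x with h | ⟨t, h⟩
  · simp [hp.eq_zero_of_wdeg h]
  · exact mul_iota_mem_homA (hp _) (by rw [Prod.fst_mul, h, shift_fst, one_mul]) k

end Good

/-! ### Parity -/

/-- A path from the vertex `1`, as a grading. -/
def baseGr (s : Fin 2) : Grp := if s = 1 then 1 else gammaRho 2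

/-- The exponent of `λ` modulo two, on the gradings of closed paths. -/
def IsPar (g : Grp) (n : ℤ) : Prop :=
  ∃ x y l : ℤ, a g = x ∧ b g = y ∧ m g + x * y + 3 / 2 * x + 1 / 2 * y = n + 2 * l

/-- The commutator term of the group law is x y' − y x', and the quadratic correction xy changes it
to 2 x y'. So the exponent becomes additive modulo 2. -/
theorem IsPar.mul {g h : Grp} {n k : ℤ} (hg : IsPar g n) (hh : IsPar h k) :
    IsPar (g * h) (n + k) := by
  obtain ⟨x, y, l, h1, h2, h3⟩ := hg
  obtain ⟨x', y', l', h1', h2', h3'⟩ := hh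
  refine ⟨x + x', y + y', l + l' + x * y', ?_, ?_, ?_⟩
  · rw [a_mul, h1, h1']; push_cast; ring
  · rw [b_mul, h2, h2']; push_cast; ring
  · rw [m_mul, h1, h2, h1', h2']; push_cast; linear_combination h3 + h3'

theorem isPar_lam : IsPar lam 1 := ⟨0, 0, 0, by simp [a_lam], by simp [b_lam], by simp [m_lam]⟩

theorem isPar_gU : IsPar gU 0 := ⟨0, 0, -1, by simp [a_gU], by simp [b_gU], by simp [m_gU]⟩

theorem isPar_one : IsPar 1 0 := ⟨0, 0, 0, by simp [a_one], by simp [b_one], by simp [m_one]⟩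

theorem IsPar.inv {g : Grp} {n : ℤ} (hg : IsPar g n) : IsPar g⁻¹ (-n) := by
  obtain ⟨x, y, l, h1, h2, h3⟩ := hg
  refine ⟨-x, -y, -l + x * y, ?_, ?_, ?_⟩
  · rw [a_inv, h1]; push_cast; ring
  · rw [b_inv, h2]; push_cast; ring
  · rw [m_inv]; push_cast; linear_combination -h3

theorem isPar_lam_zpow (j : ℤ) : IsPar (lam ^ j) j := by
  induction j with
  | zero => simpa using isPar_one
  | succ k ih => rw [zpow_add_one]; exact ih.mul isPar_lam
  | pred k ih => rw [zpow_sub_one]; exact ih.mul isPar_lam.inv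

theorem isPar_gU_pow (k : ℕ) : IsPar (gU ^ k) 0 := by
  induction k with
  | zero => simpa using isPar_one
  | succ k ih => rw [pow_succ]; simpa using ih.mul isPar_gU

theorem IsPar.congr {g : Grp} {n k : ℤ} (h : IsPar g n) (h' : IsPar g k) : n % 2 = k % 2 := by
  obtain ⟨x, y, l, h1, h2, h3⟩ := h
  obtain ⟨x', y', l', h1', h2', h3'⟩ := h'
  have hx : x = x' := by exact_mod_cast h1.symm.trans h1'
  have hy : y = y' := by exact_mod_cast h2.symm.trans h2'
  subst hx hy
  have : n + 2 * l = k + 2 * l' := by exact_mod_cast h3.symm.trans h3'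
  omega

/-- The degree `q` is zero or that of a path with the parity `n`. -/
def PathPar (q : Deg) (n : ℤ) : Prop :=
  q.1 = 0 ∨ ∃ s t, q.1 = Matrix.single s t 1 ∧ IsPar (baseGr s * q.2 * (baseGr t)⁻¹) n

/-- The base path at the common vertex cancels, so composable paths behave like closed ones. -/
theorem PathPar.mul {q r : Deg} {n k : ℤ} (hq : PathPar q n) (hr : PathPar r k) :
    PathPar (q * r) (n + k) := by
  rcases hq with hq | ⟨s, t, hq, hq'⟩
  · left; rw [Prod.fst_mul, hq, zero_mul]
  rcases hr with hr | ⟨t', u, hr, hr'⟩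
  · left; rw [Prod.fst_mul, hr, mul_zero]
  by_cases h : t = t'
  · subst h
    right
    refine ⟨s, u, by rw [Prod.fst_mul, hq, hr]; simp, ?_⟩
    have := hq'.mul hr'
    rwa [Prod.snd_mul, show baseGr s * (q.2 * r.2) * (baseGr u)⁻¹ =
      baseGr s * q.2 * (baseGr t)⁻¹ * (baseGr t * r.2 * (baseGr u)⁻¹) by group]
  · left; rw [Prod.fst_mul, hq, hr, Matrix.single_mul_single_of_ne _ _ _ _ h]

theorem PathPar.shift_mul {q : Deg} {n : ℤ} (hq : PathPar q n) (j : ℤ) :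
    PathPar (shift j * q) (j + n) := by
  rcases hq with hq | ⟨s, t, hq, hq'⟩
  · left; rw [Prod.fst_mul, hq, mul_zero]
  · right
    refine ⟨s, t, by rw [Prod.fst_mul, hq, shift_fst, one_mul], ?_⟩
    have h := (isPar_lam_zpow j).mul hq'
    have e : lam ^ j * baseGr s = baseGr s * lam ^ j :=
      ((show Commute lam (baseGr s) from lam_mul_comm _).zpow_left j).eq
    rwa [← mul_assoc, ← mul_assoc, e, mul_assoc (baseGr s)] at h

theorem PathPar.mul_var_pow {q : Deg} {n : ℤ} (hq : PathPar q n) (k : ℕ) :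
    PathPar (q * pathGrading.var ^ k) n := by
  rcases hq with hq | ⟨s, t, hq, hq'⟩
  · left; rw [Prod.fst_mul, hq, zero_mul]
  · right
    refine ⟨s, t, by rw [Prod.fst_mul, hq]; simp [pathGrading], ?_⟩
    have h := hq'.mul (isPar_gU_pow k)
    have e : gU ^ k * (baseGr t)⁻¹ = (baseGr t)⁻¹ * gU ^ k :=
      ((show Commute gU (baseGr t)⁻¹ from gU_mul_comm _).pow_left k).eq
    rw [mul_assoc, ← e, ← mul_assoc, add_zero] at h
    simpa [pathGrading, mul_assoc] using h

/-- The linear terms 3x/2 + y/2 in `IsPar` are fitted so that all four arrows, closed up by the base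
path ρ₂, become even. -/
theorem pathPar_rho (i : ZMod 4) : PathPar (Matrix.single (src i) (tgt i) 1, gammaRho i) 0 := by
  refine Or.inr ⟨_, _, rfl, ?_⟩
  rcases zmod4_cases i with rfl | rfl | rfl | rfl
  · refine ⟨1, 0, 0, ?_, ?_, ?_⟩ <;>
    simp +decide [baseGr, a_mul, b_mul, m_mul, m_gammaRho, a_gammaRho, b_gammaRho] <;> norm_num
  · refine ⟨0, 0, 0, ?_, ?_, ?_⟩ <;>
    simp +decide [baseGr, a_one, b_one, m_one]
  · refine ⟨0, 1, 0, ?_, ?_, ?_⟩ <;>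
    simp +decide [baseGr, a_mul, b_mul, m_mul, m_gammaRho, a_gammaRho, b_gammaRho] <;> norm_num
  · refine ⟨-1, -1, -1, ?_, ?_, ?_⟩ <;>
    simp +decide [baseGr, a_mul, b_mul, m_mul, a_inv, b_inv, m_inv, m_gammaRho, a_gammaRho, b_gammaRho] <;> norm_num

theorem pathPar_chord (i : ZMod 4) (n : ℕ) :
    PathPar (Matrix.single (src i) (tgt (i + n)) 1, chordGr i n) 0 := by
  induction n with
  | zero => simpa [chordGr] using pathPar_rho i
  | succ n ih =>
    have h := ih.mul (pathPar_rho (i + n + 1))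
    rw [src_succ] at h
    simpa [Prod.mk_mul_mk, chordGr, add_assoc] using h

theorem pathPar_deg (x : Basic) : PathPar (pathGrading.deg x) 1 := by
  have h : PathPar (Matrix.single x.source x.target 1, x.gr) 0 := by
    cases x with
    | idem j => exact Or.inr ⟨j, j, rfl, by simpa [Basic.gr] using isPar_one⟩
    | chord i n => exact pathPar_chord i n
  simpa [shift, pathGrading] using h.shift_mul 1

theorem pathPar_wdeg {w : List Basic} (hw : w ≠ []) : PathPar (pathGrading.wdeg w) w.length := by
  induction w with
  | nil => exact absurd rfl hw
  | cons x w ih =>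
    rcases eq_or_ne w [] with rfl | hw'
    · simpa using pathPar_deg x
    · have h := (pathPar_deg x).mul (ih hw')
      rw [PathGrading.wdeg_cons, List.length_cons]
      rwa [add_comm, ← Nat.cast_succ] at h

/-- A monomial has the parity of one shifted letter, a nonempty word that of its length, and a
degree λ^j shift adds j. Thus structure maps (j = −1) live in even arity and homomorphisms (j = 0)
in odd arity, which trivializes most signs. -/
theorem Good.hasParity {j : ℤ} {p : Cochain} (hp : Good j p) {d : ℕ} (hd : (j + d) % 2 = 1) :
    HasParity d p := by
  intro w hw
  rcases eq_or_ne w [] with rfl | hw0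
  · rw [word_nil, hp.map_one]
  refine PathGrading.eq_zero_of_mem_homA (hp w) fun b k e => ?_
  have h1 := (pathPar_deg b).mul_var_pow k
  have h2 := (pathPar_wdeg hw0).shift_mul j
  rw [e] at h1
  have h3 := monomial_fst e
  have hne : (shift j * pathGrading.wdeg w).1 ≠ 0 := by
    rw [← e]; exact deg_fst_ne_zero b k
  obtain ⟨s, t, h4, h5⟩ := h1.resolve_left hne
  obtain ⟨s', t', h4', h5'⟩ := h2.resolve_left hne
  obtain ⟨rfl, rfl⟩ := single_inj (h4.symm.trans h4')
  have := h5.congr h5'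
  omega

/-! ### Words without contractible products -/

/-- The word `ρᵢ, ρᵢ₋₁, …` of length `n`. -/
def koszul (i : ZMod 4) : ℕ → List Basic
  | 0 => []
  | n + 1 => .chord i 0 :: koszul (i - 1) n

theorem length_koszul (i : ZMod 4) (n : ℕ) : (koszul i n).length = n := by
  induction n generalizing i with
  | zero => rfl
  | succ n ih => simp [koszul, ih]

theorem grpGrading_koszul_succ (i : ZMod 4) (n : ℕ) :
    grpGrading.wdeg (koszul i (n + 1)) = lam * gammaRho i * grpGrading.wdeg (koszul (i - 1) n) := by
  rw [koszul, PathGrading.wdeg_cons]; rfl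

/-- Running once backwards around the loop, with the four factors λ from the shifted letters,
changes the winding number by one and nothing else. -/
theorem koszul_add_four (i : ZMod 4) (n : ℕ) (g : Grp) (hg : g = grpGrading.wdeg (koszul i (n + 4))) :
    m g = m (grpGrading.wdeg (koszul i n)) ∧ a g = a (grpGrading.wdeg (koszul i n)) ∧
    b g = b (grpGrading.wdeg (koszul i n)) ∧ w g = w (grpGrading.wdeg (koszul i n)) + 1 := by
  subst hg
  have e : i - 1 - 1 - 1 - 1 = i := by revert i; decide
  rw [grpGrading_koszul_succ, grpGrading_koszul_succ, grpGrading_koszul_succ,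
    grpGrading_koszul_succ, e]
  generalize grpGrading.wdeg (koszul i n) = h
  rcases zmod4_cases i with rfl | rfl | rfl | rfl <;> refine ⟨?_, ?_, ?_, ?_⟩ <;>
    simp +decide [a_mul, b_mul, m_mul, w_mul, m_gammaRho, a_gammaRho, b_gammaRho, w_gammaRho, m_lam,
      a_lam, b_lam, w_lam] <;> ring

theorem grpGrading_koszul_four_mul (i : ZMod 4) (n : ℕ) :
    m (grpGrading.wdeg (koszul i (4 * n))) = 0 ∧ a (grpGrading.wdeg (koszul i (4 * n))) = 0 ∧
    b (grpGrading.wdeg (koszul i (4 * n))) = 0 ∧ w (grpGrading.wdeg (koszul i (4 * n))) = n := by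
  induction n with
  | zero => exact ⟨rfl, rfl, rfl, rfl⟩
  | succ n ih =>
    obtain ⟨h1, h2, h3, h4⟩ := koszul_add_four i (4 * n) _ rfl
    rw [Nat.mul_succ, h1, h2, h3, h4, ih.1, ih.2.1, ih.2.2.1, ih.2.2.2]
    exact ⟨rfl, rfl, rfl, by push_cast; rfl⟩

theorem grpGrading_koszul_four_mul_add_two (i : ZMod 4) (n : ℕ) :
    a (grpGrading.wdeg (koszul i (4 * n + 2))) = a (gammaRho i) + a (gammaRho (i - 1)) ∧
    b (grpGrading.wdeg (koszul i (4 * n + 2))) = b (gammaRho i) + b (gammaRho (i - 1)) := by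
  induction n with
  | zero =>
    rw [show 4 * 0 + 2 = 0 + 1 + 1 from rfl, grpGrading_koszul_succ, grpGrading_koszul_succ, koszul]
    simp [a_mul, b_mul, a_lam, b_lam]
  | succ n ih =>
    obtain ⟨h1, h2, h3, h4⟩ := koszul_add_four i (4 * n + 2) _ rfl
    rw [show 4 * (n + 1) + 2 = 4 * n + 2 + 4 by ring, h2, h3, ih.1, ih.2]
    exact ⟨rfl, rfl⟩

theorem a_gU_pow (k : ℕ) : a (gU ^ k) = 0 := by
  induction k with
  | zero => exact a_one
  | succ k ih => rw [pow_succ, a_mul, ih, a_gU, add_zero]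
theorem b_gU_pow (k : ℕ) : b (gU ^ k) = 0 := by
  induction k with
  | zero => exact b_one
  | succ k ih => rw [pow_succ, b_mul, ih, b_gU, add_zero]
theorem m_gU_pow (k : ℕ) : m (gU ^ k) = -2 * k := by
  induction k with
  | zero => simp [m_one]
  | succ k ih => rw [pow_succ, m_mul, ih, m_gU, a_gU, b_gU]; push_cast; ring
theorem w_gU_pow (k : ℕ) : w (gU ^ k) = k := by
  induction k with
  | zero => simp [w_one]
  | succ k ih => rw [pow_succ, w_mul, ih, w_gU]; push_cast; ring

theorem chord_cases (n : ℕ) : ∃ c, n = 0 + 4 * c ∨ n = 1 + 4 * c ∨ n = 2 + 4 * c ∨ n = 3 + 4 * c :=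
  ⟨n / 4, by omega⟩

/-- The paths of trivial spin-c grading. -/
theorem basic_of_ab_eq_zero {x : Basic} (ha : a x.gr = 0) (hb : b x.gr = 0) :
    (∃ j, x = .idem j) ∨ ∃ i c, x = .chord i (3 + 4 * c) ∧ x.gr = gU ^ (c + 1) := by
  rcases x with j | ⟨i, n⟩
  · exact Or.inl ⟨j, rfl⟩
  right
  obtain ⟨c, rfl | rfl | rfl | rfl⟩ := chord_cases n
  iterate 3
    exfalso
    rw [Basic.gr, chordGr_add_mul_four, a_mul, a_gU_pow] at ha
    rw [Basic.gr, chordGr_add_mul_four, b_mul, b_gU_pow] at hb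
    revert ha hb
    rcases zmod4_cases i with rfl | rfl | rfl | rfl <;>
    simp +decide [chordGr, a_mul, b_mul, a_gammaRho, b_gammaRho] <;> norm_num
  refine ⟨i, c, rfl, ?_⟩
  rw [Basic.gr, chordGr_add_mul_four, pow_succ', ← gammaRho_loop i]
  congr 1
  simp [chordGr, add_assoc]
  norm_num

/-- Odd lengths are excluded by parity. In length 4q the target monomial must have trivial
coordinates `a` and `b`, so it is a power of the loop degree times an idempotent degree; winding
makes that power q, and the λ-coordinate reads −1 = 1 − 2q. In length 4q + 2 no path from the right
vertex has the required coordinates. -/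
theorem Good.koszul_eq_zero {p : Cochain} (hp : Good (-1) p) (i : ZMod 4) {n : ℕ} (h4 : n ≠ 4) :
    p (word (koszul i n)) = 0 := by
  by_cases hpar : n % 2 = 0
  swap
  · exact hp.hasParity (d := 0) (by norm_num) _ (by rw [length_koszul]; omega)
  rcases eq_or_ne n 0 with rfl | hn0
  · rw [koszul, word_nil, hp.map_one]
  refine PathGrading.eq_zero_of_mem_homA (hp _) fun x k e => ?_
  have e1 := monomial_fst e
  have e2 := monomial_snd e
  rw [Prod.snd_mul, wdeg_grp] at e2
  have hm := congrArg m e2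
  have ha := congrArg a e2
  have hb := congrArg b e2
  have hw := congrArg w e2
  simp only [shift, zpow_neg_one, m_mul, a_mul, b_mul, w_mul, m_inv, a_inv, b_inv, w_inv, m_lam,
    a_lam, b_lam, w_lam, a_gU_pow, b_gU_pow, m_gU_pow, w_gU_pow] at hm ha hb hw
  obtain ⟨q, rfl | rfl⟩ : ∃ q, n = 4 * q ∨ n = 4 * q + 2 := ⟨n / 4, by omega⟩
  · obtain ⟨h1, h2, h3, h5⟩ := grpGrading_koszul_four_mul i q
    rw [h1] at hm
    rw [h2] at ha
    rw [h3] at hb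
    rw [h5] at hw
    rcases basic_of_ab_eq_zero (by linarith) (by linarith) with ⟨j, rfl⟩ | ⟨i', c, -, hx⟩
    · simp only [Basic.gr, m_one, w_one] at hm hw
      have hwq : (q : ℚ) = k := by
        have : (q : ℤ) = k := by linarith
        exact_mod_cast this
      have : (q : ℚ) = 1 := by linarith
      have : q = 1 := by exact_mod_cast this
      omega
    · rw [hx, m_gU_pow, a_gU_pow, b_gU_pow] at hm
      rw [hx, w_gU_pow] at hw
      have hwq : (q : ℚ) = (c + 1 : ℕ) + k := by
        have : (q : ℤ) = (c + 1 : ℕ) + k := by linarith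
        exact_mod_cast this
      have : (q : ℚ) = 1 := by linarith
      have : q = 1 := by exact_mod_cast this
      omega
  · obtain ⟨h1, h2⟩ := grpGrading_koszul_four_mul_add_two i q
    rw [h1] at ha
    rw [h2] at hb
    -- The coordinates `a` and `b` alone do not suffice: ρ_{i-1}ρ_i has the same ones, but starts at
    -- the other vertex.
    have hs : x.source = src i := by
      rw [Prod.fst_mul, shift_fst, one_mul] at e1
      rcases wdeg_cons_fst (.chord i 0) (koszul (i - 1) (4 * q + 1)) with h | ⟨t, h⟩
      · rw [koszul, h] at e1
        have h0 := deg_fst_ne_zero x k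
        rw [monomial_fst rfl, ← e1] at h0
        exact absurd rfl h0
      · rw [koszul, h] at e1
        exact (single_inj e1).1.symm
    clear e e1 e2 hm hw hp h1 h2
    rcases x with j | ⟨i', n⟩
    · simp only [Basic.gr, a_one, b_one] at ha hb
      revert ha hb
      rcases zmod4_cases i with rfl | rfl | rfl | rfl <;>
        simp +decide [a_gammaRho, b_gammaRho]
    · obtain ⟨c, rfl | rfl | rfl | rfl⟩ := chord_cases n <;>
      simp only [Basic.gr, chordGr_add_mul_four, a_mul, b_mul, a_gU_pow, b_gU_pow] at ha hb <;>
      simp only [Basic.source] at hs <;>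
      revert ha hb hs <;>
      rcases zmod4_cases i with rfl | rfl | rfl | rfl <;>
      rcases zmod4_cases i' with rfl | rfl | rfl | rfl <;>
      simp +decide [chordGr, a_mul, b_mul, a_gammaRho, b_gammaRho] <;> norm_num

end TorusAInf

namespace TorusAInf

open Basic (idem chord source target)

/-! ### The multiplication as a cochain -/

/-- The multiplication. -/
def mulC : Cochain := lin fun w => match w with
  | [x, y] => TorusAlg.of x * TorusAlg.of y
  | _ => 0

theorem mulC_pair (x y : Basic) : mulC (word [x, y]) = TorusAlg.of x * TorusAlg.of y :=
  lin_word _ _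

theorem mulC_of_length_ne_two {w : List Basic} (h : w.length ≠ 2) : mulC (word w) = 0 := by
  rw [mulC, lin_word]
  match w, h with
  | [], _ => rfl
  | [x], _ => rfl
  | [x, y], h => exact absurd rfl h
  | _ :: _ :: _ :: _, _ => rfl

theorem mulC_one : mulC 1 = 0 := by
  rw [← word_nil]; exact mulC_of_length_ne_two (by simp)

theorem coder_mulC_singleton (x : Basic) : coder mulC (word [x]) = 0 := by
  simp [coder_cons, splitSum_cons, mulC_one, mulC_of_length_ne_two (w := [x])]

theorem coder_mulC (x y : Basic) (w : List Basic) : coder mulC (word (x :: y :: w)) =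
    letter (TorusAlg.of x * TorusAlg.of y) * word w - word [x] * coder mulC (word (y :: w)) := by
  rw [coder_cons, splitSum_cons, splitSum_cons, splitSum_eq_first, word_nil, mulC_one,
    mulC_of_length_ne_two (w := [x]) (by simp), mulC_pair]
  · simp
  · intro u v _ hu
    have := List.length_pos_iff.2 hu
    rw [mulC_of_length_ne_two (by simp; omega)]
    simp

theorem homA_mul {a a' : A} {q q' : Deg} (h : a ∈ pathGrading.homA q)
    (h' : a' ∈ pathGrading.homA q') : a * a' ∈ pathGrading.homA (shift (-1) * q * q') := by
  have h1 : ∀ x y : Basic, (TorusAlg.of x * TorusAlg.of y : A) ∈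
      pathGrading.homA (shift (-1) * pathGrading.deg x * pathGrading.deg y) := fun x y => by
    rw [TorusAlg.of_mul_of]
    rcases hz : x.mul y with _ | z
    · exact zero_mem _
    · obtain ⟨e1, e2, e3, e4⟩ := Basic.mul_eq_some hz
      have : shift (-1) * pathGrading.deg x * pathGrading.deg y = pathGrading.deg z := by
        refine Prod.ext ?_ ?_
        · simp [shift, pathGrading, e1, e2, e3]
        · simp only [shift, pathGrading, e4, Prod.snd_mul, zpow_neg_one, inv_mul_cancel_left]
          rw [← mul_assoc x.gr, ← lam_mul_comm, mul_assoc]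
      rw [this]
      exact PathGrading.of_mem_homA z
  have h2 : ∀ x : Basic, pathGrading.homA q' ≤
      (pathGrading.homA (shift (-1) * pathGrading.deg x * q')).comap
        (AddMonoidHom.mulLeft (TorusAlg.of x)) := fun x =>
    PathGrading.homA_induction fun k y e => by
      have e' : (TorusAlg.of x : A) * ((Polynomial.X : ℤ[X]) ^ k • (TorusAlg.of y : A)) =
          (Polynomial.X : ℤ[X]) ^ k • (TorusAlg.of x * TorusAlg.of y) := by
        rw [TorusAlg.mul_def, TorusAlg.mul_def, map_smul]
      rw [AddSubgroup.mem_comap, AddMonoidHom.coe_mulLeft, e', ← e, ← mul_assoc]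
      exact PathGrading.pow_smul_mem_homA (h1 x y) k
  have h3 : pathGrading.homA q ≤ (pathGrading.homA (shift (-1) * q * q')).comap
      (AddMonoidHom.mulRight a') := PathGrading.homA_induction fun k x e => by
    have e' : ((Polynomial.X : ℤ[X]) ^ k • (TorusAlg.of x : A)) * a' =
        (Polynomial.X : ℤ[X]) ^ k • (TorusAlg.of x * a') := by
      rw [TorusAlg.mul_def, TorusAlg.mul_def, map_smul, LinearMap.smul_apply]
    rw [AddSubgroup.mem_comap, AddMonoidHom.mulRight_apply, e', ← e, ← mul_assoc, mul_assoc _ _ q',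
      pathGrading.var_pow_comm, ← mul_assoc]
    exact PathGrading.pow_smul_mem_homA (h2 x h') k
  exact h3 h

theorem good_mulC : Good (-1) mulC := fun w => by
  by_cases h : w.length = 2
  · obtain ⟨x, y, rfl⟩ := List.length_eq_two.1 h
    rw [mulC_pair, PathGrading.wdeg_cons, PathGrading.wdeg_cons, PathGrading.wdeg_nil, mul_one,
      ← mul_assoc]
    exact homA_mul (PathGrading.of_mem_homA x) (PathGrading.of_mem_homA y)
  · rw [mulC_of_length_ne_two h]; exact zero_mem _

theorem chord_mul_chord (i : ZMod 4) (n k : ℕ) :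
    (TorusAlg.of (chord i n) * TorusAlg.of (chord (i + n + 1) k) : A) =
      TorusAlg.of (chord i (n + k + 1)) := by
  rw [TorusAlg.of_mul_of, Basic.mul, if_pos rfl]; rfl

theorem rho_mul_chord (i : ZMod 4) (k : ℕ) :
    (TorusAlg.of (chord i 0) * TorusAlg.of (chord (i + 1) k) : A) =
      TorusAlg.of (chord i (k + 1)) := by
  have := chord_mul_chord i 0 k
  simpa using this

theorem chord_mul_chord_eq_zero {i j : ZMod 4} {n : ℕ} (h : j ≠ i + n + 1) (k : ℕ) :
    (TorusAlg.of (chord i n) * TorusAlg.of (chord j k) : A) = 0 := by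
  rw [TorusAlg.of_mul_of, Basic.mul, if_neg h]; rfl

/-- Every product with a chord on the left is a chord with the same start, or zero. -/
theorem chord_mul_eq (i : ZMod 4) (n : ℕ) (y : Basic) :
    (TorusAlg.of (chord i n) * TorusAlg.of y : A) = 0 ∨
      ∃ k, (TorusAlg.of (chord i n) * TorusAlg.of y : A) = TorusAlg.of (chord i k) := by
  rw [TorusAlg.of_mul_of]
  rcases y with j | ⟨j, m⟩ <;> rw [Basic.mul] <;> split_ifs
  · exact Or.inr ⟨_, rfl⟩
  · exact Or.inl rfl
  · exact Or.inr ⟨_, rfl⟩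
  · exact Or.inl rfl

/-! ### The matching of words -/

/-- `ρᵢ` followed by the word has a first contractible product after length-one chords with
vanishing products. -/
inductive MTail : ZMod 4 → List Basic → Prop
  | here (i : ZMod 4) (n : ℕ) (r : List Basic) : MTail i (chord (i + 1) n :: r)
  | step (i : ZMod 4) (r : List Basic) : MTail (i - 1) r → MTail i (chord (i - 1) 0 :: r)

/-- `ρᵢ` followed by the word has a first chord of length at least two after length-one chords with
vanishing products. -/
inductive STail : ZMod 4 → List Basic → Prop
  | here (i : ZMod 4) (n : ℕ) (r : List Basic) : STail i (chord (i - 1) (n + 1) :: r)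
  | step (i : ZMod 4) (r : List Basic) : STail (i - 1) r → STail i (chord (i - 1) 0 :: r)

theorem sub_one_ne_add_one (i : ZMod 4) : i - 1 ≠ i + 1 := by revert i; decide

/-- Contract the first contractible product. -/
def merge : ZMod 4 → List Basic → List Basic
  | i, chord j n :: r => if j = i + 1 then chord i (n + 1) :: r else chord i 0 :: merge j r
  | _, _ => []

/-- The sign of the first contraction in the Hochschild differential. -/
def mergeSign : ZMod 4 → List Basic → ℤ
  | i, chord j _ :: r => if j = i + 1 then 1 else -mergeSign j r
  | _, _ => 1

theorem merge_here (i : ZMod 4) (n : ℕ) (r : List Basic) :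
    merge i (chord (i + 1) n :: r) = chord i (n + 1) :: r := by rw [merge, if_pos rfl]

theorem merge_step (i : ZMod 4) (r : List Basic) :
    merge i (chord (i - 1) 0 :: r) = chord i 0 :: merge (i - 1) r := by
  rw [merge, if_neg (sub_one_ne_add_one i)]

theorem mergeSign_here (i : ZMod 4) (n : ℕ) (r : List Basic) :
    mergeSign i (chord (i + 1) n :: r) = 1 := by rw [mergeSign, if_pos rfl]

theorem mergeSign_step (i : ZMod 4) (n : ℕ) (r : List Basic) :
    mergeSign i (chord (i - 1) n :: r) = -mergeSign (i - 1) r := by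
  rw [mergeSign, if_neg (sub_one_ne_add_one i)]

theorem mergeSign_mul_self (i : ZMod 4) (r : List Basic) :
    mergeSign i r * mergeSign i r = 1 := by
  induction r generalizing i with
  | nil => rfl
  | cons x r ih =>
    rcases x with j | ⟨j, n⟩
    · rfl
    · rw [mergeSign]; split_ifs
      · rfl
      · rw [neg_mul_neg, ih]

/-- Splitting the first long chord after its first arrow undoes a first contraction. This is the
inverse direction of the matching. -/
theorem exists_merge_eq {i : ZMod 4} {s : List Basic} (h : STail i s) :
    ∃ m, MTail (i - 1) m ∧ merge (i - 1) m = s ∧ m.length = s.length := by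
  induction h with
  | here i n r =>
    refine ⟨chord (i - 1 + 1) n :: r, MTail.here _ _ _, ?_, rfl⟩
    rw [merge_here]
  | step i r _ ih =>
    obtain ⟨m, h1, h2, h3⟩ := ih
    exact ⟨_, MTail.step _ _ h1, by rw [merge_step, h2], by simp [h3]⟩

theorem MTail.ne_nil {i : ZMod 4} {m : List Basic} (h : MTail i m) : m ≠ [] := by
  cases h <;> simp

/-- If the first nonzero product involves the last letter, then everything before that letter is
critical; otherwise that product survives. -/
theorem MTail.dropLast {i : ZMod 4} {m : List Basic} {y : Basic} (h : MTail i (m ++ [y])) :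
    MTail i m ∨ m = koszul (i - 1) m.length := by
  induction m generalizing i with
  | nil => exact Or.inr rfl
  | cons x m ih =>
    rw [List.cons_append] at h
    cases h with
    | here _ n r => exact Or.inl (MTail.here _ _ _)
    | step _ r h' =>
      rcases ih h' with h' | h'
      · exact Or.inl (MTail.step _ _ h')
      · right; rw [List.length_cons, koszul, ← h']

theorem src_eq_tgt {i j : ZMod 4} (h : src j = tgt i) : j = i + 1 ∨ j = i - 1 := by
  revert i j; decide

/-- The classification of the words without idempotents that are paths. -/
theorem tail_cases (i : ZMod 4) (r : List Basic) (hr : ∀ j, idem j ∉ r)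
    (hp : (pathGrading.wdeg (chord i 0 :: r)).1 ≠ 0) :
    r = koszul (i - 1) r.length ∨ MTail i r ∨ STail i r := by
  induction r generalizing i with
  | nil => exact Or.inl rfl
  | cons x r ih =>
    rcases x with j | ⟨j, n⟩
    · exact absurd List.mem_cons_self (hr j)
    have hs : src j = tgt i := by
      by_contra hne
      refine hp (wdeg_fst_eq_zero [] r (x := chord i 0) (y := chord j n) ?_)
      simpa [target, source] using Ne.symm hne
    have hj : j = i + 1 ∨ j = i - 1 := src_eq_tgt hs
    rcases hj with rfl | rfl
    · exact Or.inr (Or.inl (MTail.here _ _ _))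
    cases n with
    | succ n => exact Or.inr (Or.inr (STail.here _ _ _))
    | zero =>
      have hp' : (pathGrading.wdeg (chord (i - 1) 0 :: r)).1 ≠ 0 := fun h0 => hp (by
        rw [PathGrading.wdeg_cons, Prod.fst_mul, h0, mul_zero])
      rcases ih (i - 1) (fun k hk => hr k (List.mem_cons_of_mem _ hk)) hp' with h | h | h
      · left; rw [List.length_cons, koszul, ← h]
      · exact Or.inr (Or.inl (MTail.step _ _ h))
      · exact Or.inr (Or.inr (STail.step _ _ h))

/-- A cochain that vanishes on contractible words only sees the first contraction. -/
theorem apply_coder_mulC {i : ZMod 4} {m : List Basic} (h : MTail i m) {φ : Cochain}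
    (hφ : ∀ r, MTail i r → r.length + 1 = m.length → φ (word (chord i 0 :: r)) = 0) :
    φ (coder mulC (word (chord i 0 :: m))) = mergeSign i m • φ (word (merge i m)) := by
  induction h generalizing φ with
  | here i n r =>
    -- Contractions after the first one leave a chord starting at i + 1 right after ρ_i, because a
    -- product with such a chord on the left keeps its start. The resulting words are again
    -- contractible, so the functional kills them.
    have key : ∀ (r : List Basic) (n : ℕ) (ψ : Cochain),
        (∀ k r', r'.length + 1 = r.length → ψ (word (chord (i + 1) k :: r')) = 0) →
        ψ (coder mulC (word (chord (i + 1) n :: r))) = 0 := by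
      intro r n ψ hψ
      cases r with
      | nil => rw [coder_mulC_singleton, map_zero]
      | cons y r =>
        rw [coder_mulC, map_sub]
        have h1 : ψ (letter (TorusAlg.of (chord (i + 1) n) * TorusAlg.of y) * word r) = 0 := by
          rcases chord_mul_eq (i + 1) n y with h | ⟨k, h⟩
          · rw [h]; simp
          · rw [h, ← word_cons', hψ k r (by simp)]
        have h2 : ∀ t ∈ Submodule.span ℤ[X]
            {t | ∃ r' : List Basic, r'.length = r.length ∧ t = word r'},
            ψ (word [chord (i + 1) n] * t) = 0 := by
          intro t ht
          induction ht using Submodule.span_induction with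
          | mem t ht =>
            obtain ⟨r', hr', rfl⟩ := ht
            rw [← word_cons, hψ n r' (by simp [hr'])]
          | zero => simp
          | add s t _ _ hs ht => rw [mul_add, map_add, hs, ht, add_zero]
          | smul c t _ ht => rw [mul_smul_comm, map_smul, ht, smul_zero]
        have h3 : ∀ (y : Basic) (r : List Basic), coder mulC (word (y :: r)) ∈
            Submodule.span ℤ[X] {t | ∃ r' : List Basic, r'.length = r.length ∧ t = word r'} := by
          intro y r
          induction r generalizing y with
          | nil => rw [coder_mulC_singleton]; exact zero_mem _
          | cons z r ih =>
            rw [coder_mulC]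
            refine sub_mem ?_ ?_
            · rw [TorusAlg.of_mul_of]
              rcases y.mul z with _ | x
              · simp [TorusAlg.ofOption]
              · refine Submodule.subset_span ⟨x :: r, rfl, ?_⟩
                rw [TorusAlg.ofOption, word_cons']
            · have := ih z
              generalize coder mulC (word (z :: r)) = t at this
              induction this using Submodule.span_induction with
              | mem t ht =>
                obtain ⟨r', hr', rfl⟩ := ht
                exact Submodule.subset_span ⟨y :: r', by simp [hr'], by rw [← word_cons]⟩
              | zero => simp
              | add s t _ _ hs ht => rw [mul_add]; exact add_mem hs ht
              | smul c t _ ht => rw [mul_smul_comm]; exact Submodule.smul_mem _ _ ht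
        rw [h1, h2 _ (h3 y r), sub_zero]
    rw [coder_mulC, rho_mul_chord, merge_here, mergeSign_here, one_smul, map_sub, ← word_cons',
      sub_eq_self]
    exact key r n (φ ∘ₗ lmul (word [chord i 0])) fun k r' hr' => by
      rw [LinearMap.comp_apply, LinearMap.mulLeft_apply, ← word_cons]
      exact hφ _ (MTail.here _ _ _) (by simpa using hr')
  | step i r h ih =>
    rw [coder_mulC, chord_mul_chord_eq_zero (by simpa using sub_one_ne_add_one i), map_zero,
      zero_mul, zero_sub, map_neg, merge_step, mergeSign_step, neg_smul]
    have := ih (φ := φ ∘ₗ lmul (word [chord i 0])) fun r' hr' hl => by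
      rw [LinearMap.comp_apply, LinearMap.mulLeft_apply, ← word_cons]
      exact hφ _ (MTail.step _ _ hr') (by simpa using hl)
    rw [LinearMap.comp_apply, LinearMap.mulLeft_apply, LinearMap.comp_apply,
      LinearMap.mulLeft_apply, ← word_cons] at this
    rw [this]

/-- A Hochschild cocycle that vanishes on contractible words and on the words without contractible
products vanishes. -/
theorem eq_zero_of_cocycle {j : ℤ} {e : Cochain} {n : ℕ} (hgood : Good j e)
    (hidem : ∀ w, (∃ k, idem k ∈ w) → e (word w) = 0)
    (hM : ∀ i r, MTail i r → r.length + 1 = n → e (word (chord i 0 :: r)) = 0)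
    (hK : ∀ i, e (word (koszul i n)) = 0)
    (hcoc : ∀ x y m, m.length + 1 = n → e (coder mulC (word (x :: (m ++ [y])))) =
      TorusAlg.of x * e (word (m ++ [y])) +
        (-1 : ℤ) ^ m.length • (e (word (x :: m)) * TorusAlg.of y))
    (w : List Basic) (hw : w.length = n) : e (word w) = 0 := by
  -- The cocycle identity on a contractible word of length n + 1: only its first contraction
  -- survives in the differential, and the term multiplied on the right vanishes because the word
  -- without its last letter is contractible or critical.
  have hcoc' : ∀ i m, MTail i m → m.length = n →
      mergeSign i m • e (word (merge i m)) = TorusAlg.of (chord i 0) * e (word m) := by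
    intro i m hm hl
    rw [← apply_coder_mulC hm fun r hr hr' => hM i r hr (by omega)]
    obtain ⟨m, y, rfl⟩ := List.eq_nil_or_concat m |>.resolve_left hm.ne_nil
    rw [List.concat_eq_append] at *
    rw [List.length_append, List.length_singleton] at hl
    rw [hcoc _ _ _ hl]
    have : e (word (chord i 0 :: m)) = 0 := by
      rcases hm.dropLast with h | h
      · exact hM i m h hl
      · rw [h]
        have := hK i
        rwa [← hl, koszul] at this
    rw [this, zero_mul, smul_zero, add_zero]
  have hcoc'' : ∀ i m, MTail i m → m.length = n → e (word m) = 0 → e (word (merge i m)) = 0 := by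
    intro i m hm hl h0
    rw [← one_smul ℤ (e _), ← mergeSign_mul_self i m, ← smul_smul, hcoc' i m hm hl, h0, mul_zero,
      smul_zero]
  -- Words starting with a single arrow. In the only case not assumed, the word is the contraction
  -- of one whose tail is contractible, so its value is a multiple of 0.
  have hrho : ∀ i r, r.length + 1 = n → e (word (chord i 0 :: r)) = 0 := by
    intro i r hl
    by_cases hi : ∃ k, idem k ∈ r
    · exact hidem _ (hi.imp fun k hk => List.mem_cons_of_mem _ hk)
    by_cases hp : (pathGrading.wdeg (chord i 0 :: r)).1 = 0
    · exact hgood.eq_zero_of_wdeg hp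
    rcases tail_cases i r (not_exists.1 hi) hp with h | h | h
    · have := hK i
      rw [← hl, koszul, ← h] at this
      exact this
    · exact hM i r h hl
    · obtain ⟨m, h1, h2, h3⟩ := exists_merge_eq h
      rw [← h2, ← merge_step]
      refine hcoc'' i _ (MTail.step _ _ h1) ?_ (hM _ _ h1 (by omega))
      rw [List.length_cons]; omega
  -- A longer first chord arises by contracting ρ_i with the chord that is shorter by one arrow, and
  -- `hcoc''` passes vanishing from the shorter chord to the longer one.
  have hchord : ∀ k i r, r.length + 1 = n → e (word (chord i k :: r)) = 0 := by
    intro k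
    induction k with
    | zero => exact hrho
    | succ k ih =>
      intro i r hl
      rw [← merge_here]
      exact hcoc'' i _ (MTail.here _ _ _) (by simpa using hl) (ih _ _ hl)
  match w with
  | [] => rw [word_nil, hgood.map_one]
  | idem k :: r => exact hidem _ ⟨k, List.mem_cons_self⟩
  | chord i k :: r => exact hchord k i r (by simpa using hw)

/-! ### The contraction -/

/-- The contraction on words starting with `ρᵢ`. -/
def hTail : (List Basic → A) → ZMod 4 → List Basic → A
  | c, i, chord j 0 :: r => if j = i - 1 then -hTail (fun w => c (chord j 0 :: w)) j r else 0
  | c, i, chord j (n + 1) :: r =>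
    if j = i - 1 then c (chord j 0 :: chord (j + 1) n :: r) else 0
  | _, _, _ => 0

/-- The contraction on words starting with a chord. -/
def hChord (c : List Basic → A) (r : List Basic) : ℕ → ZMod 4 → A
  | 0, i => -hTail (fun w => c (chord i 0 :: w)) i r
  | n + 1, i => c (chord i 0 :: chord (i + 1) n :: r) +
      TorusAlg.of (chord i 0) * hChord c r n (i + 1)

/-- The contraction of normalized Hochschild cochains. -/
def hWord (c : List Basic → A) : List Basic → A
  | chord i n :: r => hChord c r n i
  | _ => 0

theorem hTail_of_mTail {i : ZMod 4} {r : List Basic} (h : MTail i r) (c : List Basic → A) :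
    hTail c i r = 0 := by
  induction h generalizing c with
  | here i n r =>
    cases n <;> rw [hTail, if_neg (sub_one_ne_add_one i).symm]
  | step i r _ ih => rw [hTail, if_pos rfl, ih, neg_zero]

theorem hTail_koszul (c : List Basic → A) (i : ZMod 4) (n : ℕ) :
    hTail c i (koszul (i - 1) n) = 0 := by
  induction n generalizing i c with
  | zero => rw [koszul, hTail] <;> simp
  | succ n ih => rw [koszul, hTail, if_pos rfl, ih, neg_zero]

theorem hWord_koszul (c : List Basic → A) (i : ZMod 4) (n : ℕ) : hWord c (koszul i n) = 0 := by
  cases n with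
  | zero => rfl
  | succ n => rw [koszul, hWord, hChord, hTail_koszul, neg_zero]

theorem hWord_of_mTail {i : ZMod 4} {r : List Basic} (h : MTail i r) (c : List Basic → A) :
    hWord c (chord i 0 :: r) = 0 := by
  rw [hWord, hChord, hTail_of_mTail h, neg_zero]

theorem hTail_eq_zero {c : List Basic → A} {i : ZMod 4} {r : List Basic} {P : List Basic → Prop}
    (hc : ∀ w, P w → c w = 0)
    (hP : ∀ u j n v, r = u ++ chord j (n + 1) :: v →
      P (u ++ chord j 0 :: chord (j + 1) n :: v)) : hTail c i r = 0 := by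
  induction r generalizing c i P with
  | nil => rw [hTail] <;> simp
  | cons x r ih =>
    rcases x with j | ⟨j, _ | n⟩
    · rw [hTail] <;> simp
    · rw [hTail]
      split_ifs
      · rw [ih (P := fun w => P (chord j 0 :: w)) (fun w hw => hc _ hw), neg_zero]
        intro u k n v huv
        exact hP (chord j 0 :: u) k n v (by rw [huv]; rfl)
      · rfl
    · rw [hTail]
      split_ifs
      · exact hc _ (hP [] j n r rfl)
      · rfl

theorem hChord_eq_zero {c : List Basic → A} {r : List Basic} {P : List Basic → Prop}
    (hc : ∀ w, P w → c w = 0) (hP0 : ∀ i n, P (chord i 0 :: chord (i + 1) n :: r))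
    (hP : ∀ i u j n v, r = u ++ chord j (n + 1) :: v →
      P (chord i 0 :: (u ++ chord j 0 :: chord (j + 1) n :: v))) (n : ℕ) (i : ZMod 4) :
    hChord c r n i = 0 := by
  induction n generalizing i with
  | zero =>
    rw [hChord, hTail_eq_zero (P := fun w => P (chord i 0 :: w)) (fun w hw => hc _ hw) (hP i),
      neg_zero]
  | succ n ih => rw [hChord, hc _ (hP0 i n), ih, mul_zero, add_zero]

theorem hWord_of_length_ne {c : List Basic → A} {n : ℕ} (hc : ∀ w, w.length ≠ n + 1 → c w = 0)
    {w : List Basic} (hw : w.length ≠ n) : hWord c w = 0 := by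
  match w with
  | [] => rfl
  | idem k :: r => rfl
  | chord i k :: r =>
    rw [List.length_cons] at hw
    refine hChord_eq_zero (P := fun w => w.length ≠ n + 1) hc (fun i n => ?_) ?_ k i
    · simpa using hw
    · rintro i u j n v rfl
      simp at hw ⊢
      omega

theorem hWord_of_idem_mem {c : List Basic → A} (hc : ∀ w, (∃ k, idem k ∈ w) → c w = 0)
    {w : List Basic} (hw : ∃ k, idem k ∈ w) : hWord c w = 0 := by
  match w with
  | [] => rfl
  | idem k :: r => rfl
  | chord i k :: r =>
    obtain ⟨l, hl⟩ := hw
    have hl' : idem l ∈ r := by simpa using hl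
    refine hChord_eq_zero (P := fun w => ∃ k, idem k ∈ w) hc (fun i n => ?_) ?_ k i
    · exact ⟨l, by simp [hl']⟩
    · rintro i u j n v rfl
      exact ⟨l, by simpa using hl'⟩

/-- Splitting a chord creates one more shifted letter, hence one factor λ. -/
theorem deg_rho_mul_deg_chord (i : ZMod 4) (n : ℕ) :
    pathGrading.deg (chord i 0) * pathGrading.deg (chord (i + 1) n) =
      shift 1 * pathGrading.deg (chord i (n + 1)) := by
  refine Prod.ext ?_ ?_
  · have e : i + 1 + (n : ZMod 4) = i + ((n : ZMod 4) + 1) := by ring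
    simp [pathGrading, source, target, shift, src_succ, e]
  · have := chordGr_mul i 0 n
    simp only [Nat.cast_zero, add_zero, zero_add] at this
    simp only [pathGrading, shift, Basic.gr, ← this, Prod.snd_mul, zpow_one]
    rw [mul_assoc, ← mul_assoc (chordGr i 0), ← lam_mul_comm]
    simp only [mul_assoc]

theorem hTail_mem {c : List Basic → A} {q : Deg} (hc : ∀ w, c w ∈ pathGrading.homA
    (q * pathGrading.wdeg w)) (i : ZMod 4) (r : List Basic) :
    hTail c i r ∈ pathGrading.homA (shift 1 * q * pathGrading.wdeg r) := by
  induction r generalizing c i q with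
  | nil => rw [hTail] <;> simp
  | cons x r ih =>
    rcases x with j | ⟨j, _ | n⟩
    · rw [hTail] <;> simp
    · rw [hTail]
      split_ifs
      · have := ih (c := fun w => c (chord j 0 :: w)) (q := q * pathGrading.deg (chord j 0))
          (fun w => by have := hc (chord j 0 :: w); rwa [PathGrading.wdeg_cons, ← mul_assoc] at this) j
        rw [PathGrading.wdeg_cons]
        simp only [← mul_assoc] at this ⊢
        exact neg_mem this
      · exact zero_mem _
    · rw [hTail]
      split_ifs
      · have := hc (chord j 0 :: chord (j + 1) n :: r)
        rw [PathGrading.wdeg_cons, PathGrading.wdeg_cons, ← mul_assoc (pathGrading.deg _),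
          deg_rho_mul_deg_chord, mul_assoc, ← mul_assoc q, ← shift_comm] at this
        rwa [PathGrading.wdeg_cons]
      · exact zero_mem _

/-- Each term splits one chord, which raises the degree by λ; the left multiplications by arrows in
`hChord` compensate for the arrows already removed from the first chord. -/
theorem hWord_good {c : List Basic → A} {j : ℤ} (hc : ∀ w, c w ∈ pathGrading.homA
    (shift j * pathGrading.wdeg w)) : Good (j + 1) (lin (hWord c)) := by
  intro w
  rw [lin_word]
  match w with
  | [] => exact zero_mem _
  | idem k :: r => exact zero_mem _
  | chord i n :: r =>
    rw [hWord]
    induction n generalizing i with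
    | zero =>
      have := hTail_mem (c := fun w => c (chord i 0 :: w))
        (q := shift j * pathGrading.deg (chord i 0)) (fun w => by
          have := hc (chord i 0 :: w); rwa [PathGrading.wdeg_cons, ← mul_assoc] at this) i r
      rw [← mul_assoc, shift_mul, add_comm, mul_assoc, ← PathGrading.wdeg_cons] at this
      exact neg_mem this
    | succ n ih =>
      rw [hChord]
      refine add_mem ?_ ?_
      · have := hc (chord i 0 :: chord (i + 1) n :: r)
        rwa [PathGrading.wdeg_cons, PathGrading.wdeg_cons, ← mul_assoc (pathGrading.deg _),
          deg_rho_mul_deg_chord, mul_assoc, ← mul_assoc (shift j), shift_mul,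
          ← PathGrading.wdeg_cons] at this
      · have := homA_mul (PathGrading.of_mem_homA (γ := pathGrading) (chord i 0)) (ih (i + 1))
        rw [PathGrading.wdeg_cons, mul_assoc (shift (-1)), ← mul_assoc _ (shift (j + 1)),
          ← shift_comm, mul_assoc, ← mul_assoc (pathGrading.deg _), deg_rho_mul_deg_chord,
          mul_assoc (shift 1), ← mul_assoc (shift (j + 1)), ← mul_assoc (shift (-1)), shift_mul,
          shift_mul, ← PathGrading.wdeg_cons] at this
        convert this using 3
        ring

theorem hTail_merge {i : ZMod 4} {m : List Basic} (h : MTail i m) (c : List Basic → A) :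
    mergeSign i m • hTail c (i + 1) (merge i m) = c (chord i 0 :: m) := by
  induction h generalizing c with
  | here i n r =>
    rw [mergeSign_here, merge_here, hTail, if_pos (by ring), one_smul]
  | step i r _ ih =>
    rw [mergeSign_step, merge_step, hTail, if_pos (by ring), smul_neg, neg_smul, neg_neg]
    have := ih fun w => c (chord i 0 :: w)
    rwa [sub_add_cancel] at this

/-- If the first product is at the front, this is the recursion defining `hChord`. Otherwise the
tail is itself contractible, so its contraction is zero, and splitting the merged chord restores the
word up to the sign of the merge. -/
theorem hWord_merge {i : ZMod 4} {m : List Basic} (h : MTail i m) (c : List Basic → A) :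
    mergeSign i m • hWord c (merge i m) =
      c (chord i 0 :: m) + TorusAlg.of (chord i 0) * hWord c m := by
  cases h with
  | here _ n r => rw [mergeSign_here, merge_here, one_smul]; rfl
  | step _ r h =>
    rw [hWord_of_mTail h, mul_zero, add_zero, mergeSign_step, merge_step, hWord, hChord, smul_neg,
      neg_smul, neg_neg]
    have := hTail_merge h fun w => c (chord i 0 :: w)
    rwa [sub_add_cancel] at this

/-- The contraction inverts the Hochschild differential on contractible words. -/
theorem hWord_coder_mulC {i : ZMod 4} {m : List Basic} {y : Basic} (h : MTail i (m ++ [y]))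
    (c : List Basic → A) :
    lin (hWord c) (coder mulC (word (chord i 0 :: (m ++ [y])))) -
      TorusAlg.of (chord i 0) * lin (hWord c) (word (m ++ [y])) -
      (-1 : ℤ) ^ m.length • (lin (hWord c) (word (chord i 0 :: m)) * TorusAlg.of y) =
    c (chord i 0 :: (m ++ [y])) := by
  rw [apply_coder_mulC h fun r hr _ => by rw [lin_word, hWord_of_mTail hr]]
  simp only [lin_word]
  rw [hWord_merge h]
  have : hWord c (chord i 0 :: m) = 0 := by
    rcases h.dropLast with h | h
    · exact hWord_of_mTail h c
    · rw [h]
      exact hWord_koszul c i (m.length + 1)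
  rw [this, zero_mul, smul_zero]
  abel

/-! ### Obstruction theory -/

/-- The cochains of degree `j` that agree with `p₀` in arities less than `N - 1`, on the words with
an idempotent letter, and on the words without contractible products. -/
def Admissible (p₀ : Cochain) (j : ℤ) (N : ℕ) (p : Cochain) : Prop :=
  Good j p ∧ ∀ w : List Basic, (w.length + 1 < N ∨ (∃ k, idem k ∈ w) ∨ ∃ i n, w = koszul i n) →
    p (word w) = p₀ (word w)

/-- A deformation problem whose linearization is the Hochschild differential. -/
structure IsObstruction (p₀ : Cochain) (j : ℤ) (N : ℕ) (Ob : Cochain → Cochain) : Prop where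
  two_le : 2 ≤ N
  init : Good j p₀
  agree : ∀ p q n, Admissible p₀ j N p → Admissible p₀ j N q → AgreeLE n p q →
    AgreeLE (n + 1) (Ob p) (Ob q)
  linear : ∀ p b n, N ≤ n + 1 → Admissible p₀ j N p → Admissible p₀ j N (p + b) → Good j b →
    (∀ w : List Basic, w.length ≠ n → b (word w) = 0) → ∀ x y m, m.length + 1 = n →
    Ob (p + b) (word (x :: (m ++ [y]))) = Ob p (word (x :: (m ++ [y]))) +
      (b (coder mulC (word (x :: (m ++ [y])))) - TorusAlg.of x * b (word (m ++ [y])) -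
      (-1 : ℤ) ^ m.length • (b (word (x :: m)) * TorusAlg.of y))
  cocycle : ∀ p n, N ≤ n → Admissible p₀ j N p →
    (∀ w : List Basic, w.length < n → Ob p (word w) = 0) → ∀ x y m, m.length + 1 = n →
    Ob p (coder mulC (word (x :: (m ++ [y])))) = TorusAlg.of x * Ob p (word (m ++ [y])) +
      (-1 : ℤ) ^ m.length • (Ob p (word (x :: m)) * TorusAlg.of y)
  good : ∀ p, Admissible p₀ j N p → Good (j - 1) (Ob p)
  idem : ∀ p, Admissible p₀ j N p → ∀ w, (∃ k, idem k ∈ w) → Ob p (word w) = 0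
  koszul : ∀ p, Admissible p₀ j N p → ∀ i n, N ≤ n → Ob p (word (koszul i n)) = 0
  base : ∀ p, Admissible p₀ j N p → ∀ w : List Basic, w.length < N → Ob p (word w) = 0

namespace IsObstruction

variable {p₀ : Cochain} {j : ℤ} {N : ℕ} {Ob : Cochain → Cochain}

/-- The correction is the contraction applied to minus the error in arity n + 1. By linearity the
new error vanishes on contractible words, by assumption it vanishes on critical ones, and being a
Hochschild cocycle it vanishes altogether in that arity. -/
theorem step (H : IsObstruction p₀ j N Ob) {n : ℕ} (hn : N ≤ n + 1) {p : Cochain}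
    (hp : Admissible p₀ j N p) (h0 : ∀ w : List Basic, w.length < n + 1 → Ob p (word w) = 0) :
    ∃ p', Admissible p₀ j N p' ∧ (∀ w : List Basic, w.length < n + 2 → Ob p' (word w) = 0) ∧
      ∀ w : List Basic, w.length < n → p' (word w) = p (word w) := by
  classical
  set c : List Basic → A := fun w => if w.length = n + 1 then -Ob p (word w) else 0 with hc
  have hcn : ∀ w : List Basic, w.length ≠ n + 1 → c w = 0 := fun w hw => if_neg hw
  set b : Cochain := lin (hWord c) with hb
  have hbn : ∀ w : List Basic, w.length ≠ n → b (word w) = 0 := fun w hw => by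
    rw [hb, lin_word, hWord_of_length_ne hcn hw]
  have hbg : Good j b := by
    have := hWord_good (c := c) (j := j - 1) fun w => by
      by_cases hw : w.length = n + 1
      · rw [hc]; simp only [if_pos hw]
        exact neg_mem (H.good p hp w)
      · rw [hcn w hw]; exact zero_mem _
    rwa [sub_add_cancel] at this
  have hadm : Admissible p₀ j N (p + b) := by
    refine ⟨hp.1.add hbg, fun w hw => ?_⟩
    have : b (word w) = 0 := by
      rcases hw with hw | hw | ⟨i, k, rfl⟩
      · exact hbn w (by omega)
      · rw [hb, lin_word, hWord_of_idem_mem (fun w hw => ?_) hw]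
        rw [hc]; simp only [H.idem p hp w hw, neg_zero, ite_self]
      · rw [hb, lin_word, hWord_koszul]
    rw [LinearMap.add_apply, this, add_zero, hp.2 w hw]
  have hlow : ∀ w : List Basic, w.length < n → (p + b) (word w) = p (word w) := fun w hw => by
    rw [LinearMap.add_apply, hbn w hw.ne, add_zero]
  have h2 := H.two_le
  -- The correction lives in arity n, so the error in arities up to n is untouched. Here 2 ≤ N ≤ n +
  -- 1 makes the subtraction in `n - 1` genuine.
  have h1 : ∀ w : List Basic, w.length < n + 1 → Ob (p + b) (word w) = 0 := fun w hw => by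
    rw [H.agree (p + b) p (n - 1) hadm hp (fun w hw => hlow w (by omega)) w (by omega), h0 w hw]
  refine ⟨p + b, hadm, fun w hw => ?_, hlow⟩
  rcases Nat.lt_succ_iff_lt_or_eq.1 hw with hw | hw
  · exact h1 w hw
  refine eq_zero_of_cocycle (H.good _ hadm) (H.idem _ hadm) (fun i r hr hl => ?_)
    (fun i => H.koszul _ hadm i (n + 1) hn) (H.cocycle _ _ hn hadm h1) w hw
  obtain ⟨m, y, rfl⟩ := List.eq_nil_or_concat r |>.resolve_left hr.ne_nil
  rw [List.concat_eq_append] at *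
  rw [List.length_append, List.length_singleton] at hl
  rw [H.linear p b n hn hp hadm hbg hbn _ _ _ (by omega), hb, hWord_coder_mulC hr, hc]
  simp only [List.length_cons, List.length_append, List.length_nil]
  rw [if_pos (by omega), add_neg_cancel]

/-- The deformation problem has a solution. -/
theorem exists_solution (H : IsObstruction p₀ j N Ob) :
    ∃ p, Admissible p₀ j N p ∧ ∀ w, Ob p (word w) = 0 := by
  have hN := H.two_le
  have hstep : ∀ k, ∀ p : {p // Admissible p₀ j N p ∧
      ∀ w : List Basic, w.length < N + k → Ob p (word w) = 0},
      ∃ p' : {p // Admissible p₀ j N p ∧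
        ∀ w : List Basic, w.length < N + (k + 1) → Ob p (word w) = 0},
        ∀ w : List Basic, w.length < k + 1 → p'.1 (word w) = p.1 (word w) := by
    rintro k ⟨p, hp, h0⟩
    -- The step changes arity N + k − 1 only, which is at least k + 1 because N ≥ 2; hence each
    -- arity is eventually constant along the sequence.
    obtain ⟨p', h1, h2, h3⟩ := H.step (n := N + k - 1) (by omega) hp
      (fun w hw => h0 w (by omega))
    exact ⟨⟨p', h1, fun w hw => h2 w (by omega)⟩, fun w hw => h3 w (by omega)⟩
  choose F hF using hstep
  let P : ∀ k, {p // Admissible p₀ j N p ∧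
      ∀ w : List Basic, w.length < N + k → Ob p (word w) = 0} := fun k =>
    Nat.rec ⟨p₀, ⟨H.init, fun _ _ => rfl⟩, H.base p₀ ⟨H.init, fun _ _ => rfl⟩⟩
      (fun k p => F k p) k
  have hP : ∀ k, ∀ w : List Basic, w.length < k + 1 →
      (P (k + 1)).1 (word w) = (P k).1 (word w) := fun k => hF k (P k)
  have hP' : ∀ k, ∀ w : List Basic, w.length ≤ k →
      (P k).1 (word w) = (P w.length).1 (word w) := by
    intro k w hw
    induction k, hw using Nat.le_induction with
    | base => rfl
    | succ k hk ih => rw [hP k w (by omega), ih]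
  -- The limit: in arity l all approximations from the l-th on agree.
  let p : Cochain := lin fun w => (P w.length).1 (word w)
  have hp : ∀ w, p (word w) = (P w.length).1 (word w) := fun w => lin_word _ _
  have hadm : Admissible p₀ j N p :=
    ⟨fun w => by rw [hp]; exact (P w.length).2.1.1 w, fun w hw => by
      rw [hp]; exact (P w.length).2.1.2 w hw⟩
  refine ⟨p, hadm, fun w => ?_⟩
  rw [H.agree p _ w.length hadm (P w.length).2.1 (fun v hv => by rw [hp, hP' _ v hv]) w (by omega)]
  exact (P w.length).2.2 w (by omega)

end IsObstruction

theorem splitSum_append {α N : Type*} [AddCommMonoid N] (g : List α → List α → N) (u : List α)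
    (y : α) (w : List α) : splitSum g (u ++ y :: w) =
      splitSum (fun a b => g a (b ++ y :: w)) u + splitSum (fun a b => g (u ++ y :: a) b) w := by
  induction u generalizing g with
  | nil => rw [List.nil_append, splitSum_cons]; rfl
  | cons x u ih => rw [List.cons_append, splitSum_cons, ih, splitSum_cons, add_assoc]; rfl

theorem splitSum_sub {α N : Type*} [AddCommGroup N] (g h : List α → List α → N) (w : List α) :
    splitSum g w - splitSum h w = splitSum (fun u v => g u v - h u v) w := by
  rw [sub_eq_iff_eq_add, ← splitSum_add]; simp

/-! ### Linearity and filtrations -/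

theorem coder_add (μ ν : Cochain) : coder (μ + ν) = coder μ + coder ν := words_ext fun w => by
  induction w with
  | nil => simp
  | cons x w ih =>
    rw [LinearMap.add_apply] at ih ⊢
    rw [coder_cons, coder_cons, coder_cons, ih]
    simp only [LinearMap.add_apply, map_add, add_mul, splitSum_add, mul_add]
    abel

theorem coder_zero : coder 0 = 0 := by
  have h := coder_add 0 0
  rw [add_zero] at h
  refine words_ext fun w => ?_
  have := congrArg (fun F => F (word w)) h
  rw [LinearMap.add_apply] at this
  rw [LinearMap.zero_apply]
  exact add_eq_left.1 this.symm

theorem coder_mem_lengthLE_sub {μ : Cochain} {d : ℕ}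
    (h : ∀ w : List Basic, w.length ≤ d → μ (word w) = 0) (w : List Basic) :
    coder μ (word w) ∈ lengthLE (w.length - d) := by
  induction w with
  | nil => simp
  | cons x w ih =>
    rw [coder_cons]
    refine sub_mem (splitSum_mem fun u v huv => ?_) ?_
    · have hl : u.length + v.length = w.length + 1 := by
        rw [← List.length_append, huv]; simp
      by_cases hu : u.length ≤ d
      · rw [h u hu]; simp
      · exact lengthLE_mono (by rw [List.length_cons]; omega)
          (letter_mul_mem_lengthLE _ (word_mem_lengthLE (le_refl v.length)))
    · by_cases hw : w.length ≤ d
      · have h0 : AgreeLE d μ 0 := h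
        rw [h0.coder w hw, coder_zero]; simp
      · refine lengthLE_mono ?_ (word_mul_mem_lengthLE (m := 1) (by simp) ih)
        simp only [List.length_cons]; omega

/-- In the first arity where the cochains may differ, only the block consisting of the whole word
can see it. -/
theorem coder_sub_of_agreeLE {n : ℕ} {μ ν : Cochain} (h : AgreeLE n μ ν) {w : List Basic}
    (hw : w.length ≤ n + 1) :
    coder μ (word w) - coder ν (word w) = letter (μ (word w) - ν (word w)) := by
  cases w with
  | nil => rw [h [] (by simp)]; simp
  | cons x w =>
    rw [List.length_cons] at hw
    rw [coder_cons, coder_cons, h.coder w (by omega), sub_sub_sub_cancel_right, splitSum_sub,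
      splitSum_eq_last]
    · simp
    · intro u v huv hv
      have hl : u.length + v.length = w.length + 1 := by
        rw [← List.length_append, huv]; simp
      have := List.length_pos_iff.2 hv
      rw [h u (by omega), sub_self]

theorem apply_eq_of_agreeLE {p : Cochain} {n : ℕ} (hp : ∀ w : List Basic, w.length ≤ n →
    p (word w) = 0) {t : Words} (ht : t ∈ lengthLE n) : p t = 0 :=
  (show AgreeLE n p 0 from hp).eq_of_mem ht

theorem apply_letter_mul_letter {p : Cochain} {c : ℤ[X]}
    (h : ∀ x y, p (word [x, y]) = c • (TorusAlg.of x * TorusAlg.of y)) (a a' : A) :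
    p (letter a * letter a') = c • (a * a') := by
  have h1 : ∀ x, p ∘ₗ lmul (word [x]) ∘ₗ letter = c • TorusAlg.mulHom (TorusAlg.of x) := fun x =>
    TorusAlg.hom_ext fun y => by
      simp only [LinearMap.comp_apply, letter_of, LinearMap.mulLeft_apply, ← word_cons]
      rw [h]; rfl
  have h2 : p ∘ₗ LinearMap.mulRight ℤ[X] (letter a') ∘ₗ letter =
      c • TorusAlg.mulHom.flip a' := TorusAlg.hom_ext fun x => by
    have := congrArg (fun F => F a') (h1 x)
    simpa using this
  exact congrArg (fun F => F a) h2

theorem smul_mulA (c : ℤ[X]) (a a' : A) : c • a * a' = c • (a * a') := by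
  rw [TorusAlg.mul_def, TorusAlg.mul_def, map_smul, LinearMap.smul_apply]

theorem mul_smulA (c : ℤ[X]) (a a' : A) : a * c • a' = c • (a * a') := by
  rw [TorusAlg.mul_def, TorusAlg.mul_def, map_smul]

/-! ### Strict units -/

/-- A cochain of the shape of a strictly unital deformation of the multiplication. -/
structure IsStrict (p : Cochain) : Prop where
  one : ∀ x, p (word [x]) = 0
  two : ∀ x y, p (word [x, y]) = TorusAlg.of x * TorusAlg.of y
  unit : ∀ w : List Basic, 3 ≤ w.length → (∃ k, idem k ∈ w) → p (word w) = 0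

/-- Only the products with a single letter next to the idempotent survive. Stating this through
`aug` and `proj1` extends it to arbitrary elements on both sides, such as values of coderivations
and coalgebra maps. -/
theorem IsStrict.apply_idem {p : Cochain} (hp : IsStrict p) (k : Fin 2) (s t : Words) :
    p (s * (word [idem k] * t)) = aug s • (iota k * proj1 t) + aug t • (proj1 s * iota k) := by
  have key : ∀ u v : List Basic, p (word u * (word [idem k] * word v)) =
      aug (word u) • (iota k * proj1 (word v)) + aug (word v) • (proj1 (word u) * iota k) := by
    intro u v
    rw [← word_append, ← word_append]
    match u, v with
    | [], [] => simp [hp.one]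
    | [], [y] => simp [hp.two, proj1_singleton, iota]
    | [x], [] => simp [hp.two, proj1_singleton, iota]
    | x :: y :: u, v =>
      rw [hp.unit _ (by simp; omega) ⟨k, by simp⟩,
        proj1_of_length_ne_one (by simp : (x :: y :: u).length ≠ 1)]
      simp
    | u, x :: y :: v =>
      rw [hp.unit _ (by simp; omega) ⟨k, by simp⟩,
        proj1_of_length_ne_one (by simp : (x :: y :: v).length ≠ 1)]
      simp
    | [x], [y] =>
      rw [hp.unit _ (by simp) ⟨k, by simp⟩]
      simp
  induction s using words_induction with
  | h0 => simp
  | hadd s s' hs hs' =>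
    rw [add_mul, map_add, hs, hs', map_add, map_add, add_smul, add_mul, smul_add]
    abel
  | hsmul c s hs =>
    rw [smul_mul_assoc, map_smul, hs, map_smul, map_smul, smul_add, smul_mulA, smul_eq_mul, mul_smul,
      smul_comm c (aug t)]
  | hw u =>
    induction t using words_induction with
    | h0 => simp
    | hadd s s' hs hs' =>
      rw [mul_add, mul_add, map_add, hs, hs', map_add, map_add, add_smul, mul_add, smul_add]
      abel
    | hsmul c s hs =>
      rw [mul_smul_comm, mul_smul_comm, map_smul, hs, map_smul, map_smul, smul_add, mul_smulA,
        smul_eq_mul, mul_smul, smul_comm c (aug (word u))]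
    | hw v => exact key u v

/-- The sign bookkeeping in the induction for `IsStrict.coder_idem`, separated so that it becomes an
identity in a module. The boundary term `z` is present only when the left part is a single letter.
-/
theorem coder_idem_aux {R : Type*} [Ring R] (S b x a u y v d z : R) (e c t : ℤ)
    (hz : z = (e * (1 - t)) • (x * d)) :
    S * b + z - x * (a * b - e • (u * (y * v)) + e • ((c - t) • d)) =
      (S - x * a) * b - (-e) • (x * u * (y * v)) + (-e) • ((c - 1) • (x * d)) := by
  subst hz
  simp only [mul_sub, mul_add, mul_smul_comm, sub_mul, mul_assoc]
  module

/-- The coderivation on a word with an idempotent letter. -/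
theorem IsStrict.coder_idem {p : Cochain} (hp : IsStrict p) (h0 : p 1 = 0) {k : Fin 2}
    (u v : List Basic) (hu : ∀ x ∈ u.getLast?, x.target = k) (hv : ∀ x ∈ v.head?, x.source = k) :
    coder p (word (u ++ idem k :: v)) = coder p (word u) * (word [idem k] * word v) -
      (-1 : ℤ) ^ u.length • (word u * (word [idem k] * coder p (word v))) +
      (-1 : ℤ) ^ u.length • (((if v = [] then 0 else 1) - (if u = [] then 0 else 1) : ℤ) •
        word (u ++ v)) := by
  induction u with
  | nil =>
    rw [List.nil_append, coder_cons, splitSum_cons, word_nil, h0, map_zero, zero_mul, zero_add]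
    cases v with
    | nil => simp [hp.one]
    | cons y v =>
      obtain rfl : y.source = k := hv y (by simp)
      rw [splitSum_cons, hp.one, splitSum_eq_first, hp.two]
      · have := iota_mul_of y.source y
        rw [if_pos rfl] at this
        rw [← iota, this]
        simp [← word_cons]
        abel
      · intro a b _ ha
        have := List.length_pos_iff.2 ha
        rw [hp.unit _ (by simp; omega) ⟨_, List.mem_cons_self⟩]; simp
  | cons x u ih =>
    have hu' : ∀ x ∈ u.getLast?, x.target = k := fun y hy => by
      rcases List.eq_nil_or_concat u with rfl | ⟨u, z, rfl⟩
      · simp at hy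
      · apply hu; simpa [List.getLast?_cons] using hy
    -- A block starting at the first letter either stops before the idempotent, or contains it; the
    -- latter is nonzero only for the product of `x` with an adjacent idempotent.
    have e1 : splitSum (fun a b => letter (p (word a)) * word b) (x :: (u ++ idem k :: v)) =
        splitSum (fun a b => letter (p (word a)) * word b) (x :: u) * (word [idem k] * word v) +
          if u = [] then word (x :: u ++ v) else 0 := by
      rw [← List.cons_append, splitSum_append]
      congr 1
      · have := map_splitSum (LinearMap.mulRight ℤ[X] (word [idem k] * word v))
          (fun a b => letter (p (word a)) * word b) (x :: u)
        rw [LinearMap.mulRight_apply] at this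
        rw [this]
        refine splitSum_congr fun a b _ => ?_
        rw [word_append, word_cons (idem k), LinearMap.mulRight_apply, mul_assoc]
      · rw [splitSum_eq_first]
        · split_ifs with h
          · subst h
            obtain rfl : x.target = k := hu x (by simp)
            have := of_mul_iota x.target x
            rw [if_pos rfl] at this
            rw [List.cons_append, List.nil_append, hp.two, ← iota, this, List.cons_append,
              word_cons x]
            simp
          · have := List.length_pos_iff.2 h
            rw [hp.unit _ (by simp; omega) ⟨k, by simp⟩]; simp
        · intro a b _ ha
          have := List.length_pos_iff.2 ha
          rw [hp.unit _ (by simp; omega) ⟨k, by simp⟩]; simp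
    rw [List.cons_append, coder_cons, e1, ih hu', coder_cons, List.cons_append, word_cons x (u ++ v),
      word_cons x u, List.length_cons, pow_succ, mul_neg_one, if_neg (List.cons_ne_nil x u)]
    refine coder_idem_aux _ _ _ _ _ _ _ _ _ _ _ _ ?_
    split_ifs with h
    · subst h; simp
    · simp

theorem idem_mem_split {w : List Basic} (h : ∃ k, idem k ∈ w) :
    ∃ k u v, w = u ++ idem k :: v := by
  obtain ⟨k, hk⟩ := h
  obtain ⟨u, v, rfl⟩ := List.append_of_mem hk
  exact ⟨k, u, v, rfl⟩

theorem Good.eq_zero_of_target_ne {j : ℤ} {p : Cochain} (hp : Good j p) {k : Fin 2}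
    {u v : List Basic} {x : Basic} (hx : x ∈ u.getLast?) (h : x.target ≠ k) :
    p (word (u ++ idem k :: v)) = 0 := by
  rw [Option.mem_def, List.getLast?_eq_some_iff] at hx
  obtain ⟨u, rfl⟩ := hx
  rw [List.append_assoc]
  exact hp.eq_zero_of_ne u v h

theorem Good.eq_zero_of_source_ne {j : ℤ} {p : Cochain} (hp : Good j p) {k : Fin 2}
    {u v : List Basic} {x : Basic} (hx : x ∈ v.head?) (h : x.source ≠ k) :
    p (word (u ++ idem k :: v)) = 0 := by
  rw [Option.mem_def, List.head?_eq_some_iff] at hx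
  obtain ⟨v, rfl⟩ := hx
  exact hp.eq_zero_of_ne u v (Ne.symm h)

theorem Good.iota_mul_of_head {j : ℤ} {p : Cochain} (hp : Good j p) {k : Fin 2} {v : List Basic}
    (hv : ∀ x ∈ v.head?, x.source = k) : iota k * p (word v) = p (word v) := by
  cases v with
  | nil => rw [word_nil, hp.map_one, mul_zero]
  | cons x v => rw [hp.iota_mul, if_pos (hv x (by simp)).symm]

theorem Good.mul_iota_of_getLast {j : ℤ} {p : Cochain} (hp : Good j p) {k : Fin 2} {u : List Basic}
    (hu : ∀ x ∈ u.getLast?, x.target = k) : p (word u) * iota k = p (word u) := by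
  rcases List.eq_nil_or_concat u with rfl | ⟨u, x, rfl⟩
  · rw [word_nil, hp.map_one, zero_mul]
  · rw [List.concat_eq_append] at *
    rw [hp.mul_iota, if_pos (hu x (by simp)).symm]

theorem Good.comp_coder {i j : ℤ} {p μ : Cochain} (hp : Good i p) (hμ : Good j μ) :
    Good (i + j) (p ∘ₗ coder μ) := by
  have := hp.comp (hμ.coder (shift_comm j))
  rwa [shift_mul] at this

/-- Multiplications of the idempotent with its two neighbours cancel. If one side is empty, the
uncancelled product meets the idempotent acting on the value on the other side; the signs match
because that value is nonzero only in even arity. -/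
theorem IsStrict.relation_idem {p : Cochain} (hp : IsStrict p) (hg : Good (-1) p)
    {w : List Basic} (hw : ∃ k, idem k ∈ w) : (p ∘ₗ coder p) (word w) = 0 := by
  obtain ⟨k, u, v, rfl⟩ := idem_mem_split hw
  have hg' : Good (-1 + -1) (p ∘ₗ coder p) := hg.comp_coder hg
  by_cases hu : ∀ x ∈ u.getLast?, x.target = k
  swap
  · push Not at hu
    obtain ⟨x, hx, hx'⟩ := hu
    exact hg'.eq_zero_of_target_ne hx hx'
  by_cases hv : ∀ x ∈ v.head?, x.source = k
  swap
  · push Not at hv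
    obtain ⟨x, hx, hx'⟩ := hv
    exact hg'.eq_zero_of_source_ne hx hx'
  have h0 := hg.map_one
  rw [LinearMap.comp_apply, hp.coder_idem h0 u v hu hv, map_add, map_sub, map_zsmul, map_zsmul,
    hp.apply_idem, hp.apply_idem, map_zsmul, aug_coder, aug_coder, proj1_coder h0, proj1_coder h0,
    hg.iota_mul_of_head hv, hg.mul_iota_of_getLast hu]
  rcases eq_or_ne u [] with rfl | hu0 <;> rcases eq_or_ne v [] with rfl | hv0
  · simp [h0]
  · simp [hv0]
  · rcases Nat.even_or_odd u.length with h | h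
    · simp [hu0, h.neg_one_pow]
    · have : p (word u) = 0 := hg.hasParity (d := 0) (by norm_num) u (by
        rw [Nat.odd_iff.1 h]; simp)
      simp [this, h0]
  · simp [hu0, hv0]

/-! ### The relations on the words without contractible products -/

theorem idem_notMem_koszul (k : Fin 2) (i : ZMod 4) (n : ℕ) : idem k ∉ koszul i n := by
  induction n generalizing i with
  | zero => simp [koszul]
  | succ n ih => simp [koszul, ih]

theorem splitSum_koszul {N : Type*} [AddCommMonoid N] (g : List Basic → List Basic → N)
    (i : ZMod 4) (n : ℕ) : splitSum g (koszul i n) =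
      ∑ r ∈ Finset.range (n + 1), g (koszul i r) (koszul (i - r) (n - r)) := by
  induction n generalizing g i with
  | zero => simp [koszul]
  | succ n ih =>
    rw [koszul, splitSum_cons, ih, Finset.sum_range_succ' _ (n + 1), add_comm]
    simp [koszul, sub_sub, add_comm]

/-- The words without contractible products that the cochain with `μ₄ = U` on them sees. -/
theorem splitSum_koszul_letter {p : Cochain}
    (hp : ∀ i n, n ≠ 4 → p (word (koszul i n)) = 0) {i : ZMod 4} {a : A}
    (ha : p (word (koszul i 4)) = a) {n : ℕ} :
    splitSum (fun u v => letter (p (word u)) * word v) (koszul i n) =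
      if 4 ≤ n then letter a * word (koszul i (n - 4)) else 0 := by
  rw [splitSum_koszul]
  have e : i - ((4 : ℕ) : ZMod 4) = i := (by decide : ∀ i : ZMod 4, i - ((4 : ℕ) : ZMod 4) = i) i
  split_ifs with h
  · rw [Finset.sum_eq_single 4, ha, e]
    · intro r _ hr; rw [hp i r hr]; simp
    · intro h'; simp at h'; omega
  · refine Finset.sum_eq_zero fun r hr => ?_
    rw [hp i r (by simp at hr; omega)]; simp

theorem coder_koszul_four {p : Cochain} (hp : ∀ i n, n ≠ 4 → p (word (koszul i n)) = 0)
    (i : ZMod 4) : coder p (word (koszul i 4)) = letter (p (word (koszul i 4))) := by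
  have e1 : ∀ i n, n < 4 → coder p (word (koszul i n)) = 0 := fun i n hn => by
    induction n generalizing i with
    | zero => simp [koszul]
    | succ n ih =>
      have : koszul i (n + 1) = chord i 0 :: koszul (i - 1) n := rfl
      rw [this, coder_cons, ← this, ih _ (by omega), splitSum_koszul_letter hp rfl,
        if_neg (by omega)]
      simp
  have : koszul i 4 = chord i 0 :: koszul (i - 1) 3 := rfl
  conv_lhs => rw [this]
  rw [coder_cons, ← this, e1 _ 3 (by norm_num), splitSum_koszul_letter hp rfl]
  simp [koszul]

/-- Products of adjacent letters vanish, so only the quartic operation on the first four or the last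
four letters can occur, followed by a multiplication. -/
theorem relation_koszul_five {p : Cochain}
    (h2 : ∀ x y, p (word [x, y]) = TorusAlg.of x * TorusAlg.of y)
    (hp : ∀ i n, n ≠ 4 → p (word (koszul i n)) = 0) (i : ZMod 4) :
    (p ∘ₗ coder p) (word (koszul i 5)) =
      p (word (koszul i 4)) * rho i - rho i * p (word (koszul (i - 1) 4)) := by
  have e3 : koszul i 5 = chord i 0 :: koszul (i - 1) 4 := rfl
  rw [LinearMap.comp_apply, e3, coder_cons, ← e3, coder_koszul_four hp,
    splitSum_koszul_letter hp rfl, if_pos (by simp), map_sub,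
    show koszul i (5 - 4) = [chord i 0] from rfl, ← letter_of]
  have := apply_letter_mul_letter (p := p) (c := 1) (by simpa using h2)
  simp only [one_smul] at this
  rw [this, this]
  rfl

/-! ### Existence -/

open Classical in
/-- The quartic operation on the words without contractible products. -/
def quartic : Cochain := lin fun w =>
  ∑ i : ZMod 4, if w = koszul i 4 then (Polynomial.X : ℤ[X]) • iota (src i) else 0

theorem koszul_succ_inj {i j : ZMod 4} {n : ℕ} (h : koszul i (n + 1) = koszul j (n + 1)) :
    i = j := by
  simp [koszul] at h; exact h.1

theorem quartic_koszul (i : ZMod 4) :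
    quartic (word (koszul i 4)) = (Polynomial.X : ℤ[X]) • iota (src i) := by
  rw [quartic, lin_word, Finset.sum_eq_single i, if_pos rfl]
  · intro j _ hj
    rw [if_neg fun h => hj (koszul_succ_inj h).symm]
  · simp

theorem quartic_of_ne {w : List Basic} (h : ∀ i, w ≠ koszul i 4) : quartic (word w) = 0 := by
  rw [quartic, lin_word]
  exact Finset.sum_eq_zero fun i _ => if_neg (h i)

theorem deg_quartic (i : ZMod 4) : pathGrading.deg (idem (src i)) * pathGrading.var ^ 1 =
    shift (-1) * pathGrading.wdeg (koszul i 4) := by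
  refine Prod.ext ?_ ?_
  · rcases zmod4_cases i with rfl | rfl | rfl | rfl <;>
      simp +decide
  · rw [monomial_snd rfl, Prod.snd_mul, wdeg_grp]
    obtain ⟨h1, h2, h3, h4⟩ := grpGrading_koszul_four_mul i 1
    rw [mul_one] at h1 h2 h3 h4
    apply Grp.ext <;>
      simp [Grp.m_mul, Grp.a_mul, Grp.b_mul, Grp.w_mul, shift, h1, h2, h3, h4, Basic.gr, m_gU,
        a_gU, b_gU, w_gU, Grp.m_lam, Grp.a_lam, Grp.b_lam, Grp.w_lam, Grp.m_inv,
        Grp.a_inv, Grp.b_inv, Grp.w_inv]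
    norm_num

theorem good_quartic : Good (-1) quartic := fun w => by
  by_cases h : ∃ i, w = koszul i 4
  · obtain ⟨i, rfl⟩ := h
    rw [quartic_koszul, ← deg_quartic]
    have := PathGrading.monomial_mem_homA (γ := pathGrading) 1 (idem (src i))
    rwa [pow_one (Polynomial.X : ℤ[X])] at this
  · rw [quartic_of_ne (not_exists.1 h)]; exact zero_mem _

/-- The multiplication with the quartic operation. -/
def baseC : Cochain := mulC + quartic

theorem quartic_of_length_ne {w : List Basic} (h : w.length ≠ 4) : quartic (word w) = 0 :=
  quartic_of_ne fun i hi => h (by rw [hi, length_koszul])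

theorem baseC_of_length_ne {w : List Basic} (h : w.length ≠ 4) : baseC (word w) = mulC (word w) := by
  rw [baseC, LinearMap.add_apply, quartic_of_length_ne h, add_zero]

/-! ### Admissible structure maps on critical words -/

section

variable {p : Cochain} (hp : Admissible baseC (-1) 5 p)
include hp

theorem Admissible.agree_mulC {w : List Basic} (hw : w.length ≤ 3) :
    p (word w) = mulC (word w) := by
  rw [hp.2 w (Or.inl (by omega)), baseC_of_length_ne (by omega)]

theorem Admissible.isStrict : IsStrict p where
  one x := by rw [hp.agree_mulC (by simp), mulC_of_length_ne_two (by simp)]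
  two x y := by rw [hp.agree_mulC (by simp), mulC_pair]
  unit w hw hk := by
    rw [hp.2 w (Or.inr (Or.inl hk)), baseC, LinearMap.add_apply,
      mulC_of_length_ne_two (by omega), quartic_of_ne, add_zero]
    rintro i rfl
    obtain ⟨k, hk⟩ := hk
    exact idem_notMem_koszul _ _ _ hk

theorem Admissible.koszul_of_ne (i : ZMod 4) (n : ℕ) (hn : n ≠ 4) : p (word (koszul i n)) = 0 :=
  hp.1.koszul_eq_zero i hn

theorem Admissible.koszul_four (i : ZMod 4) :
    p (word (koszul i 4)) = (Polynomial.X : ℤ[X]) • iota (src i) := by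
  rw [hp.2 _ (Or.inr (Or.inr ⟨i, 4, rfl⟩)), baseC, LinearMap.add_apply, quartic_koszul,
    mulC_of_length_ne_two (by simp [length_koszul]), zero_add]

/-- On a critical word the only nonzero inner operation replaces four letters by U times an
idempotent. -/
theorem Admissible.coder_koszul (i : ZMod 4) (n : ℕ) : coder p (word (koszul i n)) ∈
    Submodule.span ℤ[X] {t | ∃ w : List Basic, w.length + 3 = n ∧ (∃ k, idem k ∈ w) ∧ t = word w} := by
  induction n generalizing i with
  | zero => simp [koszul]
  | succ n ih =>
    have e : koszul i (n + 1) = chord i 0 :: koszul (i - 1) n := rfl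
    rw [e, coder_cons, ← e, splitSum_koszul_letter hp.koszul_of_ne (hp.koszul_four i)]
    refine sub_mem ?_ ?_
    · split_ifs with h
      · rw [map_smul, smul_mul_assoc, iota, ← word_cons']
        refine Submodule.smul_mem _ _ (Submodule.subset_span ⟨_, ?_, ⟨src i, ?_⟩, rfl⟩)
        · rw [List.length_cons, length_koszul]; omega
        · exact List.mem_cons_self
      · exact zero_mem _
    · have := ih (i - 1)
      generalize coder p (word (koszul (i - 1) n)) = t at this
      induction this using Submodule.span_induction with
      | mem t ht =>
        obtain ⟨w, hw, ⟨k, hk⟩, rfl⟩ := ht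
        rw [← word_cons]
        exact Submodule.subset_span ⟨_, by simp; omega, ⟨k, List.mem_cons_of_mem _ hk⟩, rfl⟩
      | zero => simp
      | add s t _ _ hs ht => rw [mul_add]; exact add_mem hs ht
      | smul c t _ ht => rw [mul_smul_comm]; exact Submodule.smul_mem _ _ ht

/-- In length 5 the relation says that U times an idempotent acts equally on both sides of an arrow.
In greater length the outer operation has at least three inputs, one of them an idempotent, and
vanishes by strict unitality. -/
theorem Admissible.relation_koszul (i : ZMod 4) {n : ℕ} (hn : 5 ≤ n) :
    (p ∘ₗ coder p) (word (koszul i n)) = 0 := by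
  rcases hn.eq_or_lt with rfl | hn
  · rw [relation_koszul_five hp.isStrict.two hp.koszul_of_ne,
      hp.koszul_four, hp.koszul_four, smul_mulA, mul_smulA, rho, iota_mul_of, of_mul_iota,
      if_pos (show src i = (chord i 0).source from rfl), if_pos, sub_self]
    simpa [target] using (show ∀ i, src (i - 1) = tgt i by decide) i
  · have := hp.coder_koszul i n
    rw [LinearMap.comp_apply]
    generalize coder p (word (koszul i n)) = t at this
    induction this using Submodule.span_induction with
    | mem t ht =>
      obtain ⟨w, hw, hk, rfl⟩ := ht
      exact hp.isStrict.unit w (by omega) hk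
    | zero => simp
    | add s t _ _ hs ht => rw [map_add, hs, ht, add_zero]
    | smul c t _ ht => rw [map_smul, ht, smul_zero]

end

/-- Operations of arity at least 3 shorten a word of length n + 1 below length n, where `o`
vanishes. So to lowest order only the bar differential of the multiplication is seen. -/
theorem apply_coder_eq_apply_coder_mulC {p o : Cochain} {n : ℕ}
    (hp : ∀ w : List Basic, w.length ≤ 2 → p (word w) = mulC (word w))
    (ho : ∀ w : List Basic, w.length < n → o (word w) = 0) {w : List Basic} (hw : w.length = n + 1) :
    o (coder p (word w)) = o (coder mulC (word w)) := by
  rw [← sub_eq_zero, ← map_sub]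
  have e : coder p = coder (p - mulC) + coder mulC := by rw [← coder_add, sub_add_cancel]
  rw [e, LinearMap.add_apply, add_sub_cancel_right]
  rcases n with _ | n
  · obtain ⟨x, rfl⟩ := List.length_eq_one_iff.1 hw
    have : coder (p - mulC) (word [x]) = letter ((p - mulC) (word [x])) := by
      have h0 : AgreeLE 0 (p - mulC) 0 := fun v hv => by
        rw [LinearMap.sub_apply, hp v (by omega), sub_self]; rfl
      have := coder_sub_of_agreeLE h0 (w := [x]) (by simp)
      simpa [coder_zero] using this
    rw [this, LinearMap.sub_apply, hp [x] (by simp), sub_self, map_zero, map_zero]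
  · refine apply_eq_of_agreeLE (n := n) (fun v hv => ho v (by omega)) ?_
    have := coder_mem_lengthLE_sub (μ := p - mulC) (d := 2)
      (fun v hv => by rw [LinearMap.sub_apply, hp v hv, sub_self]) w
    rwa [hw] at this

theorem lengthLE_of_isStrict {p : Cochain} (h0 : p 1 = 0) (h1 : ∀ x, p (word [x]) = 0)
    (h2 : ∀ x y, p (word [x, y]) = TorusAlg.of x * TorusAlg.of y) (w : List Basic)
    (hw : w.length ≤ 2) : p (word w) = mulC (word w) := by
  match w with
  | [] => rw [word_nil, h0, mulC_one]
  | [x] => rw [h1, mulC_of_length_ne_two (by simp)]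
  | [x, y] => rw [h2, mulC_pair]

theorem IsStrict.eq_mulC {p : Cochain} (hp : IsStrict p) (h0 : p 1 = 0) (w : List Basic)
    (hw : w.length ≤ 2) : p (word w) = mulC (word w) :=
  lengthLE_of_isStrict h0 hp.one hp.two w hw

theorem IsStrict.apply_letter_mul {p : Cochain} (hp : IsStrict p) (a a' : A) :
    p (letter a * letter a') = a * a' := by
  have := apply_letter_mul_letter (p := p) (c := 1) (by simpa using hp.two) a a'
  rwa [one_smul] at this

theorem IsStrict.apply_letter {p : Cochain} (hp : IsStrict p) (a : A) : p (letter a) = 0 := by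
  have : p ∘ₗ letter = 0 := TorusAlg.hom_ext fun x => by simp [hp.one]
  exact congrArg (fun F => F a) this

/-- The coderivation of a cochain of a single arity on words with one more letter. -/
theorem coder_of_length {b : Cochain} {n : ℕ} (hn : 0 < n)
    (hb : ∀ w : List Basic, w.length ≠ n → b (word w) = 0) {x y : Basic} {m : List Basic}
    (hm : m.length + 1 = n) : coder b (word (x :: (m ++ [y]))) =
      letter (b (word (x :: m))) * letter (TorusAlg.of y) -
        letter (TorusAlg.of x) * letter (b (word (m ++ [y]))) := by
  have e1 : ∀ w : List Basic, w.length < n → coder b (word w) = 0 := fun w hw => by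
    have h0 : AgreeLE (n - 1) b 0 := fun w hw => by rw [hb w (by omega)]; rfl
    rw [h0.coder w (by omega), coder_zero]; rfl
  have e2 : coder b (word (m ++ [y])) = letter (b (word (m ++ [y]))) := by
    have h0 : AgreeLE (n - 1) b 0 := fun w hw => by rw [hb w (by omega)]; rfl
    have := coder_sub_of_agreeLE h0 (w := m ++ [y]) (by simp; omega)
    simpa [coder_zero] using this
  rw [coder_cons, e2, ← List.cons_append, splitSum_append_singleton, hb (x :: m ++ [y]) (by simp; omega),
    splitSum_eq_last]
  · simp
  · intro u v huv hv
    have hl : u.length + v.length = m.length + 1 := by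
      rw [← List.length_append, huv]; simp
    have := List.length_pos_iff.2 hv
    rw [hb u (by omega)]; simp

/-- A change in arity n + 1 would enter the relation of that arity only composed with μ₁, which is
zero. -/
theorem agreeLE_relation {p q : Cochain} {n : ℕ} (hp : IsStrict p) (hq : IsStrict q)
    (hq0 : q 1 = 0) (h : AgreeLE n p q) : AgreeLE (n + 1) (p ∘ₗ coder p) (q ∘ₗ coder q) := by
  intro w hw
  have h1 := coder_sub_of_agreeLE h hw
  have h2 : coder q (word w) ∈ lengthLE n :=
    lengthLE_mono (by omega) (coder_mem_lengthLE hq0 hq.one w)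
  rw [LinearMap.comp_apply, LinearMap.comp_apply, sub_eq_iff_eq_add.1 h1, map_add,
    hp.apply_letter, zero_add, h.eq_of_mem h2]

theorem apply_letter_mul_letter_eq_zero {b : Cochain} {n : ℕ} (hn : n ≠ 2)
    (hb : ∀ w : List Basic, w.length ≠ n → b (word w) = 0) (a a' : A) :
    b (letter a * letter a') = 0 := by
  rw [apply_letter_mul_letter (c := 0) fun x y => by rw [hb _ (by simpa using hn.symm), zero_smul],
    zero_smul]

/-- By parity the alternating Hochschild sign can be replaced by one depending only on the degree,
since values of the other parity are zero. -/
theorem Good.apply_mul_of {j : ℤ} {b : Cochain} (hb : Good j b) {n : ℕ} (hj : (j + n) % 2 = 1)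
    (m x : List Basic) (hx : x.length = m.length + 1) (a : A) :
    (-1 : ℤ) ^ m.length • (b (word x) * a) = (-1 : ℤ) ^ (n + 1) • (b (word x) * a) := by
  by_cases h : m.length % 2 = (n + 1) % 2
  · rw [neg_one_pow_eq_pow_mod_two, h, ← neg_one_pow_eq_pow_mod_two]
  · rw [hb.hasParity hj x (by omega), zero_mul, smul_zero, smul_zero]

/-- The quadratic term applies `b` to two letters, which is zero for n > 2. The mixed terms are the
contractions inside `b` and the two outer multiplications, that is, the Hochschild differential. -/
theorem linear_relation {p b : Cochain} {n : ℕ} (hn : 2 < n) (hs : IsStrict p) (hp0 : p 1 = 0)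
    (hbg : Good (-1) b) (hb : ∀ w : List Basic, w.length ≠ n → b (word w) = 0) (x y : Basic)
    (m : List Basic) (hm : m.length + 1 = n) :
    ((p + b) ∘ₗ coder (p + b)) (word (x :: (m ++ [y]))) =
      (p ∘ₗ coder p) (word (x :: (m ++ [y]))) +
      (b (coder mulC (word (x :: (m ++ [y])))) - TorusAlg.of x * b (word (m ++ [y])) -
      (-1 : ℤ) ^ m.length • (b (word (x :: m)) * TorusAlg.of y)) := by
  have e3 := apply_coder_eq_apply_coder_mulC (p := p) (o := b) (n := n)
    (hs.eq_mulC hp0) (fun w hw => hb w hw.ne) (w := x :: (m ++ [y])) (by simp; omega)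
  rw [LinearMap.comp_apply, LinearMap.comp_apply, coder_add, LinearMap.add_apply,
    LinearMap.add_apply, map_add, map_add, e3, coder_of_length (by omega) hb hm, map_sub, map_sub,
    apply_letter_mul_letter_eq_zero hn.ne' hb, apply_letter_mul_letter_eq_zero hn.ne' hb,
    hs.apply_letter_mul, hs.apply_letter_mul,
    hbg.apply_mul_of (n := 0) (by norm_num) m (x :: m) rfl]
  norm_num
  abel

/-- The Bianchi identity. Both (p ∘ D) ∘ D and p ∘ D² are the same map, where D is `coder p`; the
first reduces to the bar differential, and D² is a coderivation with corestriction p ∘ D, whose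
lowest terms are given by `IsCoderAlong.eq_add`. -/
theorem cocycle_relation {p : Cochain} (hs : IsStrict p) (hg : Good (-1) p) {n : ℕ}
    (h0 : ∀ w : List Basic, w.length < n → (p ∘ₗ coder p) (word w) = 0) (x y : Basic)
    (m : List Basic) (hm : m.length + 1 = n) :
    (p ∘ₗ coder p) (coder mulC (word (x :: (m ++ [y])))) =
      TorusAlg.of x * (p ∘ₗ coder p) (word (m ++ [y])) +
      (-1 : ℤ) ^ m.length • ((p ∘ₗ coder p) (word (x :: m)) * TorusAlg.of y) := by
  have hp1 := hg.map_one
  have hc : IsCoderAlong LinearMap.id proj1 1 (p ∘ₗ coder p) (coder p ∘ₗ coder p) :=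
    fun w => coder_coder hp1 (hg.hasParity (by norm_num)) w
  have := hc.eq_add proj1_one rfl proj1_singleton (fun _ => rfl) h0 x y m hm
  rw [LinearMap.comp_apply] at this
  rw [← apply_coder_eq_apply_coder_mulC (hs.eq_mulC hp1) h0 (by simp; omega),
    (hg.comp_coder hg).apply_mul_of (n := 1) (by norm_num) m (x :: m) rfl]
  have e : ∀ t, (p ∘ₗ coder p) t = p (coder p t) := fun _ => rfl
  generalize p ∘ₗ coder p = o at this e ⊢
  rw [e, this, one_smul, map_add, map_add, hs.apply_letter, ← letter_of,
    ← letter_of, hs.apply_letter_mul, hs.apply_letter_mul]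
  norm_num
  abel

/-- The relation has degree λ⁻², so it is empty in even arity. In arity 1 it is trivial and in arity
3 it is associativity. -/
theorem base_relation {p : Cochain} (hs : IsStrict p) (hg : Good (-1) p) (w : List Basic)
    (hw : w.length < 5) : (p ∘ₗ coder p) (word w) = 0 := by
  by_cases hpar : w.length % 2 = 1
  swap
  · exact (hg.comp_coder hg).hasParity (d := 1) (by norm_num) w (by omega)
  have hp1 := hg.map_one
  match w with
  | [] => simp at hpar
  | [x] => simp [coder_cons, splitSum_cons, hp1, hs.one]
  | [x, y, z] =>
    have e : ∀ x y, coder p (word [x, y]) = letter (TorusAlg.of x * TorusAlg.of y) := fun x y => by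
      simp [coder_cons, splitSum_cons, hp1, hs.one, hs.two]
    have h3 : p (word [x, y, z]) = 0 := hg.hasParity (d := 0) (by norm_num) _ (by simp)
    rw [LinearMap.comp_apply, coder_cons, e, splitSum_cons, splitSum_cons, splitSum_cons,
      splitSum_nil, hs.one, hs.two, h3, ← letter_of, ← letter_of]
    simp only [word_nil, hp1, map_zero, zero_mul, zero_add, add_zero, map_sub,
      hs.apply_letter_mul, mul_assoc, sub_self]
  | [_, _] => simp at hpar
  | [_, _, _, _] => simp at hpar
  | _ :: _ :: _ :: _ :: _ :: _ => simp at hw; omega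

theorem isObstruction_relation : IsObstruction baseC (-1) 5 fun p => p ∘ₗ coder p where
  two_le := by norm_num
  init := good_mulC.add good_quartic
  agree p q n hp hq h := agreeLE_relation hp.isStrict hq.isStrict hq.1.map_one h
  linear p b n hn hp hpb hbg hb x y m hm :=
    linear_relation (by omega) hp.isStrict hp.1.map_one hbg hb x y m hm
  cocycle p n hn hp h0 x y m hm := cocycle_relation hp.isStrict hp.1 h0 x y m hm
  good p hp := by rw [sub_eq_add_neg]; exact hp.1.comp_coder hp.1
  idem p hp w hw := hp.isStrict.relation_idem hp.1 hw
  koszul p hp i n hn := hp.relation_koszul i hn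
  base p hp w hw := base_relation hp.isStrict hp.1 w hw

/-- There is a strictly unital deformation with the prescribed quartic operations. -/
theorem exists_relation : ∃ p : Cochain, Good (-1) p ∧ IsStrict p ∧
    (∀ i, p (word (koszul i 4)) = (Polynomial.X : ℤ[X]) • iota (src i)) ∧
    p ∘ₗ coder p = 0 := by
  obtain ⟨p, hp, h⟩ := isObstruction_relation.exists_solution
  exact ⟨p, hp.1, hp.isStrict, hp.koszul_four, words_ext h⟩

/-! ### Strictly unital coalgebra maps -/

/-- A cochain of the shape of a strictly unital homomorphism with linear part the identity. -/
structure IsUnital (f : Cochain) : Prop where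
  one : ∀ x, f (word [x]) = TorusAlg.of x
  unit : ∀ w : List Basic, 2 ≤ w.length → (∃ k, idem k ∈ w) → f (word w) = 0

theorem isUnital_proj1 : IsUnital proj1 where
  one := proj1_singleton
  unit w hw _ := proj1_of_length_ne_one (by omega)

theorem words_ext₂ {N : Type*} [AddCommGroup N] [Module ℤ[X] N]
    {f g : Words →ₗ[ℤ[X]] Words →ₗ[ℤ[X]] N} (h : ∀ u v, f (word u) (word v) = g (word u) (word v))
    (s t : Words) : f s t = g s t := by
  have : f = g := words_ext fun u => words_ext fun v => h u v
  rw [this]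

/-- The product with a letter in between. -/
def sandwich (k : Fin 2) : Words →ₗ[ℤ[X]] Words →ₗ[ℤ[X]] Words :=
  (LinearMap.mul ℤ[X] Words).compl₂ (lmul (word [idem k]))

theorem IsUnital.apply_idem {f : Cochain} (hf : IsUnital f) (k : Fin 2) (s t : Words) :
    f (s * (word [idem k] * t)) = (aug s * aug t) • iota k := by
  refine words_ext₂ (f := (sandwich k).compr₂ f) (g := (LinearMap.mul ℤ[X] ℤ[X]).compl₁₂ aug aug
    |>.compr₂ (LinearMap.toSpanSingleton ℤ[X] A (iota k))) (fun u v => ?_) s t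
  change f (word u * (word [idem k] * word v)) = (aug (word u) * aug (word v)) • iota k
  rw [← word_append, ← word_append]
  rcases eq_or_ne u [] with rfl | hu <;> rcases eq_or_ne v [] with rfl | hv
  · simp [hf.one, iota]
  · have := List.length_pos_iff.2 hv
    rw [hf.unit _ (by simp; omega) ⟨k, by simp⟩]; simp [hv]
  · have := List.length_pos_iff.2 hu
    rw [hf.unit _ (by simp; omega) ⟨k, by simp⟩]; simp [hu]
  · have := List.length_pos_iff.2 hu
    rw [hf.unit _ (by simp; omega) ⟨k, by simp⟩]; simp [hu]

/-- A block of length at least two containing the idempotent gives zero, so the idempotent forms its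
own block and separates the two sides. -/
theorem IsUnital.cohom_idem {f : Cochain} (hf : IsUnital f) (h0 : f 1 = 0) (k : Fin 2)
    (u v : List Basic) : cohom f (word (u ++ idem k :: v)) =
      cohom f (word u) * (word [idem k] * cohom f (word v)) := by
  induction hn : u.length using Nat.strong_induction_on generalizing u with
  | _ n ih =>
    subst hn
    rcases eq_or_ne u [] with rfl | hu
    · rw [List.nil_append, cohom_of_ne_nil h0 (by simp), splitSum_cons, splitSum_eq_first, hf.one]
      · simp [h0]
      · intro a b _ ha
        have := List.length_pos_iff.2 ha
        rw [hf.unit _ (by simp; omega) ⟨k, by simp⟩]; simp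
    · have hl := List.length_pos_iff.2 hu
      rw [cohom_of_ne_nil h0 (by simp), splitSum_append, cohom_of_ne_nil h0 hu]
      have e : splitSum (fun a b => letter (f (word (u ++ idem k :: a))) * cohom f (word b)) v =
          0 := splitSum_eq_zero fun a b _ => by
        rw [hf.unit _ (by simp; omega) ⟨k, by simp⟩]; simp
      rw [e, add_zero]
      have := map_splitSum (LinearMap.mulRight ℤ[X] (word [idem k] * cohom f (word v)))
        (fun a b => letter (f (word a)) * cohom f (word b)) u
      rw [LinearMap.mulRight_apply] at this
      rw [this]
      refine splitSum_congr fun a b hab => ?_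
      rcases eq_or_ne a [] with rfl | ha
      · simp [h0]
      · have h1 := List.length_pos_iff.2 ha
        have h2 : a.length + b.length = u.length := by rw [← hab, List.length_append]
        rw [ih b.length (by omega) b rfl, LinearMap.mulRight_apply, mul_assoc]

theorem IsUnital.cohom_sandwich {f : Cochain} (hf : IsUnital f) (h0 : f 1 = 0) (k : Fin 2)
    (s t : Words) : cohom f (s * (word [idem k] * t)) =
      cohom f s * (word [idem k] * cohom f t) := by
  refine words_ext₂ (f := (sandwich k).compr₂ (cohom f))
    (g := (sandwich k).compl₁₂ (cohom f) (cohom f)) (fun u v => ?_) s t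
  change cohom f (word u * (word [idem k] * word v)) =
    cohom f (word u) * (word [idem k] * cohom f (word v))
  rw [← hf.cohom_idem h0, ← word_append, ← word_append]
  rfl

theorem cohom_singleton {f : Cochain} (hf0 : f 1 = 0) (hu : IsUnital f) (x : Basic) :
    cohom f (word [x]) = word [x] := by
  rw [cohom_of_ne_nil hf0 (by simp), splitSum_cons, splitSum_nil]
  simp [hf0, hu.one]

theorem IsUnital.apply_letter {f : Cochain} (hf : IsUnital f) (a : A) : f (letter a) = a := by
  have : f ∘ₗ letter = LinearMap.id := TorusAlg.hom_ext fun x => by simp [hf.one]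
  exact congrArg (fun F => F a) this

theorem Good.cohom {f : Cochain} (hf : Good 0 f) : pathGrading.IsHomEnd 1 (cohom f) :=
  PathGrading.IsHom.cohom hf.map_one (by have := hf; rwa [Good, shift_zero] at this)

theorem Good.comp_cohom {j : ℤ} {p f : Cochain} (hp : Good j p) (hf : Good 0 f) :
    Good j (p ∘ₗ TorusAInf.cohom f) := by
  have := hp.comp hf.cohom
  rwa [mul_one] at this

/-- The failure of the relations of a homomorphism. -/
def homRelation (μ μ' f : Cochain) : Cochain := f ∘ₗ coder μ - μ' ∘ₗ cohom f

theorem homRelation_apply (μ μ' f : Cochain) (t : Words) :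
    homRelation μ μ' f t = f (coder μ t) - μ' (cohom f t) := rfl

theorem good_homRelation {μ μ' f : Cochain} (hμ : Good (-1) μ) (hμ' : Good (-1) μ')
    (hf : Good 0 f) : Good (-1) (homRelation μ μ' f) := by
  have := hf.comp_coder hμ
  rw [zero_add] at this
  exact this.sub (hμ'.comp_cohom hf)

/-- As for the structure relation, only a word with the idempotent at one end leaves terms. They
cancel because `f` is nonzero only in odd arity. -/
theorem IsUnital.homRelation_idem {μ μ' f : Cochain} (hf : IsUnital f) (hμ : Good (-1) μ)
    (hμ' : Good (-1) μ') (hs : IsStrict μ) (hs' : IsStrict μ') (hg : Good 0 f)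
    {w : List Basic} (hw : ∃ k, idem k ∈ w) : homRelation μ μ' f (word w) = 0 := by
  obtain ⟨k, u, v, rfl⟩ := idem_mem_split hw
  have hg' := good_homRelation hμ hμ' hg
  by_cases hu : ∀ x ∈ u.getLast?, x.target = k
  swap
  · push Not at hu
    obtain ⟨x, hx, hx'⟩ := hu
    exact hg'.eq_zero_of_target_ne hx hx'
  by_cases hv : ∀ x ∈ v.head?, x.source = k
  swap
  · push Not at hv
    obtain ⟨x, hx, hx'⟩ := hv
    exact hg'.eq_zero_of_source_ne hx hx'
  have h0 := hg.map_one
  rw [homRelation_apply, hs.coder_idem hμ.map_one u v hu hv, map_add, map_sub, map_zsmul, map_zsmul,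
    hf.apply_idem, hf.apply_idem, map_zsmul, aug_coder, aug_coder, hf.cohom_idem h0, hs'.apply_idem,
    aug_cohom h0, aug_cohom h0, proj1_cohom h0, proj1_cohom h0, hg.iota_mul_of_head hv,
    hg.mul_iota_of_getLast hu]
  rcases eq_or_ne u [] with rfl | hu0 <;> rcases eq_or_ne v [] with rfl | hv0
  · simp [h0]
  · simp [hv0]
  · rcases Nat.even_or_odd u.length with h | h
    · have : f (word u) = 0 := hg.hasParity (d := 1) (by norm_num) u (by
        rw [Nat.even_iff.1 h]; simp)
      simp [this, h0]
    · simp [hu0, h.neg_one_pow]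
  · simp [hu0, hv0]

/-! ### Linearization of the homomorphism relations -/

theorem cohom_sub_of_agreeLE {f g : Cochain} (hf : f 1 = 0) (hg : g 1 = 0) {n : ℕ}
    (h : AgreeLE n f g) {w : List Basic} (hw : w.length ≤ n + 1) :
    cohom f (word w) - cohom g (word w) = letter (f (word w) - g (word w)) := by
  rcases eq_or_ne w [] with rfl | hw0
  · simp [hf, hg]
  · rw [cohom_of_ne_nil hf hw0, cohom_of_ne_nil hg hw0, splitSum_sub, splitSum_eq_last]
    · simp
    · intro u v huv hv
      have hl : u.length + v.length = w.length := by rw [← List.length_append, huv]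
      have h1 := List.length_pos_iff.2 hv
      rcases eq_or_ne u [] with rfl | hu
      · simp [hf, hg]
      · have h2 := List.length_pos_iff.2 hu
        rw [h u (by omega), h.cohom hf hg v (by omega), sub_self]

theorem cohom_add_of_length {f b : Cochain} (hf : f 1 = 0) (hf1 : ∀ x, f (word [x]) = TorusAlg.of x)
    {n : ℕ} (hn : 1 < n) (hb : ∀ w : List Basic, w.length ≠ n → b (word w) = 0) {x y : Basic}
    {m : List Basic} (hm : m.length + 1 = n) :
    cohom (f + b) (word (x :: (m ++ [y]))) = cohom f (word (x :: (m ++ [y]))) +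
      (letter (b (word (x :: m))) * letter (TorusAlg.of y) +
        letter (TorusAlg.of x) * letter (b (word (m ++ [y])))) := by
  have hb0 : b 1 = 0 := by rw [← word_nil]; exact hb [] (by simp; omega)
  have hfb : (f + b) 1 = 0 := by rw [LinearMap.add_apply, hf, hb0, add_zero]
  have hag : AgreeLE (n - 1) (f + b) f := fun w hw => by
    rw [LinearMap.add_apply, hb w (by omega), add_zero]
  have e1 : cohom (f + b) (word [y]) = letter (TorusAlg.of y) := by
    rw [cohom_of_ne_nil hfb (by simp), splitSum_cons, splitSum_nil]
    simp [hf1, hb [y] (by simp; omega), hb0, hf]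
  have e2 : cohom (f + b) (word (m ++ [y])) - cohom f (word (m ++ [y])) =
      letter (b (word (m ++ [y]))) := by
    rw [cohom_sub_of_agreeLE hfb hf hag (by simp; omega), LinearMap.add_apply, add_sub_cancel_left]
  rw [← sub_eq_iff_eq_add', cohom_of_ne_nil hfb (by simp), cohom_of_ne_nil hf (by simp),
    splitSum_sub, ← List.cons_append, splitSum_append_singleton]
  have e3 : splitSum (fun u v => letter ((f + b) (word u)) * cohom (f + b) (word (v ++ [y])) -
      letter (f (word u)) * cohom f (word (v ++ [y]))) (x :: m) =
      letter (b (word (x :: m))) * letter (TorusAlg.of y) +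
        letter (TorusAlg.of x) * letter (b (word (m ++ [y]))) := by
    have : ∀ u v, u ++ v = x :: m →
        letter ((f + b) (word u)) * cohom (f + b) (word (v ++ [y])) -
          letter (f (word u)) * cohom f (word (v ++ [y])) =
        letter (b (word u)) * cohom (f + b) (word (v ++ [y])) +
          letter (f (word u)) * (cohom (f + b) (word (v ++ [y])) - cohom f (word (v ++ [y]))) := by
      intro u v _
      rw [LinearMap.add_apply, map_add, add_mul, mul_sub]; abel
    rw [splitSum_congr this, splitSum_add, splitSum_eq_last, splitSum_cons, splitSum_eq_first]
    · rw [List.nil_append, e1, hf1, e2]; simp [hf]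
    · intro u v huv hu
      have hl : u.length + v.length = m.length := by rw [← List.length_append, huv]
      have := List.length_pos_iff.2 hu
      rw [hag.cohom hfb hf _ (by simp; omega), sub_self, mul_zero]
    · intro u v huv hv
      have hl : u.length + v.length = m.length + 1 := by
        rw [← List.length_append, huv]; simp
      have := List.length_pos_iff.2 hv
      rw [hb u (by omega)]; simp
  rw [e3, LinearMap.add_apply, hb (x :: m ++ [y]) (by simp; omega), add_zero, add_eq_left,
    word_nil, cohom_one, cohom_one, sub_self]

section

variable {μ μ' : Cochain}

theorem agreeLE_homRelation {f g : Cochain} {n : ℕ} (hμ0 : μ 1 = 0) (hs : IsStrict μ)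
    (hs' : IsStrict μ') (hf : f 1 = 0) (hg : g 1 = 0) (h : AgreeLE n f g) :
    AgreeLE (n + 1) (homRelation μ μ' f) (homRelation μ μ' g) := by
  intro w hw
  have h2 : coder μ (word w) ∈ lengthLE n :=
    lengthLE_mono (by omega) (coder_mem_lengthLE hμ0 hs.one w)
  rw [homRelation_apply, homRelation_apply, h.eq_of_mem h2,
    sub_eq_iff_eq_add.1 (cohom_sub_of_agreeLE hf hg h hw), map_add, hs'.apply_letter, zero_add]

/-- On a word of length n + 1 a block of length n leaves just one letter. Hence μ' enters only
through its multiplication and μ only through the bar differential. -/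
theorem linear_homRelation {f b : Cochain} {n : ℕ} (hn : 2 < n) (hμ0 : μ 1 = 0) (hs : IsStrict μ)
    (hs' : IsStrict μ') (hf0 : f 1 = 0) (hf : IsUnital f)
    (hbg : Good 0 b) (hb : ∀ w : List Basic, w.length ≠ n → b (word w) = 0) (x y : Basic)
    (m : List Basic) (hm : m.length + 1 = n) :
    homRelation μ μ' (f + b) (word (x :: (m ++ [y]))) =
      homRelation μ μ' f (word (x :: (m ++ [y]))) +
      (b (coder mulC (word (x :: (m ++ [y])))) - TorusAlg.of x * b (word (m ++ [y])) -
      (-1 : ℤ) ^ m.length • (b (word (x :: m)) * TorusAlg.of y)) := by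
  have e3 := apply_coder_eq_apply_coder_mulC (p := μ) (o := b) (n := n)
    (hs.eq_mulC hμ0) (fun w hw => hb w hw.ne) (w := x :: (m ++ [y])) (by simp; omega)
  rw [homRelation_apply, homRelation_apply, LinearMap.add_apply, e3,
    cohom_add_of_length hf0 hf.one (by omega) hb hm, map_add, map_add,
    hs'.apply_letter_mul, hs'.apply_letter_mul,
    hbg.apply_mul_of (n := 1) (by norm_num) m (x :: m) rfl]
  norm_num
  abel

theorem coder_coder_eq_zero (hg : Good (-1) μ) (h : μ ∘ₗ coder μ = 0) : coder μ ∘ₗ coder μ = 0 := by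
  have hc : IsCoderAlong LinearMap.id proj1 1 (μ ∘ₗ coder μ) (coder μ ∘ₗ coder μ) :=
    fun w => coder_coder hg.map_one (hg.hasParity (by norm_num)) w
  exact words_ext fun w =>
    hc.eq_zero proj1_one (n := w.length + 1) (fun _ _ => by rw [h]; rfl) w (by omega)

theorem isCoderAlong_homRelation {f : Cochain} (hg : Good (-1) μ) (hg' : Good (-1) μ')
    (hf : Good 0 f) : IsCoderAlong (cohom f) f (-1) (homRelation μ μ' f)
      (cohom f ∘ₗ coder μ - coder μ' ∘ₗ cohom f) := fun w =>
  cohom_coder_sub hg.map_one hg'.map_one (hf.hasParity (by norm_num)) w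

/-- Since D² = 0 and μ' ∘ D' = 0, the error composed with D is −μ' applied to the failure of the
coalgebra map to commute with D and D'. That failure is a coderivation along the coalgebra map, so
its lowest terms are explicit. -/
theorem cocycle_homRelation {f : Cochain} (hg : Good (-1) μ) (hg' : Good (-1) μ') (hs : IsStrict μ)
    (hs' : IsStrict μ') (hr : μ ∘ₗ coder μ = 0) (hr' : μ' ∘ₗ coder μ' = 0) (hf : Good 0 f)
    (hu : IsUnital f) {n : ℕ}
    (h0 : ∀ w : List Basic, w.length < n → homRelation μ μ' f (word w) = 0) (x y : Basic)
    (m : List Basic) (hm : m.length + 1 = n) :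
    homRelation μ μ' f (coder mulC (word (x :: (m ++ [y])))) =
      TorusAlg.of x * homRelation μ μ' f (word (m ++ [y])) +
      (-1 : ℤ) ^ m.length • (homRelation μ μ' f (word (x :: m)) * TorusAlg.of y) := by
  have hf0 := hf.map_one
  have := (isCoderAlong_homRelation hg hg' hf).eq_add hf0 (cohom_one f) hu.one
    (cohom_singleton hf0 hu) h0 x y m hm
  rw [← apply_coder_eq_apply_coder_mulC (hs.eq_mulC hg.map_one) h0 (by simp; omega),
    (good_homRelation hg hg' hf).apply_mul_of (n := 0) (by norm_num) m (x :: m) rfl]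
  have e : ∀ t, homRelation μ μ' f (coder μ t) =
      -μ' ((cohom f ∘ₗ coder μ - coder μ' ∘ₗ cohom f) t) := fun t => by
    have h1 : coder μ (coder μ t) = 0 := congrArg (fun F => F t) (coder_coder_eq_zero hg hr)
    have h2 : μ' (coder μ' (cohom f t)) = 0 := congrArg (fun F => F (cohom f t)) hr'
    rw [homRelation_apply, h1, LinearMap.sub_apply, map_sub, LinearMap.comp_apply,
      LinearMap.comp_apply, h2]
    simp
  rw [e, this, neg_one_smul, map_add, map_add, map_neg, hs'.apply_letter, ← letter_of,
    ← letter_of, hs'.apply_letter_mul, hs'.apply_letter_mul]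
  norm_num

/-- By parity only even arities matter. In arity 2 the relation says that the identity respects the
product, as f₂ = 0. -/
theorem base_homRelation {f : Cochain} (hg : Good (-1) μ) (hg' : Good (-1) μ') (hs : IsStrict μ)
    (hs' : IsStrict μ') (hf : Good 0 f) (hu : IsUnital f) (w : List Basic) (hw : w.length < 4) :
    homRelation μ μ' f (word w) = 0 := by
  by_cases hpar : w.length % 2 = 0
  swap
  · exact (good_homRelation hg hg' hf).hasParity (d := 0) (by norm_num) w (by omega)
  have hf0 := hf.map_one
  match w with
  | [] => exact (good_homRelation hg hg' hf).map_one
  | [x, y] =>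
    have e : coder μ (word [x, y]) = letter (TorusAlg.of x * TorusAlg.of y) := by
      simp [coder_cons, splitSum_cons, hg.map_one, hs.one, hs.two]
    have h2 : f (word [x, y]) = 0 := hf.hasParity (d := 1) (by norm_num) _ (by simp)
    rw [homRelation_apply, e, hu.apply_letter, cohom_of_ne_nil hf0 (by simp), splitSum_cons,
      splitSum_cons, splitSum_nil, h2, cohom_singleton hf0 hu, hu.one, ← letter_of]
    simp only [word_nil, hf0, map_zero, zero_mul, zero_add, add_zero]
    rw [hs'.apply_letter_mul, sub_self]
  | [_] => simp at hpar
  | [_, _, _] => simp at hpar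
  | _ :: _ :: _ :: _ :: _ => simp at hw; omega

end

/-! ### The quartic operations -/

/-- The monomials in the degree of a quartic operation on a word without contractible products. -/
theorem monomial_cases_koszul_four {i : ZMod 4} {x : Basic} {k : ℕ}
    (e : pathGrading.deg x * pathGrading.var ^ k = shift (-1) * pathGrading.wdeg (koszul i 4)) :
    (x = idem (src i) ∧ k = 1) ∨ (x = chord i 3 ∧ k = 0) ∨ (x = chord (i + 2) 3 ∧ k = 0) := by
  have e' := e
  rw [← deg_quartic] at e
  have hs : x.source = src i := by
    have := (monomial_fst (k := k) rfl).symm.trans ((congrArg Prod.fst e).trans (monomial_fst rfl))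
    exact (single_inj this).1
  have e2 := (monomial_snd e').symm.trans (by rw [← deg_quartic, monomial_snd rfl])
  rw [show (idem (src i)).gr = 1 from rfl] at e2
  have ha := congrArg Grp.a e2
  have hb := congrArg Grp.b e2
  have hw := congrArg Grp.w e2
  simp only [Grp.a_mul, Grp.b_mul, Grp.w_mul, Grp.a_lam, Grp.b_lam, Grp.w_lam, a_gU_pow, b_gU_pow,
    w_gU_pow, Grp.a_one, Grp.b_one, Grp.w_one] at ha hb hw
  rcases basic_of_ab_eq_zero (x := x) (by linarith) (by linarith) with ⟨j, rfl⟩ | ⟨j, c, rfl, hx⟩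
  · left
    obtain rfl : j = src i := hs
    refine ⟨rfl, ?_⟩
    rw [show (idem (src i)).gr = 1 from rfl, Grp.w_one] at hw
    omega
  · right
    rw [hx, w_gU_pow] at hw
    have hk : k = 0 := by push_cast at hw; omega
    have hc : c = 0 := by push_cast at hw; omega
    subst hk hc
    have : ∀ i j : ZMod 4, src j = src i → j = i ∨ j = i + 2 := by decide
    rcases this i j hs with rfl | rfl
    · exact Or.inl ⟨rfl, rfl⟩
    · exact Or.inr ⟨rfl, rfl⟩

theorem mem_homA_koszul_four {i : ZMod 4} {a : A}
    (ha : a ∈ pathGrading.homA (shift (-1) * pathGrading.wdeg (koszul i 4))) :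
    ∃ x y z : ℤ, a = x • ((Polynomial.X : ℤ[X]) ^ 1 • TorusAlg.of (idem (src i)) : A) +
      y • ((Polynomial.X : ℤ[X]) ^ 0 • TorusAlg.of (chord i 3) : A) +
      z • ((Polynomial.X : ℤ[X]) ^ 0 • TorusAlg.of (chord (i + 2) 3) : A) := by
  have : pathGrading.homA (shift (-1) * pathGrading.wdeg (koszul i 4)) ≤
      (Submodule.span ℤ {((Polynomial.X : ℤ[X]) ^ 1 • TorusAlg.of (idem (src i)) : A),
        ((Polynomial.X : ℤ[X]) ^ 0 • TorusAlg.of (chord i 3) : A),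
        ((Polynomial.X : ℤ[X]) ^ 0 • TorusAlg.of (chord (i + 2) 3) : A)}).toAddSubgroup :=
    PathGrading.homA_induction fun k b e => Submodule.subset_span (by
      rcases monomial_cases_koszul_four e with ⟨rfl, rfl⟩ | ⟨rfl, rfl⟩ | ⟨rfl, rfl⟩ <;> simp)
  obtain ⟨x, y, z, h⟩ := Submodule.mem_span_triple.1 (this ha)
  exact ⟨x, y, z, h.symm⟩

theorem mul_zsmul_pow_smul (a b : A) (x : ℤ) (k : ℕ) :
    a * x • ((Polynomial.X : ℤ[X]) ^ k • b) = x • ((Polynomial.X : ℤ[X]) ^ k • (a * b)) := by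
  rw [mul_smul_comm, mul_smulA]

theorem zsmul_pow_smul_mul (a b : A) (x : ℤ) (k : ℕ) :
    x • ((Polynomial.X : ℤ[X]) ^ k • b) * a = x • ((Polynomial.X : ℤ[X]) ^ k • (b * a)) := by
  rw [smul_mul_assoc, smul_mulA]

/-- The degree admits three monomials: U times the idempotent and the two loops of four arrows at
the vertex. Left multiplication by ρ_{i+1} kills only the loop that starts with ρ_i and sends the
other two to distinct monomials. -/
theorem eq_zsmul_of_rho_mul {i : ZMod 4} {a : A}
    (ha : a ∈ pathGrading.homA (shift (-1) * pathGrading.wdeg (koszul i 4)))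
    (h : rho (i + 1) * a = 0) : ∃ y : ℤ, a = y • TorusAlg.of (chord i 3) := by
  obtain ⟨x, y, z, rfl⟩ := mem_homA_koszul_four ha
  have e1 : rho (i + 1) * TorusAlg.of (idem (src i)) = (TorusAlg.of (chord (i + 1) 0) : A) := by
    rw [rho, ← iota, of_mul_iota, if_pos]
    simpa [target] using (by decide : ∀ i : ZMod 4, src i = tgt (i + 1)) i
  have e2 : rho (i + 1) * TorusAlg.of (chord i 3) = (0 : A) :=
    chord_mul_chord_eq_zero (by simpa using (by decide : ∀ i : ZMod 4, i ≠ i + 1 + 1) i) 3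
  have e3 : rho (i + 1) * TorusAlg.of (chord (i + 2) 3) = (TorusAlg.of (chord (i + 1) 4) : A) := by
    rw [show i + 2 = i + 1 + 1 by ring]
    exact rho_mul_chord (i + 1) 3
  rw [mul_add, mul_add, mul_zsmul_pow_smul, mul_zsmul_pow_smul, mul_zsmul_pow_smul, e1, e2,
    e3, smul_zero, smul_zero, add_zero] at h
  have hx := congrArg (coefA (chord (i + 1) 0) 1) h
  have hz := congrArg (coefA (chord (i + 1) 4) 0) h
  rw [map_add, map_zsmul, map_zsmul, coefA_monomial, coefA_monomial] at hx hz
  simp at hx hz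
  exact ⟨y, by simp [hx, hz]⟩

theorem eq_zsmul_of_mul_rho {i : ZMod 4} {a : A}
    (ha : a ∈ pathGrading.homA (shift (-1) * pathGrading.wdeg (koszul i 4)))
    (h : a * rho i = 0) : ∃ z : ℤ, a = z • TorusAlg.of (chord (i + 2) 3) := by
  obtain ⟨x, y, z, rfl⟩ := mem_homA_koszul_four ha
  have e1 : TorusAlg.of (idem (src i)) * rho i = (TorusAlg.of (chord i 0) : A) := by
    rw [rho, ← iota, iota_mul_of, if_pos (show src i = (chord i 0).source from rfl)]
  have e2 : TorusAlg.of (chord i 3) * rho i = (TorusAlg.of (chord i 4) : A) := by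
    have := chord_mul_chord i 3 0
    rwa [(by decide : ∀ i : ZMod 4, i + ((3 : ℕ) : ZMod 4) + 1 = i) i] at this
  have e3 : TorusAlg.of (chord (i + 2) 3) * rho i = (0 : A) :=
    chord_mul_chord_eq_zero ((by decide : ∀ i : ZMod 4, i ≠ i + 2 + ((3 : ℕ) : ZMod 4) + 1) i) 0
  rw [add_mul, add_mul, zsmul_pow_smul_mul, zsmul_pow_smul_mul, zsmul_pow_smul_mul, e1, e2,
    e3, smul_zero, smul_zero, add_zero] at h
  have hx := congrArg (coefA (chord i 0) 1) h
  have hz := congrArg (coefA (chord i 4) 0) h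
  rw [map_add, map_zsmul, map_zsmul, coefA_monomial, coefA_monomial] at hx hz
  simp at hx hz
  exact ⟨z, by simp [hx, hz]⟩

/-- The shape of the differences of the quartic operations of two deformations. -/
theorem exists_quartic_eq {μ μ' : Cochain} (hg : Good (-1) μ) (hg' : Good (-1) μ')
    (hs : IsStrict μ) (hs' : IsStrict μ') (hr : μ ∘ₗ coder μ = 0) (hr' : μ' ∘ₗ coder μ' = 0)
    (h3 : μ (word (koszul 3 4)) = μ' (word (koszul 3 4)))
    (h4 : μ (word (koszul 4 4)) = μ' (word (koszul 4 4))) : ∃ z : ℤ,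
    μ (word (koszul 1 4)) - μ' (word (koszul 1 4)) = z • TorusAlg.of (chord 3 3) ∧
    μ (word (koszul 2 4)) - μ' (word (koszul 2 4)) = z • TorusAlg.of (chord 2 3) := by
  -- With δ_i the difference of the quartic values on the word starting with ρ_i, the relations in
  -- arity 5 give δ_i ρ_i = ρ_i δ_{i-1}.
  have key : ∀ i, (μ (word (koszul i 4)) - μ' (word (koszul i 4))) * rho i =
      rho i * (μ (word (koszul (i - 1) 4)) - μ' (word (koszul (i - 1) 4))) := fun i => by
    have e := relation_koszul_five hs.two (fun i n hn => hg.koszul_eq_zero i hn) i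
    have e' := relation_koszul_five hs'.two (fun i n hn => hg'.koszul_eq_zero i hn) i
    rw [hr, LinearMap.zero_apply, eq_comm, sub_eq_zero] at e
    rw [hr', LinearMap.zero_apply, eq_comm, sub_eq_zero] at e'
    rw [sub_mul, mul_sub, e, e']
  have hmem : ∀ i, μ (word (koszul i 4)) - μ' (word (koszul i 4)) ∈
      pathGrading.homA (shift (-1) * pathGrading.wdeg (koszul i 4)) := fun i =>
    sub_mem (hg _) (hg' _)
  have k3 := key 3
  have k2 := key 2
  have k1 := key 1
  -- Since δ₃ = δ₄ = 0, the cases i = 3 and i = 1 give ρ₃δ₂ = 0 and δ₁ρ₁ = 0, so each of δ₂ and δ₁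
  -- is a multiple of one loop. The case i = 2 identifies the two coefficients.
  rw [show (3 : ZMod 4) - 1 = 2 by decide, h3, sub_self, zero_mul] at k3
  rw [show (2 : ZMod 4) - 1 = 1 by decide] at k2
  rw [show (1 : ZMod 4) - 1 = 4 by decide, h4, sub_self, mul_zero] at k1
  obtain ⟨y, hy⟩ := eq_zsmul_of_rho_mul (hmem 2) (by
    rw [show (2 : ZMod 4) + 1 = 3 by decide]; exact k3.symm)
  obtain ⟨z, hz⟩ := eq_zsmul_of_mul_rho (hmem 1) k1
  rw [show (1 : ZMod 4) + 2 = 3 by decide] at hz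
  rw [hy, hz, smul_mul_assoc, mul_smul_comm] at k2
  have e1 : TorusAlg.of (chord 2 3) * rho 2 = (TorusAlg.of (chord 2 4) : A) := by
    have := chord_mul_chord 2 3 0
    rwa [show (2 : ZMod 4) + ((3 : ℕ) : ZMod 4) + 1 = 2 by decide] at this
  have e2 : rho 2 * TorusAlg.of (chord 3 3) = (TorusAlg.of (chord 2 4) : A) := rho_mul_chord 2 3
  rw [e1, e2] at k2
  have := congrArg (coefA (chord 2 4) 0) k2
  have e3 := coefA_monomial (chord 2 4) (chord 2 4) 0 0
  rw [pow_zero, one_smul] at e3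
  rw [map_zsmul, map_zsmul, e3] at this
  simp at this
  exact ⟨z, hz, by rw [hy, this]⟩

/-! ### Uniqueness -/

open Classical in
/-- The cubic correction. -/
def cubic (z : ℤ) : Cochain := lin fun w =>
  if w = koszul 1 3 then z • TorusAlg.of (chord 3 2) else 0

theorem cubic_koszul (z : ℤ) : cubic z (word (koszul 1 3)) = z • TorusAlg.of (chord 3 2) := by
  rw [cubic, lin_word, if_pos rfl]

theorem cubic_of_ne (z : ℤ) {w : List Basic} (h : w ≠ koszul 1 3) : cubic z (word w) = 0 := by
  rw [cubic, lin_word, if_neg h]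

theorem deg_cubic : pathGrading.deg (chord 3 2) = shift 0 * pathGrading.wdeg (koszul 1 3) := by
  refine Prod.ext ?_ ?_
  · simp +decide
  · rw [shift_zero, one_mul, wdeg_grp]
    apply Grp.ext <;>
      simp +decide [koszul, pathGrading, grpGrading, Basic.gr, chordGr, Grp.m_mul, Grp.a_mul,
        Grp.b_mul, Grp.m_gammaRho, Grp.a_gammaRho, Grp.b_gammaRho, Grp.m_lam, Grp.a_lam, Grp.b_lam]
    all_goals norm_num

theorem good_cubic (z : ℤ) : Good 0 (cubic z) := fun w => by
  by_cases h : w = koszul 1 3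
  · rw [h, cubic_koszul, ← deg_cubic]
    exact zsmul_mem (PathGrading.of_mem_homA _) z
  · rw [cubic_of_ne z h]; exact zero_mem _

/-- The identity with a cubic correction. -/
def baseHom (z : ℤ) : Cochain := proj1 + cubic z

theorem good_proj1 : Good 0 proj1 := by
  rw [Good, shift_zero]; exact PathGrading.isHom_proj1

theorem cubic_of_length_ne (z : ℤ) {w : List Basic} (h : w.length ≠ 3) : cubic z (word w) = 0 :=
  cubic_of_ne z fun hi => h (by rw [hi, length_koszul])

/-! ### Admissible homomorphisms on critical words of length at most four -/

section

variable {z : ℤ} {f : Cochain} (hf : Admissible (baseHom z) 0 4 f)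
include hf

theorem Admissible.isUnital : IsUnital f where
  one x := by
    rw [hf.2 _ (Or.inl (by simp)), baseHom, LinearMap.add_apply, proj1_singleton,
      cubic_of_length_ne z (by simp), add_zero]
  unit w hw hk := by
    rw [hf.2 w (Or.inr (Or.inl hk)), baseHom, LinearMap.add_apply,
      proj1_of_length_ne_one (by omega), cubic_of_ne, add_zero]
    rintro rfl
    obtain ⟨k, hk⟩ := hk
    exact idem_notMem_koszul _ _ _ hk

theorem Admissible.koszul_three (i : ZMod 4) : f (word (koszul i 3)) =
    if i = 1 then z • TorusAlg.of (chord 3 2) else 0 := by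
  rw [hf.2 _ (Or.inr (Or.inr ⟨i, 3, rfl⟩)), baseHom, LinearMap.add_apply,
    proj1_of_length_ne_one (by simp [length_koszul]), zero_add]
  split_ifs with h
  · rw [h, cubic_koszul]
  · exact cubic_of_ne z fun h' => h (koszul_succ_inj h')

/-- The even components of `f` vanish, so the only block lengths are 1+1+1+1, 1+3 and 3+1. -/
theorem Admissible.cohom_koszul_four (i : ZMod 4) : cohom f (word (koszul i 4)) =
    word (koszul i 4) + letter (rho i) * letter (f (word (koszul (i - 1) 3))) +
      letter (f (word (koszul i 3))) * letter (rho (i - 3)) := by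
  have hf0 := hf.1.map_one
  have hu := hf.isUnital
  have h1 : ∀ i, koszul i 1 = [chord i 0] := fun i => rfl
  have hne : ∀ i n, koszul i (n + 1) ≠ [] := fun i n => by rw [koszul]; simp
  have e2 : ∀ i, f (word (koszul i 2)) = 0 := fun i =>
    hf.1.hasParity (d := 1) (by norm_num) _ (by simp [length_koszul])
  have e4 : ∀ i, f (word (koszul i 4)) = 0 := fun i =>
    hf.1.hasParity (d := 1) (by norm_num) _ (by simp [length_koszul])
  have c1 : ∀ i, cohom f (word (koszul i 1)) = word (koszul i 1) := fun i => by
    rw [h1, cohom_singleton hf0 hu]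
  have c2 : ∀ i, cohom f (word (koszul i 2)) = word (koszul i 2) := fun i => by
    rw [cohom_of_ne_nil hf0 (hne i 1), splitSum_koszul]
    simp only [Finset.sum_range_succ, Finset.sum_range_zero]
    have e := e2 i
    rw [show koszul i 2 = [chord i 0, chord (i - 1) 0] from rfl] at e
    simp [hu.one, koszul, hf0, e, cohom_singleton hf0 hu, ← word_cons]
  have c3 : ∀ i, cohom f (word (koszul i 3)) = word (koszul i 3) + letter (f (word (koszul i 3))) :=
    fun i => by
    rw [cohom_of_ne_nil hf0 (hne i 2), splitSum_koszul]
    simp only [Finset.sum_range_succ, Finset.sum_range_zero]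
    simp only [e2, c2, h1, hu.one]
    simp [koszul, hf0, ← word_cons]
  rw [cohom_of_ne_nil hf0 (hne i 3), splitSum_koszul]
  simp only [Finset.sum_range_succ, Finset.sum_range_zero]
  simp only [e2, e4, h1, hu.one, Nat.add_one_sub_one, Nat.cast_one, c3]
  simp [koszul, hf0, rho, ← word_cons, mul_add]
  rw [← h1, c1]
  exact Or.inl rfl

/-- The cubic term multiplied by ρ₂ on the right produces z ρ₃ρ₄ρ₁ρ₂ on the word starting with ρ₁,
and multiplied by ρ₂ on the left it produces z ρ₂ρ₃ρ₄ρ₁ on the word starting with ρ₂. These are the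
two discrepancies. -/
theorem Admissible.homRelation_koszul_four {μ μ' : Cochain} (hg : Good (-1) μ)
    (hs' : IsStrict μ')
    (h1 : μ (word (koszul 1 4)) - μ' (word (koszul 1 4)) = z • TorusAlg.of (chord 3 3))
    (h2 : μ (word (koszul 2 4)) - μ' (word (koszul 2 4)) = z • TorusAlg.of (chord 2 3))
    (h3 : μ (word (koszul 3 4)) = μ' (word (koszul 3 4)))
    (h4 : μ (word (koszul 4 4)) = μ' (word (koszul 4 4))) (i : ZMod 4) :
    homRelation μ μ' f (word (koszul i 4)) = 0 := by
  rw [homRelation_apply, coder_koszul_four (fun i n hn => hg.koszul_eq_zero i hn),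
    hf.isUnital.apply_letter, hf.cohom_koszul_four, map_add, map_add, hs'.apply_letter_mul,
    hs'.apply_letter_mul, hf.koszul_three, hf.koszul_three, ← sub_sub, ← sub_sub]
  rcases zmod4_cases i with rfl | rfl | rfl | rfl
  · have : TorusAlg.of (chord 3 2) * rho (1 - 3) = (TorusAlg.of (chord 3 3) : A) :=
      chord_mul_chord 3 2 0
    rw [h1, if_neg (by decide), if_pos rfl, smul_mul_assoc, this, mul_zero, sub_zero, sub_self]
  · have : rho 2 * TorusAlg.of (chord 3 2) = (TorusAlg.of (chord 2 3) : A) := rho_mul_chord 2 2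
    rw [h2, if_pos (by decide), if_neg (by decide), mul_smul_comm, this, zero_mul, sub_zero,
      sub_self]
  · rw [h3, if_neg (by decide), if_neg (by decide), mul_zero, zero_mul, sub_self, sub_zero, sub_zero]
  · rw [h4, if_neg (by decide), if_neg (by decide), mul_zero, zero_mul, sub_self, sub_zero, sub_zero]

end

/-- Two deformations with the same quartic operations on two words are related by a
homomorphism. -/
theorem exists_homRelation {μ μ' : Cochain} (hg : Good (-1) μ) (hg' : Good (-1) μ')
    (hs : IsStrict μ) (hs' : IsStrict μ') (hr : μ ∘ₗ coder μ = 0) (hr' : μ' ∘ₗ coder μ' = 0)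
    (h3 : μ (word (koszul 3 4)) = μ' (word (koszul 3 4)))
    (h4 : μ (word (koszul 4 4)) = μ' (word (koszul 4 4))) :
    ∃ f, Good 0 f ∧ IsUnital f ∧ homRelation μ μ' f = 0 := by
  obtain ⟨z, h1, h2⟩ := exists_quartic_eq hg hg' hs hs' hr hr' h3 h4
  -- The relation is automatic below arity 4, and arity 4 is the first one with a condition on
  -- critical words.
  have H : IsObstruction (baseHom z) 0 4 (homRelation μ μ') :=
  { two_le := by norm_num
    init := good_proj1.add (good_cubic z)
    agree := fun p q n hp hq h =>
      agreeLE_homRelation hg.map_one hs hs' hp.1.map_one hq.1.map_one h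
    linear := fun p b n hn hp hpb hbg hb x y m hm =>
      linear_homRelation (by omega) hg.map_one hs hs' hp.1.map_one hp.isUnital hbg hb x y m hm
    cocycle := fun p n hn hp h0 x y m hm =>
      cocycle_homRelation hg hg' hs hs' hr hr' hp.1 hp.isUnital h0 x y m hm
    good := fun p hp => by rw [zero_sub]; exact good_homRelation hg hg' hp.1
    idem := fun p hp w hw => hp.isUnital.homRelation_idem hg hg' hs hs' hp.1 hw
    koszul := fun p hp i n hn => by
      rcases hn.eq_or_lt with rfl | hn
      · exact hp.homRelation_koszul_four hg hs' h1 h2 h3 h4 i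
      -- The error has degree λ⁻¹, so the grading alone removes all longer critical words.
      · exact (good_homRelation hg hg' hp.1).koszul_eq_zero i hn.ne'
    base := fun p hp w hw => base_homRelation hg hg' hs hs' hp.1 hp.isUnital w hw }
  obtain ⟨f, hf, h⟩ := H.exists_solution
  exact ⟨f, hf.1, hf.isUnital, words_ext h⟩

/-! ### Inverses of coalgebra maps -/

section

variable {f : Cochain} (hf : Good 0 f) (hu : IsUnital f)

/-- The difference of the identity and a coalgebra map. -/
def defect (f : Cochain) : Module.End ℤ[X] Words := 1 - cohom f

/-- The inverse of a unipotent coalgebra map. -/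
def cohomInv (f : Cochain) : Words →ₗ[ℤ[X]] Words :=
  lin fun w => ∑ k ∈ Finset.range (w.length + 1), (defect f ^ k) (word w)

include hf hu

theorem defect_word (w : List Basic) : defect f (word w) ∈ lengthLE (w.length - 1) := by
  have := neg_mem (cohom_sub_mem_lengthLE hf.map_one hu.one w)
  rwa [neg_sub] at this

theorem defect_pow_word (k : ℕ) (w : List Basic) (hw : w.length < k) :
    (defect f ^ k) (word w) = 0 := by
  induction k generalizing w with
  | zero => omega
  | succ k ih =>
    rw [pow_succ, Module.End.mul_apply]
    rcases eq_or_ne w [] with rfl | hne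
    · simp [defect]
    · have := List.length_pos_iff.2 hne
      have h0 : AgreeLE (w.length - 1) (defect f ^ k) (0 : Words →ₗ[ℤ[X]] Words) :=
        fun v hv => ih v (by omega)
      exact h0.eq_of_mem (defect_word hf hu w)

theorem cohomInv_eq_of_mem {n : ℕ} {t : Words} (ht : t ∈ lengthLE n) :
    cohomInv f t = (∑ k ∈ Finset.range (n + 1), defect f ^ k : Module.End ℤ[X] Words) t := by
  have : AgreeLE n (cohomInv f) (∑ k ∈ Finset.range (n + 1), defect f ^ k :
      Module.End ℤ[X] Words) := fun w hw => by
    rw [cohomInv, lin_word, LinearMap.sum_apply]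
    refine Finset.sum_subset (by simpa using hw) fun k _ hk => ?_
    exact defect_pow_word hf hu k w (by simpa using hk)
  exact this.eq_of_mem ht

/-- A finite geometric series: the defect strictly lowers the length and kills the empty word, hence
it is nilpotent on words of bounded length. -/
theorem cohom_cohomInv : cohom f ∘ₗ cohomInv f = LinearMap.id := words_ext fun w => by
  have e : cohom f = (1 - defect f : Module.End ℤ[X] Words) :=
    (sub_sub_cancel (1 : Module.End ℤ[X] Words) (cohom f)).symm
  rw [LinearMap.comp_apply, cohomInv_eq_of_mem hf hu (word_mem_lengthLE le_rfl), e,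
    ← Module.End.mul_apply]
  refine (congrArg (fun F : Module.End ℤ[X] Words => F (word w))
    (mul_neg_geom_sum (defect f) (w.length + 1))).trans ?_
  change word w - (defect f ^ (w.length + 1)) (word w) = word w
  rw [defect_pow_word hf hu _ _ (Nat.lt_succ_self _), sub_zero]

theorem cohomInv_cohom : cohomInv f ∘ₗ cohom f = LinearMap.id := words_ext fun w => by
  have e : cohom f = (1 - defect f : Module.End ℤ[X] Words) :=
    (sub_sub_cancel (1 : Module.End ℤ[X] Words) (cohom f)).symm
  rw [LinearMap.comp_apply, cohomInv_eq_of_mem hf hu (cohom_mem_lengthLE hf.map_one w), e,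
    ← Module.End.mul_apply]
  refine (congrArg (fun F : Module.End ℤ[X] Words => F (word w))
    (geom_sum_mul_neg (defect f) (w.length + 1))).trans ?_
  change word w - (defect f ^ (w.length + 1)) (word w) = word w
  rw [defect_pow_word hf hu _ _ (Nat.lt_succ_self _), sub_zero]

omit hu in
theorem isHomEnd_cohomInv : pathGrading.IsHomEnd 1 (cohomInv f) := fun w => by
  have h : ∀ k, pathGrading.IsHomEnd 1 (defect f ^ k) := fun k => by
    induction k with
    | zero => exact PathGrading.isHomEnd_id
    | succ k ih =>
      have := ih.comp (PathGrading.isHomEnd_id.sub hf.cohom : pathGrading.IsHomEnd 1 (defect f))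
      rw [mul_one] at this
      exact this
  rw [cohomInv, lin_word]
  exact AddSubgroup.sum_mem _ fun k _ => h k w

/-- The corestriction of the inverse. -/
def _root_.TorusAInf.inverse (f : Cochain) : Cochain := proj1 ∘ₗ cohomInv f

theorem good_inverse : Good 0 (inverse f) := by
  have := good_proj1.comp (isHomEnd_cohomInv hf)
  rwa [mul_one] at this

theorem cohomInv_apply_cohom (t : Words) : cohomInv f (cohom f t) = t :=
  congrArg (fun F => F t) (cohomInv_cohom hf hu)

theorem cohom_apply_cohomInv (t : Words) : cohom f (cohomInv f t) = t :=
  congrArg (fun F => F t) (cohom_cohomInv hf hu)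

/-- The linear inverse is again a coalgebra map. It suffices to compose the coalgebra map of its
corestriction with `cohom f`: by `conv_cohom` the corestriction sees one letter at a time, so the
composite is the identity by induction on the word. -/
theorem cohom_inverse : cohom (inverse f) = cohomInv f := by
  have hf0 := hf.map_one
  have h0 := (good_inverse hf hu).map_one
  have key : cohom (inverse f) ∘ₗ cohom f = LinearMap.id := words_ext fun w => by
    induction w with
    | nil => simp
    | cons x w ih =>
      have e : cohom (inverse f) (cohom f (word (x :: w))) =
          conv (inverse f) (cohom (inverse f)) (cohom f (word (x :: w))) := by
        conv_lhs => rw [cohom_eq_conv h0]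
        simp [aug_cohom hf0]
      rw [LinearMap.comp_apply, e, conv_cohom hf0, splitSum_cons, splitSum_eq_first]
      · rw [LinearMap.comp_apply] at ih
        rw [ih, word_nil, cohom_one, h0, inverse, LinearMap.comp_apply, cohomInv_apply_cohom hf hu,
          proj1_singleton, word_cons x]
        simp
      · intro u v _ hu'
        rw [inverse, LinearMap.comp_apply, cohomInv_apply_cohom hf hu,
          proj1_of_length_ne_one (by simpa using hu'), map_zero, zero_mul]
  refine LinearMap.ext fun t => ?_
  obtain ⟨s, rfl⟩ : ∃ s, cohom f s = t := ⟨_, cohom_apply_cohomInv hf hu t⟩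
  rw [cohomInv_apply_cohom hf hu]
  exact congrArg (fun F => F s) key

theorem aug_cohomInv (t : Words) : aug (cohomInv f t) = aug t := by
  rw [← cohom_inverse hf hu, aug_cohom (good_inverse hf hu).map_one]

/-- Since `cohom f` splits at an idempotent letter, so does its inverse; the projection to length
one then vanishes unless the word is that single letter. -/
theorem isUnital_inverse : IsUnital (inverse f) where
  one x := by
    rw [inverse, LinearMap.comp_apply, ← cohom_singleton hf.map_one hu, cohomInv_apply_cohom hf hu,
      proj1_singleton]
  unit w hw hk := by
    obtain ⟨k, u, v, rfl⟩ := idem_mem_split hk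
    have e : cohomInv f (word (u ++ idem k :: v)) =
        cohomInv f (word u) * (word [idem k] * cohomInv f (word v)) := by
      rw [← cohomInv_apply_cohom hf hu (_ * _), hu.cohom_sandwich hf.map_one,
        cohom_apply_cohomInv hf hu, cohom_apply_cohomInv hf hu, ← word_append, ← word_append]
      rfl
    rw [inverse, LinearMap.comp_apply, e, isUnital_proj1.apply_idem, aug_cohomInv hf hu,
      aug_cohomInv hf hu, aug_word, aug_word]
    by_cases h : u = []
    · subst h
      have : v ≠ [] := by rintro rfl; simp at hw
      simp [this]
    · simp [h]

end

/-- Two deformations with the same quartic operations on two words are related by mutually inverse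
homomorphisms. -/
theorem exists_inverse_homs {μ μ' : Cochain} (hg : Good (-1) μ) (hg' : Good (-1) μ')
    (hs : IsStrict μ) (hs' : IsStrict μ') (hr : μ ∘ₗ coder μ = 0) (hr' : μ' ∘ₗ coder μ' = 0)
    (h3 : μ (word (koszul 3 4)) = μ' (word (koszul 3 4)))
    (h4 : μ (word (koszul 4 4)) = μ' (word (koszul 4 4))) :
    ∃ f g : Cochain, Good 0 f ∧ Good 0 g ∧ IsUnital f ∧ IsUnital g ∧
      f ∘ₗ coder μ = μ' ∘ₗ cohom f ∧ g ∘ₗ coder μ' = μ ∘ₗ cohom g ∧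
      g ∘ₗ cohom f = proj1 ∧ f ∘ₗ cohom g = proj1 := by
  obtain ⟨f, hf, hu, h⟩ := exists_homRelation hg hg' hs hs' hr hr' h3 h4
  have hf0 := hf.map_one
  have hD : cohom f ∘ₗ coder μ - coder μ' ∘ₗ cohom f = 0 := words_ext fun w =>
    (isCoderAlong_homRelation hg hg' hf).eq_zero hf0 (n := w.length + 1)
      (fun _ _ => by rw [h]; rfl) w (by omega)
  have hD' : ∀ t, cohom f (coder μ t) = coder μ' (cohom f t) := fun t =>
    sub_eq_zero.1 (congrArg (fun F => F t) hD)
  refine ⟨f, inverse f, hf, good_inverse hf hu, hu, isUnital_inverse hf hu, sub_eq_zero.1 h, ?_,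
    ?_, ?_⟩
  · rw [cohom_inverse hf hu]
    refine LinearMap.ext fun t => ?_
    obtain ⟨s, rfl⟩ : ∃ s, cohom f s = t := ⟨_, cohom_apply_cohomInv hf hu t⟩
    rw [inverse, LinearMap.comp_apply, LinearMap.comp_apply, LinearMap.comp_apply, ← hD',
      cohomInv_apply_cohom hf hu, cohomInv_apply_cohom hf hu, proj1_coder hg.map_one]
  · refine LinearMap.ext fun t => ?_
    rw [inverse, LinearMap.comp_apply, LinearMap.comp_apply, cohomInv_apply_cohom hf hu]
  · rw [cohom_inverse hf hu]
    refine LinearMap.ext fun t => ?_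
    rw [LinearMap.comp_apply, ← proj1_cohom hf0, cohom_apply_cohomInv hf hu]

/-! ### Tensors of elements of the algebra -/

/-- The tensor of a list of elements of the algebra. -/
def tensor (l : List A) : Words := (l.map letter).prod

@[simp] theorem tensor_nil : tensor [] = 1 := rfl

theorem tensor_cons (a : A) (l : List A) : tensor (a :: l) = letter a * tensor l := by
  simp [tensor]

theorem tensor_append (l l' : List A) : tensor (l ++ l') = tensor l * tensor l' := by
  simp [tensor]

theorem tensor_map_of (w : List Basic) : tensor (w.map TorusAlg.of) = word w := by
  induction w with
  | nil => simp
  | cons x w ih => rw [List.map_cons, tensor_cons, ih, ← word_cons']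

theorem tensor_singleton (a : A) : tensor [a] = letter a := by simp [tensor_cons]

/-- Linear maps that agree on words of a given length agree on tensors of that length. -/
theorem tensor_ext {N : Type} [AddCommGroup N] [Module ℤ[X] N] {p q : Words →ₗ[ℤ[X]] N} {n : ℕ}
    (h : ∀ w : List Basic, w.length = n → p (word w) = q (word w)) {l : List A} (hl : l.length = n) :
    p (tensor l) = q (tensor l) := by
  induction l generalizing n p q with
  | nil => simpa using h [] (by simpa using hl)
  | cons a l ih =>
    rw [tensor_cons]
    have : p ∘ₗ LinearMap.mulRight ℤ[X] (tensor l) ∘ₗ letter =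
        q ∘ₗ LinearMap.mulRight ℤ[X] (tensor l) ∘ₗ letter := TorusAlg.hom_ext fun x => by
      simp only [LinearMap.comp_apply, letter_of, LinearMap.mulRight_apply]
      refine ih (n := l.length) (p := p ∘ₗ lmul (word [x])) (q := q ∘ₗ lmul (word [x]))
        (fun w hw => ?_) rfl
      simp only [LinearMap.comp_apply, LinearMap.mulLeft_apply, ← word_cons]
      exact h _ (by rw [List.length_cons, hw, ← hl, List.length_cons])
    exact congrArg (fun F => F a) this

theorem HasParity.apply_tensor {d : ℕ} {p : Cochain} (hp : HasParity d p) {l : List A}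
    (hl : l.length % 2 ≠ d % 2) : p (tensor l) = 0 :=
  tensor_ext (q := (0 : Cochain)) (fun w hw => hp w (by rw [hw]; exact hl)) rfl

theorem aug_tensor (l : List A) : aug (tensor l) = if l = [] then 1 else 0 := by
  cases l with
  | nil => simp
  | cons a l => rw [tensor_cons, aug_letter_mul]; simp

theorem proj1_tensor_of_length_ne_one {l : List A} (h : l.length ≠ 1) : proj1 (tensor l) = 0 :=
  tensor_ext (q := (0 : Cochain)) (fun w hw => proj1_of_length_ne_one (by rwa [hw])) rfl

theorem proj1_tensor (l : List A) : proj1 (tensor l) = idOn l := by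
  match l with
  | [a] => rw [tensor_singleton, proj1_letter, idOn]
  | [] => rw [proj1_tensor_of_length_ne_one (by simp)]; rfl
  | _ :: _ :: _ => rw [proj1_tensor_of_length_ne_one (by simp)]; rfl

theorem conv_proj1_letter_mul (q : Words →ₗ[ℤ[X]] Words) (a : A) (t : Words) :
    conv proj1 q (letter a * t) = letter a * q t := by
  have h1 : ∀ x, conv proj1 q ∘ₗ lmul (word [x]) = lmul (word [x]) ∘ₗ q := fun x =>
    words_ext fun w => by
      simp only [LinearMap.comp_apply, LinearMap.mulLeft_apply, ← word_cons, conv_proj1_cons]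
  have h2 : conv proj1 q ∘ₗ LinearMap.mulRight ℤ[X] t ∘ₗ letter =
      LinearMap.mulRight ℤ[X] (q t) ∘ₗ letter := TorusAlg.hom_ext fun x => by
    have := congrArg (fun F => F t) (h1 x)
    simpa using this
  exact congrArg (fun F => F a) h2

theorem conv_tensor (p : Cochain) (q : Words →ₗ[ℤ[X]] Words) (l : List A) :
    conv p q (tensor l) = splitSum (fun u v => letter (p (tensor u)) * q (tensor v)) l := by
  induction l generalizing p with
  | nil =>
    have := conv_word p q []
    simpa using this
  | cons a l ih =>
    rw [tensor_cons, conv_letter_mul, ih, splitSum_cons, tensor_nil, ← tensor_cons]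
    simp only [LinearMap.comp_apply, LinearMap.mulLeft_apply, ← tensor_cons]

theorem coder_letter_mul {μ : Cochain} (hμ : μ 1 = 0) (a : A) (t : Words) :
    coder μ (letter a * t) = conv μ LinearMap.id (letter a * t) - letter a * coder μ t := by
  conv_lhs => rw [coder_eq_conv hμ]
  rw [LinearMap.sub_apply, conv_proj1_letter_mul]

theorem neg_mul_smul_mul {R : Type*} [Ring R] (e : ℤ) (a x y : R) :
    -(a * e • (x * y)) = (e * -1) • (a * x * y) := by
  rw [mul_smul_comm, mul_neg_one, neg_smul, mul_assoc]

theorem coder_tensor {μ : Cochain} (hμ : μ 1 = 0) (l : List A) : coder μ (tensor l) =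
    ∑ r ∈ Finset.range (l.length + 1),
      (-1 : ℤ) ^ r • (tensor (l.take r) * conv μ LinearMap.id (tensor (l.drop r))) := by
  induction l with
  | nil =>
    have := conv_word μ LinearMap.id []
    rw [word_nil, splitSum_nil, word_nil, hμ, map_zero, zero_mul] at this
    rw [List.length_nil, Finset.sum_range_one, List.drop_nil, tensor_nil, this, mul_zero, smul_zero,
      coder_one]
  | cons a l ih =>
    rw [tensor_cons, coder_letter_mul hμ, ih, List.length_cons,
      Finset.sum_range_succ' _ (l.length + 1), Finset.mul_sum, sub_eq_neg_add,
      ← Finset.sum_neg_distrib]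
    refine congrArg₂ (· + ·) ?_ ?_
    · refine Finset.sum_congr rfl fun r _ => ?_
      rw [List.take_succ_cons, List.drop_succ_cons, tensor_cons, pow_succ]
      exact neg_mul_smul_mul _ _ _ _
    · rw [pow_zero, one_smul, List.take_zero, List.drop_zero, tensor_nil, one_mul, tensor_cons]

/-! ### Operations and cochains -/

/-- The sequence of operations of a cochain. -/
def Cochain.toOps (p : Cochain) : Ops := fun n =>
  p.compMultilinearMap ((MultilinearMap.mkPiAlgebraFin ℤ[X] n Words).compLinearMap fun _ => letter)

theorem Cochain.toOps_apply (p : Cochain) {n : ℕ} (a : Fin n → A) :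
    p.toOps n a = p (tensor (List.ofFn a)) := by
  rw [tensor, List.map_ofFn]
  simp [Cochain.toOps, MultilinearMap.mkPiAlgebraFin_apply, Function.comp_def]

theorem Cochain.ev_toOps (p : Cochain) (l : List A) : Ops.ev p.toOps l = p (tensor l) := by
  rw [Ops.ev, Cochain.toOps_apply, List.ofFn_get]

/-- The cochain of a sequence of operations. -/
def Ops.toCochain (f : Ops) : Cochain := lin fun w => f.ev (w.map TorusAlg.of)

theorem Ops.ev_ofFn (f : Ops) {n : ℕ} (a : Fin n → A) : f.ev (List.ofFn a) = f n a := by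
  have : ∀ (l : List A) (h : l.length = n), f.ev l = f n fun i => l.get (i.cast h.symm) := by
    rintro l rfl; rfl
  rw [this _ (List.length_ofFn)]
  congr 1
  ext i
  simp

/-- A multilinear map is determined by its values on paths, so cochains lose no information about
the operations. -/
theorem Ops.toOps_toCochain (f : Ops) : f.toCochain.toOps = f := by
  funext n
  refine Module.Basis.ext_multilinear (fun _ => TorusAlg.basis) fun v => ?_
  rw [Cochain.toOps_apply]
  have : (List.ofFn fun i => (TorusAlg.basis (R := ℤ[X])) (v i)) = (List.ofFn v).map TorusAlg.of := by
    rw [List.map_ofFn]; rfl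
  rw [this, tensor_map_of, Ops.toCochain, lin_word, ← this, Ops.ev_ofFn]

theorem Ops.ev_eq (f : Ops) (l : List A) : f.ev l = f.toCochain (tensor l) := by
  conv_lhs => rw [← f.toOps_toCochain]
  rw [Cochain.ev_toOps]

/-! ### The structure relations -/

/-- The sign exponents r + st and r differ by st. For s even this is even, and for s odd the inner
operation vanishes by parity. -/
theorem Ops.insert_eq {f μ : Ops} {p q : Cochain} (hf : ∀ l, f.ev l = p (tensor l))
    (hμ : ∀ l, μ.ev l = q (tensor l)) (hq : HasParity 0 q) (hq0 : q 1 = 0) (l : List A) :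
    f.insert μ l = p (coder q (tensor l)) := by
  rw [coder_tensor hq0, map_sum, Ops.insert]
  refine Finset.sum_congr rfl fun r hr => ?_
  rw [conv_tensor, splitSum_eq_sum, map_zsmul, Finset.mul_sum, map_sum, Finset.smul_sum,
    List.length_drop]
  refine Finset.sum_subset_zero_on_sdiff (fun s hs => ?_) (fun s hs => ?_) (fun s hs => ?_)
  · simp at hs ⊢; omega
  -- The empty block occurs in the coderivation but not in the structure relation; it contributes
  -- nothing because `q 1 = 0`.
  · have : s = 0 := by simp at hs; omega
    subst this
    simp [hq0]
  · rw [hf, hμ, tensor_append, tensor_cons, LinearMap.id_apply, List.drop_drop]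
    by_cases h : s % 2 = 0
    · congr 1
      rw [pow_add, pow_mul, (Nat.even_iff.2 h).neg_one_pow, one_pow, mul_one]
    · have h0 : q (tensor ((l.drop r).take s)) = 0 := hq.apply_tensor (by
        simp only [Finset.mem_Icc] at hs
        rw [List.length_take, List.length_drop, min_eq_left hs.2]
        exact h)
      simp [h0]

/-! ### Sums over compositions -/

/-- The blocks of the compositions of `n`. -/
def compositionBlocks : ℕ → Finset (List ℕ)
  | 0 => {[]}
  | n + 1 => (Finset.range (n + 1)).attach.biUnion fun k =>
      (compositionBlocks (n - k.1)).image (List.cons (k.1 + 1))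
decreasing_by omega

theorem compositionBlocks_succ (n : ℕ) : compositionBlocks (n + 1) =
    (Finset.range (n + 1)).biUnion fun k =>
      (compositionBlocks (n - k)).image (List.cons (k + 1)) := by
  rw [compositionBlocks]
  ext L
  simp

theorem mem_compositionBlocks {n : ℕ} {L : List ℕ} :
    L ∈ compositionBlocks n ↔ (∀ i ∈ L, 0 < i) ∧ L.sum = n := by
  induction n using Nat.strong_induction_on generalizing L with
  | _ n ih =>
    rcases n with _ | n
    · rw [compositionBlocks, Finset.mem_singleton]
      constructor
      · rintro rfl; simp
      · rintro ⟨h1, h2⟩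
        cases L with
        | nil => rfl
        | cons i L =>
          have := h1 i (by simp)
          simp at h2
          omega
    · rw [compositionBlocks_succ, Finset.mem_biUnion]
      constructor
      · rintro ⟨k, hk, h⟩
        obtain ⟨L, hL, rfl⟩ := Finset.mem_image.1 h
        rw [ih _ (by omega)] at hL
        simp only [Finset.mem_range] at hk
        refine ⟨?_, ?_⟩
        · simpa using hL.1
        · rw [List.sum_cons, hL.2]; omega
      · rintro ⟨h1, h2⟩
        cases L with
        | nil => simp at h2
        | cons i L =>
          have := h1 i (by simp)
          rw [List.sum_cons] at h2
          refine ⟨i - 1, by simp; omega, Finset.mem_image.2 ⟨L, ?_, by rw [Nat.sub_add_cancel this]⟩⟩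
          rw [ih _ (by omega)]
          exact ⟨fun j hj => h1 j (by simp [hj]), by omega⟩

theorem sum_composition {N : Type*} [AddCommMonoid N] (F : List ℕ → N) (n : ℕ) :
    ∑ c : Composition n, F c.blocks = ∑ L ∈ compositionBlocks n, F L := by
  refine Finset.sum_nbij (fun c => c.blocks) (fun c _ => ?_) (fun c _ c' _ h => Composition.ext h)
    (fun L hL => ?_) fun _ _ => rfl
  · exact mem_compositionBlocks.2 ⟨fun i hi => c.blocks_pos hi, c.blocks_sum⟩
  · obtain ⟨h1, h2⟩ := mem_compositionBlocks.1 hL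
    exact ⟨⟨L, fun {i} hi => h1 i hi, h2⟩, by simp, rfl⟩

theorem sum_compositionBlocks_succ {N : Type*} [AddCommMonoid N] (F : List ℕ → N) (n : ℕ) :
    ∑ L ∈ compositionBlocks (n + 1), F L =
      ∑ k ∈ Finset.range (n + 1), ∑ L ∈ compositionBlocks (n - k), F ((k + 1) :: L) := by
  rw [compositionBlocks_succ, Finset.sum_biUnion]
  · refine Finset.sum_congr rfl fun k _ => ?_
    rw [Finset.sum_image fun L _ L' _ h => List.cons_injective h]
  · intro k _ k' _ hne
    rw [Function.onFun, Finset.disjoint_left]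
    intro L hL hL'
    obtain ⟨M, _, rfl⟩ := Finset.mem_image.1 hL
    obtain ⟨M', _, h⟩ := Finset.mem_image.1 hL'
    simp at h
    exact hne h.1.symm

/-- Sorting compositions by their first block reproduces the recursion for the coalgebra map. -/
theorem sum_tensor_blocks {f : Ops} {q : Cochain} (hf : ∀ l, f.ev l = q (tensor l))
    (hq0 : q 1 = 0) (l : List A) :
    ∑ L ∈ compositionBlocks l.length, tensor ((l.splitWrtCompositionAux L).map f.ev) =
      cohom q (tensor l) := by
  induction hn : l.length using Nat.strong_induction_on generalizing l with
  | _ n ih =>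
    subst hn
    cases l with
    | nil => simp [compositionBlocks, List.splitWrtCompositionAux]
    | cons a l =>
      conv_rhs => rw [cohom_eq_conv hq0]
      rw [List.length_cons, sum_compositionBlocks_succ, LinearMap.add_apply, conv_tensor,
        splitSum_eq_sum, List.length_cons, Finset.sum_range_succ' _ (l.length + 1)]
      simp only [LinearMap.comp_apply, aug_tensor, List.take_zero, tensor_nil, hq0, map_zero,
        zero_mul, add_zero, reduceCtorEq, if_false]
      refine Finset.sum_congr rfl fun k _ => ?_
      rw [← ih (l.length - k) (by rw [List.length_cons]; omega) ((a :: l).drop (k + 1)) (by simp), Finset.mul_sum]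
      refine Finset.sum_congr rfl fun L _ => ?_
      rw [List.splitWrtCompositionAux_cons, List.map_cons, tensor_cons, hf]

/-- A block of odd length contributes an even amount to σ, and a block of even length makes the
tensor vanish, so the sign never matters. -/
theorem neg_one_pow_sigma_smul {f : Ops} {q : Cochain} (hf : ∀ l, f.ev l = q (tensor l))
    (hq : HasParity 1 q) (L : List ℕ) (l : List A) (hL : L.sum = l.length) :
    (-1 : ℤ) ^ sigma L • tensor ((l.splitWrtCompositionAux L).map f.ev) =
      tensor ((l.splitWrtCompositionAux L).map f.ev) := by
  induction L generalizing l with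
  | nil => simp [sigma]
  | cons i L ih =>
    rw [List.sum_cons] at hL
    rw [List.splitWrtCompositionAux_cons, List.map_cons, tensor_cons, sigma]
    by_cases h : i % 2 = 1
    · have : Even (L.length * (i - 1)) := (Nat.even_iff.2 (by omega)).mul_left _
      rw [pow_add, this.neg_one_pow, one_mul, ← mul_smul_comm, ih _ (by rw [List.length_drop]; omega)]
    · have : f.ev (l.take i) = 0 := by
        rw [hf]
        exact hq.apply_tensor (by rw [List.length_take, min_eq_left (by omega)]; exact h)
      rw [this, map_zero, zero_mul, smul_zero]

theorem Ops.comp_eq {g f : Ops} {p q : Cochain} (hg : ∀ l, g.ev l = p (tensor l))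
    (hf : ∀ l, f.ev l = q (tensor l)) (hq : HasParity 1 q) (l : List A) :
    g.comp f l = p (cohom q (tensor l)) := by
  rw [← sum_tensor_blocks hf hq.map_one, map_sum, Ops.comp]
  have := sum_composition (fun L => p ((-1 : ℤ) ^ sigma L •
    tensor ((l.splitWrtCompositionAux L).map f.ev))) l.length
  refine Eq.trans ?_ (this.trans (Finset.sum_congr rfl fun L hL => ?_))
  · refine Finset.sum_congr rfl fun c _ => ?_
    rw [map_zsmul, hg]; rfl
  · rw [neg_one_pow_sigma_smul hf hq L l (mem_compositionBlocks.1 hL).2]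

/-! ### Operations of homogeneous cochains -/

section

variable {j : ℤ} {p : Cochain} (hp : Good j p)
include hp

theorem Good.toOps_zero : p.toOps 0 = 0 := by
  ext a
  rw [Cochain.toOps_apply]
  simp [hp.map_one]

theorem Good.apply_iota_mul (k : Fin 2) (a : A) (t : Words) :
    p (letter (iota k * a) * t) = iota k * p (letter a * t) := by
  have h1 : ∀ x, p ∘ₗ lmul (letter (iota k * TorusAlg.of x)) =
      TorusAlg.mulHom (iota k) ∘ₗ p ∘ₗ lmul (word [x]) := fun x => words_ext fun w => by
    change p (letter (iota k * TorusAlg.of x) * word w) = iota k * p (word [x] * word w)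
    rw [← word_cons, hp.iota_mul, iota_mul_of]
    split_ifs
    · rw [← word_cons']
    · simp
  have h2 : p ∘ₗ LinearMap.mulRight ℤ[X] t ∘ₗ letter ∘ₗ TorusAlg.mulHom (iota k) =
      TorusAlg.mulHom (iota k) ∘ₗ p ∘ₗ LinearMap.mulRight ℤ[X] t ∘ₗ letter :=
    TorusAlg.hom_ext fun x => by
      have := congrArg (fun F => F t) (h1 x)
      rw [← letter_of] at this
      exact this
  exact congrArg (fun F => F a) h2

theorem Good.apply_mul_iota (k : Fin 2) (a : A) (t : Words) :
    p (t * letter (a * iota k)) = p (t * letter a) * iota k := by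
  have h1 : ∀ x, p ∘ₗ LinearMap.mulRight ℤ[X] (letter (TorusAlg.of x * iota k)) =
      TorusAlg.mulHom.flip (iota k) ∘ₗ p ∘ₗ LinearMap.mulRight ℤ[X] (word [x]) := fun x =>
    words_ext fun w => by
      change p (word w * letter (TorusAlg.of x * iota k)) = p (word w * word [x]) * iota k
      rw [← word_append, hp.mul_iota, of_mul_iota]
      split_ifs
      · rw [letter_of, ← word_append]
      · simp
  have h2 : p ∘ₗ lmul t ∘ₗ letter ∘ₗ TorusAlg.mulHom.flip (iota k) =
      TorusAlg.mulHom.flip (iota k) ∘ₗ p ∘ₗ lmul t ∘ₗ letter :=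
    TorusAlg.hom_ext fun x => by
      have := congrArg (fun F => F t) (h1 x)
      rw [← letter_of] at this
      exact this
  exact congrArg (fun F => F a) h2

/-- On paths, an idempotent in the middle acts identically from either side when the neighbours
compose; when they do not, the cochain already vanishes. The rest is linearity in each tensor
factor. -/
theorem Good.apply_balanced (k : Fin 2) (a b : A) (s t : Words) :
    p (s * (letter (a * iota k) * (letter b * t))) =
      p (s * (letter a * (letter (iota k * b) * t))) := by
  have h1 : ∀ x y, ∀ s t, p (s * (letter (TorusAlg.of x * iota k) * (letter (TorusAlg.of y) * t))) =
      p (s * (letter (TorusAlg.of x) * (letter (iota k * TorusAlg.of y) * t))) := by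
    intro x y s t
    refine words_ext₂ (f := ((LinearMap.mul ℤ[X] Words).compl₂
        (lmul (letter (TorusAlg.of x * iota k)) ∘ₗ lmul (letter (TorusAlg.of y)))).compr₂ p)
      (g := ((LinearMap.mul ℤ[X] Words).compl₂
        (lmul (letter (TorusAlg.of x)) ∘ₗ lmul (letter (iota k * TorusAlg.of y)))).compr₂ p)
      (fun u v => ?_) s t
    change p (word u * (letter (TorusAlg.of x * iota k) * (letter (TorusAlg.of y) * word v))) =
      p (word u * (letter (TorusAlg.of x) * (letter (iota k * TorusAlg.of y) * word v)))
    rw [of_mul_iota, iota_mul_of]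
    by_cases h : x.target = y.source
    · rw [h]; split_ifs <;> simp
    · have h0 : p (word u * (letter (TorusAlg.of x) * (letter (TorusAlg.of y) * word v))) = 0 := by
        rw [← word_cons', ← word_cons', ← word_append]
        exact hp.eq_zero_of_ne u v h
      split_ifs <;> simp only [h0, map_zero, zero_mul, mul_zero]
  have h2 : ∀ x, p ∘ₗ lmul s ∘ₗ lmul (letter (TorusAlg.of x * iota k)) ∘ₗ
        LinearMap.mulRight ℤ[X] t ∘ₗ letter =
      p ∘ₗ lmul s ∘ₗ lmul (letter (TorusAlg.of x)) ∘ₗ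
        LinearMap.mulRight ℤ[X] t ∘ₗ letter ∘ₗ TorusAlg.mulHom (iota k) := fun x =>
    TorusAlg.hom_ext fun y => h1 x y s t
  have h3 : p ∘ₗ lmul s ∘ₗ LinearMap.mulRight ℤ[X] (letter b * t) ∘ₗ letter ∘ₗ
        TorusAlg.mulHom.flip (iota k) =
      p ∘ₗ lmul s ∘ₗ LinearMap.mulRight ℤ[X] (letter (iota k * b) * t) ∘ₗ letter :=
    TorusAlg.hom_ext fun x => congrArg (fun F => F b) (h2 x)
  exact congrArg (fun F => F a) h3

theorem Good.isGroundLinear : Ops.IsGroundLinear p.toOps where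
  left k a l := by
    rw [Cochain.ev_toOps, Cochain.ev_toOps, tensor_cons, tensor_cons, hp.apply_iota_mul]
  right k a l := by
    rw [Cochain.ev_toOps, Cochain.ev_toOps, tensor_append, tensor_append, tensor_singleton,
      tensor_singleton, hp.apply_mul_iota]
  balanced k a b l l' := by
    simp only [Cochain.ev_toOps, tensor_append, tensor_cons]
    exact hp.apply_balanced k a b _ _

/-- The homogeneous elements of the algebra. -/
def stdPiece (g : Grp) : AddSubgroup A := grpGrading.homA (lam * g)

omit hp in
theorem tensor_mem {l : List A} {g : List Grp}
    (h : List.Forall₂ (fun a g => a ∈ stdPiece g) l g) :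
    tensor l ∈ grpGrading.homW (lam ^ l.length * g.prod) := by
  induction h with
  | nil => simpa using PathGrading.word_mem_homW (γ := grpGrading) []
  | @cons a g l gs ha _ ih =>
    rw [tensor_cons, List.length_cons, List.prod_cons]
    have := PathGrading.mul_mem_homW (PathGrading.letter_mem_homW ha) ih
    have e : lam ^ l.length * g = g * lam ^ l.length :=
      ((show Commute lam g from lam_mul_comm g).pow_left _).eq
    rwa [mul_assoc, ← mul_assoc g, ← e, mul_assoc, ← mul_assoc lam, ← pow_succ'] at this

/-- The n shifted inputs contribute λⁿ and the shifted output removes one λ, so a cochain of degree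
j moves unshifted degrees by λ^(n + j − 1). This is λ^(n − 2) for structure maps and λ^(n − 1) for
homomorphisms. -/
theorem Good.isHomogeneous : Ops.IsHomogeneous p.toOps (1 - j) stdPiece stdPiece := by
  intro n a g h
  rw [Cochain.toOps_apply]
  have h1 : List.Forall₂ (fun a g => a ∈ stdPiece g) (List.ofFn a) (List.ofFn g) := by
    rw [List.forall₂_iff_get]
    refine ⟨by simp, fun i h1 h2 => ?_⟩
    simpa using h ⟨i, by simpa using h1⟩
  have := hp.isHom_grp.apply_mem (tensor_mem h1)
  rw [List.length_ofFn, ← mul_assoc, ← zpow_natCast, ← zpow_add] at this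
  rw [stdPiece, ← mul_assoc, ← zpow_one_add]
  convert this using 3
  ring

end

theorem IsStrict.toOps_eq_zero {p : Cochain} (hp : IsStrict p) {l : List A} (hl : 3 ≤ l.length)
    (h : ∃ k, iota k ∈ l) : Ops.ev p.toOps l = 0 := by
  obtain ⟨k, hk⟩ := h
  obtain ⟨u, v, rfl⟩ := List.append_of_mem hk
  rw [Cochain.ev_toOps, tensor_append, tensor_cons, iota, letter_of, hp.apply_idem, aug_tensor,
    aug_tensor]
  rw [List.length_append, List.length_cons] at hl
  by_cases hu : u = []
  · subst hu
    rw [List.length_nil] at hl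
    rw [proj1_tensor_of_length_ne_one (l := v) (by omega)]
    simp
  · by_cases hv : v = []
    · subst hv
      rw [List.length_nil] at hl
      rw [proj1_tensor_of_length_ne_one (l := u) (by omega)]
      simp
    · simp [hu, hv]

theorem IsUnital.toOps_eq_zero {p : Cochain} (hp : IsUnital p) {l : List A} (hl : 2 ≤ l.length)
    (h : ∃ k, iota k ∈ l) : Ops.ev p.toOps l = 0 := by
  obtain ⟨k, hk⟩ := h
  obtain ⟨u, v, rfl⟩ := List.append_of_mem hk
  rw [Cochain.ev_toOps, tensor_append, tensor_cons, iota, letter_of, hp.apply_idem, aug_tensor,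
    aug_tensor]
  by_cases hu : u = []
  · subst hu
    rw [if_neg (c := v = []) (by rintro rfl; simp at hl)]
    simp
  · simp [hu]

theorem IsUnital.toOps_singleton {p : Cochain} (hp : IsUnital p) (a : A) :
    Ops.ev p.toOps [a] = a := by
  rw [Cochain.ev_toOps, tensor_singleton, hp.apply_letter]

/-! ### Gradings -/

theorem mem_stdPiece (b : Basic) (k : ℕ) :
    (Polynomial.X : ℤ[X]) ^ k • (TorusAlg.of b : A) ∈ stdPiece (b.gr * gU ^ k) := by
  have := PathGrading.monomial_mem_homA (γ := grpGrading) k b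
  rwa [show grpGrading.deg b * grpGrading.var ^ k = lam * (b.gr * gU ^ k) from mul_assoc _ _ _]
    at this

theorem stdPiece_le {g : Grp} {S : AddSubgroup A}
    (h : ∀ b k, b.gr * gU ^ k = g → (Polynomial.X : ℤ[X]) ^ k • (TorusAlg.of b : A) ∈ S) :
    stdPiece g ≤ S :=
  PathGrading.homA_induction fun k b e => h b k (mul_left_cancel ((mul_assoc _ _ _).symm.trans e))

theorem iSup_stdPiece : ⨆ g, stdPiece g = ⊤ :=
  (AddSubgroup.eq_top_iff' _).2 (mem_of_monomials fun k b =>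
    (le_iSup stdPiece (b.gr * gU ^ k)) (mem_stdPiece b k))

theorem iSupIndep_stdPiece : iSupIndep stdPiece := by
  intro g
  rw [AddSubgroup.disjoint_def]
  intro x hx hx'
  refine coefA_ext fun b k => ?_
  rw [map_zero]
  by_cases h : grpGrading.deg b * grpGrading.var ^ k = lam * g
  · have : ⨆ (g') (_ : g' ≠ g), stdPiece g' ≤ (coefA b k).ker := iSup₂_le fun g' hg' y hy => by
      rw [AddMonoidHom.mem_ker]
      exact PathGrading.coefA_eq_zero hy fun h' => hg' (mul_left_cancel (h'.symm.trans h))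
    exact this hx'
  · exact PathGrading.coefA_eq_zero hx h

/-- A family that already spans cannot be enlarged piecewise without losing independence. -/
theorem iSupIndep.eq_of_le {ι M : Type*} [AddCommGroup M] {S T : ι → AddSubgroup M}
    (hT : iSupIndep T) (hS : ⨆ i, S i = ⊤) (h : S ≤ T) : T = S := by
  refine le_antisymm (fun i x hx => ?_) h
  have hx' : x ∈ S i ⊔ ⨆ (k) (_ : k ≠ i), S k := by rw [← iSup_split_single, hS]; trivial
  obtain ⟨y, hy, z, hz, rfl⟩ := AddSubgroup.mem_sup.1 hx'
  have hz' : z ∈ ⨆ (k) (_ : k ≠ i), T k :=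
    (iSup₂_mono fun k _ => h k : ⨆ (k) (_ : k ≠ i), S k ≤ _) hz
  have hz'' : z ∈ T i := by
    have := sub_mem hx (h i hy)
    rwa [add_sub_cancel_left] at this
  rw [AddSubgroup.disjoint_def.1 (hT i) hz'' hz', add_zero]
  exact hy

namespace GradedDeformation

variable (D : GradedDeformation)

theorem mul_mem {a b : A} {g h : Grp} (ha : a ∈ D.piece g) (hb : b ∈ D.piece h) :
    a * b ∈ D.piece (g * h) := by
  have := D.homogeneous 2 ![a, b] ![g, h] (by
    intro i; fin_cases i
    · exact ha
    · exact hb)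
  rw [← Ops.ev_ofFn, show List.ofFn ![a, b] = [a, b] by simp, D.μ_two] at this
  simpa using this

theorem of_chord_mem (i : ZMod 4) (n : ℕ) : (TorusAlg.of (chord i n) : A) ∈
    D.piece (chordGr i n) := by
  induction n with
  | zero => exact D.rho_mem i
  | succ n ih =>
    have := D.mul_mem ih (D.rho_mem (i + n + 1))
    rw [rho, chord_mul_chord] at this
    exact this

theorem of_mem (b : Basic) : (TorusAlg.of b : A) ∈ D.piece b.gr := by
  cases b with
  | idem k => exact D.iota_mem k
  | chord i n => exact D.of_chord_mem i n

variable {D}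

theorem smul_iota_mem {i j k l : ZMod 4} {s : Fin 2}
    (h : D.μ.ev [rho i, rho j, rho k, rho l] = (Polynomial.X : ℤ[X]) • iota s)
    (hg : lam ^ 2 * (gammaRho i * (gammaRho j * (gammaRho k * gammaRho l))) = gU) :
    (Polynomial.X : ℤ[X]) • iota s ∈ D.piece gU := by
  have := D.homogeneous 4 ![rho i, rho j, rho k, rho l]
    ![gammaRho i, gammaRho j, gammaRho k, gammaRho l] (by
      intro r; fin_cases r <;> exact D.rho_mem _)
  rw [← Ops.ev_ofFn, show List.ofFn ![rho i, rho j, rho k, rho l] = [rho i, rho j, rho k, rho l] by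
    simp, h] at this
  have e : (lam ^ (((4 : ℕ) : ℤ) - 2) * (List.ofFn ![gammaRho i, gammaRho j, gammaRho k,
      gammaRho l]).prod) = gU := by
    rw [← hg]; simp
  rwa [e] at this

/-- Homogeneity of μ₄ puts U times each idempotent in the degree `gU`, and homogeneity of μ₂ then
puts every monomial in its standard degree. So the standard pieces lie in those of the deformation,
and both families being decompositions forces equality. -/
theorem piece_eq
    (h1 : D.μ.ev [rho 4, rho 3, rho 2, rho 1] = (Polynomial.X : ℤ[X]) • iota 1)
    (h0 : D.μ.ev [rho 3, rho 2, rho 1, rho 4] = (Polynomial.X : ℤ[X]) • iota 0) :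
    D.piece = stdPiece := by
  have hU : ∀ s, (Polynomial.X : ℤ[X]) • iota s ∈ D.piece gU := by
    intro s
    have : s = 0 ∨ s = 1 := by revert s; decide
    rcases this with rfl | rfl
    · refine smul_iota_mem h0 ?_
      apply Grp.ext <;>
      simp +decide [pow_two, m_gU, a_gU, b_gU, Grp.m_mul, Grp.a_mul, Grp.b_mul,
        Grp.m_gammaRho, Grp.a_gammaRho, Grp.b_gammaRho, Grp.m_lam, Grp.a_lam, Grp.b_lam] <;> norm_num
    · refine smul_iota_mem h1 ?_
      apply Grp.ext <;>
      simp +decide [pow_two, m_gU, a_gU, b_gU, Grp.m_mul, Grp.a_mul, Grp.b_mul,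
        Grp.m_gammaRho, Grp.a_gammaRho, Grp.b_gammaRho, Grp.m_lam, Grp.a_lam, Grp.b_lam] <;> norm_num
  refine iSupIndep.eq_of_le D.independent iSup_stdPiece fun g => stdPiece_le fun b k e => ?_
  subst e
  induction k with
  | zero => simpa using D.of_mem b
  | succ k ih =>
    have := D.mul_mem (hU b.source) ih
    rw [smul_mulA, mul_smulA, iota_mul_of, if_pos rfl, smul_smul, ← pow_succ', gU_mul_comm,
      mul_assoc, ← pow_succ] at this
    exact this

end GradedDeformation

/-! ### Cochains of homogeneous operations -/

theorem wdeg_fst_cases (x : Basic) (w : List Basic) :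
    (∃ u a b v, x :: w = u ++ a :: b :: v ∧ a.target ≠ b.source) ∨
      (pathGrading.wdeg (x :: w)).1 =
        Matrix.single x.source ((x :: w).getLast (by simp)).target 1 := by
  induction w generalizing x with
  | nil => right; simp [pathGrading]
  | cons y w ih =>
    by_cases h : x.target = y.source
    · rcases ih y with ⟨u, a, b, v, e, hab⟩ | e
      · exact Or.inl ⟨x :: u, a, b, v, by rw [e]; rfl, hab⟩
      · right
        rw [PathGrading.wdeg_cons, Prod.fst_mul, e]
        simp [pathGrading, h]
    · exact Or.inl ⟨[], x, y, w, rfl, h⟩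

theorem mem_homA_path {s t : Fin 2} {g : Grp} {a : A} (ha : a ∈ grpGrading.homA g)
    (hs : iota s * a = a) (ht : a * iota t = a) :
    a ∈ pathGrading.homA (Matrix.single s t 1, g) := by
  have : grpGrading.homA g ≤ (pathGrading.homA (Matrix.single s t 1, g)).comap
      ((AddMonoidHom.mulRight (iota t)).comp (AddMonoidHom.mulLeft (iota s))) :=
    PathGrading.homA_induction fun k b e => by
      rw [AddSubgroup.mem_comap, AddMonoidHom.comp_apply, AddMonoidHom.coe_mulLeft,
        AddMonoidHom.mulRight_apply, mul_smulA, iota_mul_of]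
      split_ifs with h
      · rw [smul_mulA, of_mul_iota]
        split_ifs with h'
        · have e' : (Matrix.single s t 1, g) =
              pathGrading.deg b * pathGrading.var ^ k := by
            rw [← e, h, h']
            exact Prod.ext (by simp [pathGrading]) (by simp [pathGrading, grpGrading])
          rw [e']
          exact PathGrading.monomial_mem_homA k b
        · rw [smul_zero]; exact zero_mem _
      · rw [smul_zero, zero_mul]; exact zero_mem _
  have h := this ha
  rw [AddSubgroup.mem_comap, AddMonoidHom.comp_apply, AddMonoidHom.coe_mulLeft,
    AddMonoidHom.mulRight_apply, hs, ht] at h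
  exact h

theorem grpGrading_wdeg (w : List Basic) :
    grpGrading.wdeg w = lam ^ w.length * (w.map Basic.gr).prod := by
  induction w with
  | nil => simp
  | cons x w ih =>
    have e : lam ^ w.length * x.gr = x.gr * lam ^ w.length :=
      ((show Commute lam x.gr from lam_mul_comm x.gr).pow_left _).eq
    rw [PathGrading.wdeg_cons, ih, List.length_cons, List.map_cons, List.prod_cons, pow_succ',
      mul_assoc lam, ← mul_assoc _ x.gr, e]
    simp only [grpGrading, mul_assoc]

/-- The end-point part of the degree comes from linearity over the idempotents, and the Γ-part from
homogeneity. The exponent of λ is corrected by the shift of each letter. -/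
theorem good_toCochain {f : Ops} {j : ℤ} (h0 : f 0 = 0) (hl : f.IsGroundLinear)
    (hh : f.IsHomogeneous (1 - j) stdPiece stdPiece) : Good j f.toCochain := by
  intro w
  rw [Ops.toCochain, lin_word]
  cases w with
  | nil =>
    rw [show f.ev (List.map TorusAlg.of []) = 0 from by
      show f 0 _ = 0
      rw [h0]; rfl]
    exact zero_mem _
  | cons x w =>
    rcases wdeg_fst_cases x w with ⟨u, a, b, v, e, hab⟩ | e
    · rw [e, List.map_append, List.map_cons, List.map_cons]
      -- An idempotent inserted at a pair that does not compose passes to the next letter and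
      -- annihilates it.
      have ha : (TorusAlg.of a : A) = TorusAlg.of a * iota a.target := by
        rw [of_mul_iota, if_pos rfl]
      rw [ha, hl.balanced, iota_mul_of, if_neg hab, Ops.ev_eq, tensor_append, tensor_cons,
        tensor_cons, map_zero, zero_mul, mul_zero, mul_zero, map_zero]
      exact zero_mem _
    · have h1 : f.ev ((x :: w).map TorusAlg.of) ∈ grpGrading.homA
          (lam ^ j * grpGrading.wdeg (x :: w)) := by
        have hof : ∀ b : Basic, (TorusAlg.of b : A) ∈ stdPiece b.gr := fun b => by
          simpa using mem_stdPiece b 0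
        have := hh (x :: w).length (fun i => TorusAlg.of ((x :: w).get i))
          (fun i => ((x :: w).get i).gr) fun i => hof _
        rw [← Ops.ev_ofFn] at this
        have e1 : (List.ofFn fun i => (TorusAlg.of ((x :: w).get i) : A)) =
            (x :: w).map TorusAlg.of := by
          conv_rhs => rw [← List.ofFn_get (x :: w), List.map_ofFn]
          rfl
        have e2 : (List.ofFn fun i => ((x :: w).get i).gr) = (x :: w).map Basic.gr := by
          conv_rhs => rw [← List.ofFn_get (x :: w), List.map_ofFn]
          rfl
        rw [e1, e2, stdPiece, ← mul_assoc, ← zpow_one_add] at this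
        rw [grpGrading_wdeg, ← mul_assoc, ← zpow_natCast, ← zpow_add]
        convert this using 3
        refine congrArg (lam ^ ·) ?_
        ring
      have h2 : iota x.source * f.ev ((x :: w).map TorusAlg.of) = f.ev ((x :: w).map TorusAlg.of) := by
        rw [List.map_cons, ← hl.left, iota_mul_of, if_pos rfl]
      have h3 : f.ev ((x :: w).map TorusAlg.of) * iota ((x :: w).getLast (by simp)).target =
          f.ev ((x :: w).map TorusAlg.of) := by
        have e1 : (x :: w).map (TorusAlg.of (R := ℤ[X])) = (x :: w).dropLast.map TorusAlg.of ++
            [TorusAlg.of ((x :: w).getLast (by simp))] := by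
          conv_lhs => rw [← List.dropLast_append_getLast (l := x :: w) (by simp)]
          rw [List.map_append]; rfl
        rw [e1, ← hl.right, of_mul_iota, if_pos rfl]
      have h4 := mem_homA_path h1 h2 h3
      convert h4 using 2
      refine Prod.ext ?_ ?_
      · rw [Prod.fst_mul, shift_fst, one_mul, e]
      · rw [Prod.snd_mul, wdeg_grp]; rfl

namespace GradedDeformation

variable {D : GradedDeformation}
  (h1 : D.μ.ev [rho 4, rho 3, rho 2, rho 1] = (Polynomial.X : ℤ[X]) • iota 1)
  (h0 : D.μ.ev [rho 3, rho 2, rho 1, rho 4] = (Polynomial.X : ℤ[X]) • iota 0)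
include h1 h0

theorem good : Good (-1) D.μ.toCochain := by
  refine good_toCochain D.μ_zero D.groundLinear ?_
  have := D.homogeneous
  rw [piece_eq h1 h0] at this
  exact this

omit h1 h0 in
theorem isStrict : IsStrict D.μ.toCochain where
  one x := by
    rw [Ops.toCochain, lin_word]
    show D.μ 1 _ = 0
    rw [D.μ_one]; rfl
  two x y := by
    rw [Ops.toCochain, lin_word]
    exact D.μ_two _ _
  unit w hw hk := by
    rw [Ops.toCochain, lin_word]
    refine D.unital _ (by simpa using hw) ?_
    obtain ⟨k, hk⟩ := hk
    exact ⟨k, List.mem_map_of_mem hk⟩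

theorem relation_toCochain : D.μ.toCochain ∘ₗ coder D.μ.toCochain = 0 := words_ext fun w => by
  have hg := good h1 h0
  have := D.relation (w.map TorusAlg.of)
  rwa [Ops.insert_eq D.μ.ev_eq D.μ.ev_eq (hg.hasParity (by norm_num)) hg.map_one, tensor_map_of]
    at this

omit h0 in
theorem koszul_four : D.μ.toCochain (word (koszul 4 4)) = (Polynomial.X : ℤ[X]) • iota 1 := by
  rw [Ops.toCochain, lin_word]; exact h1

omit h1 in
theorem koszul_three : D.μ.toCochain (word (koszul 3 4)) = (Polynomial.X : ℤ[X]) • iota 0 := by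
  rw [Ops.toCochain, lin_word]; exact h0

end GradedDeformation

/-- The graded deformation of a cochain. -/
def deformationOfCochain {p : Cochain} (hg : Good (-1) p) (hs : IsStrict p)
    (hr : p ∘ₗ coder p = 0) : GradedDeformation where
  μ := p.toOps
  μ_zero := hg.toOps_zero
  μ_one := by
    ext a
    rw [Cochain.toOps_apply, List.ofFn_succ, List.ofFn_zero, tensor_singleton, hs.apply_letter]
    rfl
  μ_two a b := by
    rw [Cochain.ev_toOps, tensor_cons, tensor_singleton, hs.apply_letter_mul]
  groundLinear := hg.isGroundLinear
  unital l hl h := hs.toOps_eq_zero hl h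
  relation l := by
    rw [Ops.insert_eq p.ev_toOps p.ev_toOps (hg.hasParity (by norm_num)) hg.map_one]
    exact congrArg (fun F => F (tensor l)) hr
  piece := stdPiece
  independent := iSupIndep_stdPiece
  span := iSup_stdPiece
  iota_mem j := by
    have := mem_stdPiece (idem j) 0
    rw [pow_zero, pow_zero, mul_one, one_smul] at this
    exact this
  rho_mem i := by
    have := mem_stdPiece (chord i 0) 0
    rw [pow_zero, pow_zero, mul_one, one_smul] at this
    exact this
  homogeneous := hg.isHomogeneous

theorem isHom_toOps {D E : GradedDeformation} (hD : D.piece = stdPiece) (hE : E.piece = stdPiece)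
    {f : Cochain} (hf : Good 0 f) (hu : IsUnital f) (hg : Good (-1) D.μ.toCochain)
    (h : f ∘ₗ coder D.μ.toCochain = E.μ.toCochain ∘ₗ cohom f) : IsHom D E f.toOps where
  zero := hf.toOps_zero
  groundLinear := hf.isGroundLinear
  unital_one j := hu.toOps_singleton _
  unital l hl hk := hu.toOps_eq_zero hl hk
  relation l := by
    rw [Ops.insert_eq f.ev_toOps D.μ.ev_eq (hg.hasParity (by norm_num)) hg.map_one,
      Ops.comp_eq E.μ.ev_eq f.ev_toOps (hf.hasParity (by norm_num))]
    exact congrArg (fun F => F (tensor l)) h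
  homogeneous := by rw [hD, hE]; exact hf.isHomogeneous

theorem comp_toOps {f g : Cochain} (hf : Good 0 f) (h : g ∘ₗ cohom f = proj1) :
    Ops.comp g.toOps f.toOps = idOn := by
  funext l
  rw [Ops.comp_eq g.ev_toOps f.ev_toOps (hf.hasParity (by norm_num)), ← proj1_tensor]
  exact congrArg (fun F => F (tensor l)) h

end TorusAInf

end

/-! ### The theorem -/

open TorusAInf in
theorem mainTheorem10 :
    (∃ D : GradedDeformation,
      D.μ.ev [rho 4, rho 3, rho 2, rho 1] = (Polynomial.X : ℤ[X]) • iota 1 ∧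
      D.μ.ev [rho 3, rho 2, rho 1, rho 4] = (Polynomial.X : ℤ[X]) • iota 0) ∧
    ∀ D E : GradedDeformation,
      D.μ.ev [rho 4, rho 3, rho 2, rho 1] = (Polynomial.X : ℤ[X]) • iota 1 →
      D.μ.ev [rho 3, rho 2, rho 1, rho 4] = (Polynomial.X : ℤ[X]) • iota 0 →
      E.μ.ev [rho 4, rho 3, rho 2, rho 1] = (Polynomial.X : ℤ[X]) • iota 1 →
      E.μ.ev [rho 3, rho 2, rho 1, rho 4] = (Polynomial.X : ℤ[X]) • iota 0 →
      ∃ f : Ops, IsIso D E f := by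
  refine ⟨?_, fun D E hD1 hD0 hE1 hE0 => ?_⟩
  · obtain ⟨p, hg, hs, h4, hr⟩ := exists_relation
    -- The two prescribed inputs are the critical words of length 4 starting with ρ₄ and with ρ₃;
    -- their indices decrease cyclically modulo 4.
    have e4 : tensor [rho 4, rho 3, rho 2, rho 1] = word (koszul 4 4) :=
      tensor_map_of (koszul 4 4)
    have e3 : tensor [rho 3, rho 2, rho 1, rho 4] = word (koszul 3 4) :=
      tensor_map_of (koszul 3 4)
    refine ⟨deformationOfCochain hg hs hr, ?_, ?_⟩
    · exact (p.ev_toOps _).trans (by rw [e4, h4]; rfl)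
    · exact (p.ev_toOps _).trans (by rw [e3, h4]; rfl)
  · have hgD := GradedDeformation.good hD1 hD0
    have hgE := GradedDeformation.good hE1 hE0
    obtain ⟨f, g, hf, hg, hfu, hgu, h1, h2, h3, h4⟩ := exists_inverse_homs hgD hgE
      GradedDeformation.isStrict GradedDeformation.isStrict
      (GradedDeformation.relation_toCochain hD1 hD0) (GradedDeformation.relation_toCochain hE1 hE0)
      ((GradedDeformation.koszul_three hD0).trans (GradedDeformation.koszul_three hE0).symm)
      ((GradedDeformation.koszul_four hD1).trans (GradedDeformation.koszul_four hE1).symm)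
    have hpD := GradedDeformation.piece_eq hD1 hD0
    have hpE := GradedDeformation.piece_eq hE1 hE0
    exact ⟨f.toOps, isHom_toOps hpD hpE hf hfu hgD h1, hfu.toOps_singleton, g.toOps,
      isHom_toOps hpE hpD hg hgu hgE h2, comp_toOps hf h3, comp_toOps hg h4⟩
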